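/- **Conventions.** All 2-complexes are combinatorial: each 2-cell $R\to X$ is attached by mapping the boundary circle $\partial R$ of a polygon with $|\partial R|\ge 1$ sides to a closed edge path of $X^{(1)}$, and this boundary path is immersed, i.e. has no backtracks, even cyclically. Maps between complexes are combinatorial (each open cell is mapped homeomorphically onto an open cell). A path is an edge path. A *side* of $X$ is a pair $(R,r)$, where $R\to X$ is a 2-cell and $r$ is a 1-cell of $\partial R$; it is *present at* the 1-cell $x$ of $X$ to which $r$ is mapped. Given a map $\phi\colon Y\to X$ and a 1-cell $y$ of $Y$, a side $(R,r)$ present at $\phi(y)$ is *missing at $y$* if $R\to X$ does not factor as $\phi\circ\rho$ for a map $\rho\colon R\to Y$ with $\rho(r)=y$. A *weighted 2-complex* is a 2-complex $X$ with a nonnegative integer weight $\mathrm{Wt}(R,r)$ assigned to each side, such that for each 1-cell $x$ the perimeter $\mathbf P(x)$, the sum of the weights of the sides present at $x$, is finite, and for each 2-cell $R$ the weight $\sum_{r}\mathrm{Wt}(R,r)$ is positive. The *perimeter* $\mathbf P(\phi)=\mathbf P(Y)$ of a map $\phi\colon Y\to X$ is the sum, over all 1-cells $y$ of $Y$, of the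 weights of the sides of $X$ missing at $y$; for a path $Q\to X$ it is the sum of $\mathbf P(x)$ over the 1-cells $x$ traversed by $Q$, with multiplicity. If $\partial R\to X$ is the closed path $W^n$ with $n$ maximal, the *packet* $\widetilde R\to X$ is the circle $\partial R$ with $n$ copies of $R$ attached along homeomorphisms of boundaries, one for each of the $n$ rotations of $\partial R$ compatible with $\partial R\to X$, together with the natural extension of $R\to X$. If a subpath $Q$ of a path $P=P_1QP_2$ is also a subpath of $\partial R$ (with $0\le|Q|\le|\partial R|$), and $S$ is its complement, i.e. $QS^{-1}$ is the boundary path of $R$, then $P_1SP_2$ is obtained from $P$ by *pushing across* $R$; the push is *weakly perimeter-reducing* if $\mathbf P(\widetilde R)\le \mathbf P(Q)$. *Removing a backtrack* replaces $P_1ee^{-1}P_2$ by $P_1P_2$. $X$ satisfies the *path reduction hypothesis* if for every nontrivial closed null-homotopic path $P\to X$ there is a finite sequence of closed paths $P=P_1,\dots,P_t$ with $P_t$ trivial, such that each $P_{i+1}$ is obtained from $P_i$ by removing a backtrack or by a weakly perimeter-reducing push across a 2-cell. $X$ satisfies the *perimeter reduction hypothesis* if for every compact connected $Y$ and every based map $\phi\colon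 Y\to X$ that is locally injective on $Y^{(1)}$ and not $\pi_1$-injective, there are a compact connected $Y^+$, a based map $\phi^+\colon Y^+\to X$ and a based map $\iota\colon Y\to Y^+$ with $\phi^+\circ\iota=\phi$, $\mathbf P(Y^+)<\mathbf P(Y)$ and $\phi^+_*(\pi_1Y^+)=\phi_*(\pi_1Y)$. A group is *coherent* if each of its finitely generated subgroups is finitely presented. **Theorem (Path coherence).** If a weighted 2-complex $X$ satisfies the path reduction hypothesis, then $X$ satisfies the perimeter reduction hypothesis. Moreover, $\pi_1(X,x)$ is coherent for every 0-cell $x$ of $X$. -/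

import Mathlib

open scoped ENNReal

universe u

/-- A combinatorial 2-complex whose 2-cells are attached along immersed closed paths.

`V` is the set of 0-cells and `D` the set of oriented 1-cells, `inv` reversing the orientation; the
1-cells are the pairs `{d, inv d}`.

`S` is the set of oriented sides of 2-cells: pairs consisting of a 2-cell `R` (a polygon mapping to
the complex) and an oriented 1-cell `r` of its boundary circle `∂R`.  The boundary of a polygon is
recorded by `next` (the oriented 1-cell of `∂R` following `r` in the direction in which `r` points),
`flip` (the same 1-cell of `∂R` with the opposite orientation), and `lab` (the image of `r` under
the attaching map).  The polygons are finite (`next_periodic`), and attaching maps are immersions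
(`lab_next_ne`).  The 2-cells themselves are the orbits of `S` under `next` and `flip`.  (An
element and its flip are never in the same `next`-orbit: a reflection `flip` of such an orbit would
give some `s` with `s = flip s` or `next s = flip s`, against `inv_ne` or `lab_next_ne`.) -/
structure TwoComplex where
  V : Type u
  D : Type u
  S : Type u
  src : D → V
  inv : D → D
  inv_inv : ∀ d, inv (inv d) = d
  inv_ne : ∀ d, inv d ≠ d
  next : S → S
  flip : S → S
  lab : S → D
  flip_flip : ∀ s, flip (flip s) = s
  next_flip_next : ∀ s, next (flip (next s)) = flip s
  next_periodic : ∀ s, ∃ n, 0 < n ∧ next^[n] s = s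
  lab_flip : ∀ s, lab (flip s) = inv (lab s)
  src_lab_next : ∀ s, src (lab (next s)) = src (inv (lab s))
  lab_next_ne : ∀ s, lab (next s) ≠ inv (lab s)

namespace TwoComplex

variable (X Y Z : TwoComplex.{u})

/-- Terminal 0-cell of an oriented 1-cell. -/
def tgt (d : X.D) : X.V := X.src (X.inv d)

/-- Reversal of orientation as an equivalence relation on oriented 1-cells. -/
def edgeSetoid : Setoid X.D where
  r a b := a = b ∨ a = X.inv b
  iseqv :=
    { refl := fun _ => Or.inl rfl
      symm := by
        rintro a b (h | h)
        · exact Or.inl h.symm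
        · exact Or.inr (by rw [h, X.inv_inv])
      trans := by
        rintro a b c (rfl | rfl) (rfl | rfl)
        · exact Or.inl rfl
        · exact Or.inr rfl
        · exact Or.inr rfl
        · exact Or.inl (X.inv_inv _) }

/-- The 1-cells. -/
def Edge : Type u := Quotient X.edgeSetoid

/-- Reversal of orientation as an equivalence relation on oriented sides. -/
def sideSetoid : Setoid X.S where
  r a b := a = b ∨ a = X.flip b
  iseqv :=
    { refl := fun _ => Or.inl rfl
      symm := by
        rintro a b (h | h)
        · exact Or.inl h.symm
        · exact Or.inr (by rw [h, X.flip_flip])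
      trans := by
        rintro a b c (rfl | rfl) (rfl | rfl)
        · exact Or.inl rfl
        · exact Or.inr rfl
        · exact Or.inr rfl
        · exact Or.inl (X.flip_flip _) }

/-- The sides `(R, r)` of 2-cells. -/
def Side : Type u := Quotient X.sideSetoid

variable {X Y Z}

/-- The 1-cell underlying an oriented 1-cell. -/
def edge (d : X.D) : X.Edge := Quotient.mk X.edgeSetoid d

/-- The side underlying an oriented side. -/
def side (s : X.S) : X.Side := Quotient.mk X.sideSetoid s

/-- The 1-cell at which a side is present: `(R, r)` is present at the image of `r`. -/
def Side.at (σ : X.Side) : X.Edge :=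
  Quotient.lift (fun s : X.S => edge (X.lab s))
    (by
      rintro a b (rfl | rfl)
      · rfl
      · exact Quotient.sound (Or.inr (X.lab_flip b))) σ

/-- The length `|∂R|` of the boundary of the 2-cell carrying `s`. -/
noncomputable def len (s : X.S) : ℕ := Function.minimalPeriod X.next s

/-- The boundary path of a 2-cell, read from the oriented side `s` in the direction of `s`. -/
noncomputable def boundaryPath (s : X.S) : List X.D :=
  (List.range (len s)).map fun i => X.lab (X.next^[i] s)

/-! ### Paths -/

/-- `IsWalk a p b`: the sequence `p` of oriented 1-cells is a path from `a` to `b`. -/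
def IsWalk : X.V → List X.D → X.V → Prop
  | a, [], b => a = b
  | a, d :: p, b => X.src d = a ∧ IsWalk (X.tgt d) p b

/-- The reversed path. -/
def revPath (p : List X.D) : List X.D := (p.map X.inv).reverse

theorem IsWalk.append {a b c : X.V} {p q : List X.D} (hp : IsWalk a p b) (hq : IsWalk b q c) :
    IsWalk a (p ++ q) c := by
  induction p generalizing a with
  | nil => cases hp; exact hq
  | cons d p ih => exact ⟨hp.1, ih hp.2⟩

theorem IsWalk.rev {a b : X.V} {p : List X.D} (hp : IsWalk a p b) : IsWalk b (revPath p) a := by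
  induction p generalizing a with
  | nil => cases hp; exact rfl
  | cons d p ih =>
    have h := ih hp.2
    simp only [revPath, List.map_cons, List.reverse_cons]
    exact h.append ⟨rfl, by rw [tgt, X.inv_inv]; exact hp.1⟩

/-- Removing a backtrack, or removing a boundary path of a 2-cell. -/
inductive Move : List X.D → List X.D → Prop
  | backtrack (p q : List X.D) (d : X.D) : Move (p ++ ([d, X.inv d] ++ q)) (p ++ q)
  | cell (p q : List X.D) (s : X.S) : Move (p ++ (boundaryPath s ++ q)) (p ++ q)

/-- Paths from `a` to `b`. -/
def Walk (a b : X.V) : Type u := {p : List X.D // IsWalk a p b}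

/-- Homotopy of paths relative to their endpoints: the equivalence relation generated by removing
backtracks and removing boundary paths of 2-cells. -/
def walkSetoid (a b : X.V) : Setoid (Walk a b) where
  r := Relation.EqvGen fun p q => Move p.1 q.1
  iseqv := Relation.EqvGen.is_equivalence _

/-- A closed path is null-homotopic. -/
def NullHomotopic {a : X.V} (p : Walk a a) : Prop :=
  (walkSetoid a a).r p ⟨[], rfl⟩

/-! ### The fundamental group -/

theorem Move.append_left {p q : List X.D} (r : List X.D) (h : Move p q) :
    Move (r ++ p) (r ++ q) := by
  cases h with
  | backtrack u v d => simpa [List.append_assoc] using Move.backtrack (r ++ u) v d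
  | cell u v s => simpa [List.append_assoc] using Move.cell (r ++ u) v s

theorem Move.append_right {p q : List X.D} (r : List X.D) (h : Move p q) :
    Move (p ++ r) (q ++ r) := by
  cases h with
  | backtrack u v d => simpa [List.append_assoc] using Move.backtrack u (v ++ r) d
  | cell u v s => simpa [List.append_assoc] using Move.cell u (v ++ r) s

def Walk.append {a b c : X.V} (p : Walk a b) (q : Walk b c) : Walk a c :=
  ⟨p.1 ++ q.1, p.2.append q.2⟩

def Walk.rev {a b : X.V} (p : Walk a b) : Walk b a := ⟨revPath p.1, p.2.rev⟩

theorem walk_append_congr {a b c : X.V} {p p' : Walk a b} {q q' : Walk b c}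
    (hp : (walkSetoid a b).r p p') (hq : (walkSetoid b c).r q q') :
    (walkSetoid a c).r (p.append q) (p'.append q') := by
  have h1 : (walkSetoid a c).r (p.append q) (p'.append q) := by
    clear hq
    induction hp with
    | rel x y h => exact .rel _ _ (h.append_right _)
    | refl x => exact .refl _
    | symm x y _ ih => exact .symm _ _ ih
    | trans x y z _ _ ih1 ih2 => exact .trans _ _ _ ih1 ih2
  have h2 : (walkSetoid a c).r (p'.append q) (p'.append q') := by
    clear h1 hp
    induction hq with
    | rel x y h => exact .rel _ _ (h.append_left _)
    | refl x => exact .refl _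
    | symm x y _ ih => exact .symm _ _ ih
    | trans x y z _ _ ih1 ih2 => exact .trans _ _ _ ih1 ih2
  exact .trans _ _ _ h1 h2

theorem rev_append_homotopic {a b : X.V} (p : Walk a b) :
    (walkSetoid b b).r (p.rev.append p) ⟨[], rfl⟩ := by
  obtain ⟨p, hp⟩ := p
  induction p generalizing a with
  | nil => cases hp; exact .refl _
  | cons d p ih =>
    refine .trans _ _ _ (.rel _ _ ?_) (ih hp.2)
    have h := Move.backtrack (revPath p) p (X.inv d)
    simpa [Walk.rev, Walk.append, revPath, X.inv_inv] using h

theorem revPath_revPath (p : List X.D) : revPath (revPath p) = p := by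
  simp only [revPath, List.map_reverse, List.map_map, List.reverse_reverse]
  conv_rhs => rw [← List.map_id p]
  exact List.map_congr_left fun d _ => X.inv_inv d

theorem append_rev_homotopic {a b : X.V} (p : Walk a b) :
    (walkSetoid a a).r (p.append p.rev) ⟨[], rfl⟩ := by
  have h := rev_append_homotopic p.rev
  have e : p.rev.rev = p := Subtype.ext (revPath_revPath p.1)
  rwa [e] at h

theorem walk_rev_congr {a b : X.V} {p q : Walk a b} (h : (walkSetoid a b).r p q) :
    (walkSetoid b a).r p.rev q.rev := by
  -- rev p  ~  rev p · q · rev q  ~  rev p · p · rev q  ~  rev q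
  have h1 : (walkSetoid b a).r (p.rev.append (q.append q.rev)) (p.rev.append ⟨[], rfl⟩) :=
    walk_append_congr (.refl _) (append_rev_homotopic q)
  have h2 : (walkSetoid b a).r ((p.rev.append p).append q.rev) ((p.rev.append q).append q.rev) :=
    walk_append_congr (walk_append_congr (.refl _) h) (.refl _)
  have h3 : (walkSetoid b a).r ((p.rev.append p).append q.rev) (Walk.append ⟨[], rfl⟩ q.rev) :=
    walk_append_congr (rev_append_homotopic p) (.refl _)
  have e1 : p.rev.append ⟨[], rfl⟩ = p.rev := Subtype.ext (List.append_nil _)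
  have e2 : (p.rev.append q).append q.rev = p.rev.append (q.append q.rev) :=
    Subtype.ext (List.append_assoc _ _ _)
  have e3 : Walk.append ⟨[], rfl⟩ q.rev = q.rev := rfl
  rw [e1] at h1
  rw [e2] at h2
  rw [e3] at h3
  exact .trans _ _ _ (.symm _ _ h1) (.trans _ _ _ (.symm _ _ h2) h3)

/-- The fundamental group: homotopy classes of closed paths based at `x`. -/
def Pi1 (X : TwoComplex.{u}) (x : X.V) : Type u := Quotient (walkSetoid x x)

instance (x : X.V) : Group (Pi1 X x) where
  mul := Quotient.map₂ Walk.append fun _ _ hp _ _ hq => walk_append_congr hp hq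
  one := Quotient.mk _ ⟨[], rfl⟩
  inv := Quotient.map Walk.rev fun _ _ h => walk_rev_congr h
  mul_assoc := by
    rintro ⟨p⟩ ⟨q⟩ ⟨r⟩
    exact congrArg (Quotient.mk _) (Subtype.ext (List.append_assoc _ _ _))
  one_mul := by
    rintro ⟨p⟩
    rfl
  mul_one := by
    rintro ⟨p⟩
    exact congrArg (Quotient.mk _) (Subtype.ext (List.append_nil _))
  inv_mul_cancel := by
    rintro ⟨p⟩
    exact Quotient.sound (rev_append_homotopic p)

/-! ### Combinatorial maps -/

/-- A combinatorial map.  Every cell is mapped onto a cell; on a 2-cell the map is given by an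
isomorphism of polygons, that is, a map of oriented sides which commutes with `next` and `flip` and
does not wrap a boundary circle several times around another one (`next_iterate`). -/
structure Hom (Y X : TwoComplex.{u}) where
  onV : Y.V → X.V
  onD : Y.D → X.D
  onS : Y.S → X.S
  src_onD : ∀ d, X.src (onD d) = onV (Y.src d)
  inv_onD : ∀ d, X.inv (onD d) = onD (Y.inv d)
  next_onS : ∀ s, X.next (onS s) = onS (Y.next s)
  flip_onS : ∀ s, X.flip (onS s) = onS (Y.flip s)
  lab_onS : ∀ s, X.lab (onS s) = onD (Y.lab s)
  next_iterate : ∀ s n, X.next^[n] (onS s) = onS s → Y.next^[n] s = s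

namespace Hom

/-- Composition of combinatorial maps. -/
def comp (φ : Hom Y X) (ρ : Hom Z Y) : Hom Z X where
  onV := φ.onV ∘ ρ.onV
  onD := φ.onD ∘ ρ.onD
  onS := φ.onS ∘ ρ.onS
  src_onD d := by simp [φ.src_onD, ρ.src_onD]
  inv_onD d := by simp [φ.inv_onD, ρ.inv_onD]
  next_onS s := by simp [φ.next_onS, ρ.next_onS]
  flip_onS s := by simp [φ.flip_onS, ρ.flip_onS]
  lab_onS s := by simp [φ.lab_onS, ρ.lab_onS]
  next_iterate s n h := ρ.next_iterate s n (φ.next_iterate _ n h)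

variable (φ : Hom Y X)

/-- The induced map on 1-cells. -/
def onEdge (e : Y.Edge) : X.Edge :=
  Quotient.map φ.onD
    (by
      rintro a b (rfl | rfl)
      · exact Or.inl rfl
      · exact Or.inr (φ.inv_onD b).symm) e

/-- The induced map on sides. -/
def onSide (σ : Y.Side) : X.Side :=
  Quotient.map φ.onS
    (by
      rintro a b (rfl | rfl)
      · exact Or.inl rfl
      · exact Or.inr (φ.flip_onS b).symm) σ

/-- A map is a 1-immersion if it is locally injective on the 1-skeleton. -/
def IsOneImmersion : Prop :=
  ∀ d d' : Y.D, Y.src d = Y.src d' → φ.onD d = φ.onD d' → d = d'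

theorem next_iterate_onS (s : Y.S) (n : ℕ) : X.next^[n] (φ.onS s) = φ.onS (Y.next^[n] s) := by
  induction n with
  | zero => rfl
  | succ n ih => rw [Function.iterate_succ_apply', Function.iterate_succ_apply', ih, φ.next_onS]

theorem len_onS (s : Y.S) : len (φ.onS s) = len s := by
  refine Nat.dvd_antisymm ?_ ?_
  · refine Function.IsPeriodicPt.minimalPeriod_dvd ?_
    change X.next^[_] _ = _
    rw [next_iterate_onS, len, Function.iterate_minimalPeriod]
  · refine Function.IsPeriodicPt.minimalPeriod_dvd ?_
    exact φ.next_iterate s _ Function.iterate_minimalPeriod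

theorem map_boundaryPath (s : Y.S) : (boundaryPath s).map φ.onD = boundaryPath (φ.onS s) := by
  simp only [boundaryPath, List.map_map, len_onS]
  refine List.map_congr_left fun i _ => ?_
  rw [next_iterate_onS, lab_onS, Function.comp_apply]

theorem isWalk {a b : Y.V} {p : List Y.D} (h : IsWalk a p b) :
    IsWalk (φ.onV a) (p.map φ.onD) (φ.onV b) := by
  induction p generalizing a with
  | nil => cases h; exact rfl
  | cons d p ih =>
    refine ⟨by rw [φ.src_onD, h.1], ?_⟩
    have := ih h.2
    rwa [tgt, ← φ.src_onD, ← φ.inv_onD] at this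

theorem move {p q : List Y.D} (h : Move p q) : Move (p.map φ.onD) (q.map φ.onD) := by
  cases h with
  | backtrack u v d =>
    simpa [φ.inv_onD] using Move.backtrack (u.map φ.onD) (v.map φ.onD) (φ.onD d)
  | cell u v s =>
    simpa [φ.map_boundaryPath] using Move.cell (u.map φ.onD) (v.map φ.onD) (φ.onS s)

/-- The image of a closed path under a based map. -/
def onLoop {y : Y.V} {x : X.V} (h : φ.onV y = x) (p : Walk y y) : Walk x x :=
  ⟨p.1.map φ.onD, by have := φ.isWalk p.2; rwa [h] at this⟩

theorem onLoop_congr {y : Y.V} {x : X.V} (h : φ.onV y = x) {p q : Walk y y}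
    (hpq : (walkSetoid y y).r p q) : (walkSetoid x x).r (φ.onLoop h p) (φ.onLoop h q) := by
  induction hpq with
  | rel a b h => exact .rel _ _ (φ.move h)
  | refl a => exact .refl _
  | symm a b _ ih => exact .symm _ _ ih
  | trans a b c _ _ ih1 ih2 => exact .trans _ _ _ ih1 ih2

/-- The homomorphism of fundamental groups induced by a based map `(Y, y) → (X, x)`. -/
def pi1Map {y : Y.V} {x : X.V} (h : φ.onV y = x) : Pi1 Y y →* Pi1 X x where
  toFun := Quotient.map (φ.onLoop h) fun _ _ hpq => φ.onLoop_congr h hpq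
  map_one' := rfl
  map_mul' := by
    rintro ⟨p⟩ ⟨q⟩
    exact congrArg (Quotient.mk _) (Subtype.ext List.map_append)

end Hom

/-- A 2-complex is compact if it has finitely many cells. -/
def IsCompact (Y : TwoComplex.{u}) : Prop := Finite Y.V ∧ Finite Y.D ∧ Finite Y.S

/-- A 2-complex is connected if it is nonempty and any two 0-cells are joined by a path. -/
def IsConnected (Y : TwoComplex.{u}) : Prop :=
  Nonempty Y.V ∧ ∀ a b : Y.V, ∃ p : List Y.D, IsWalk a p b

/-! ### Packets -/

/-- The inverse of `next`. -/
def prev (s : X.S) : X.S := X.flip (X.next (X.flip s))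

theorem next_prev (s : X.S) : X.next (prev s) = s := by
  have h := X.next_flip_next (X.flip s)
  rwa [X.flip_flip] at h

theorem prev_next (s : X.S) : prev (X.next s) = s := by
  rw [prev, X.next_flip_next, X.flip_flip]

theorem next_injective : Function.Injective X.next := fun a b h => by
  rw [← prev_next a, h, prev_next]

/-- The cyclically ordered set of the 1-cells of `∂R`, where `R` is the 2-cell carrying `s`,
oriented in the direction of `s`. -/
@[ext]
structure Cyc (s : X.S) : Type u where
  val : X.S
  mem : ∃ n, X.next^[n] s = val

namespace Cyc

variable {s : X.S}

/-- The next 1-cell of `∂R`. -/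
def next (c : Cyc s) : Cyc s where
  val := X.next c.val
  mem := by
    obtain ⟨n, hn⟩ := c.mem
    exact ⟨n + 1, by rw [Function.iterate_succ_apply', hn]⟩

/-- The previous 1-cell of `∂R`. -/
def prev (c : Cyc s) : Cyc s where
  val := TwoComplex.prev c.val
  mem := by
    obtain ⟨n, hn⟩ := c.mem
    obtain ⟨m, hm, hs⟩ := X.next_periodic s
    obtain ⟨m, rfl⟩ : ∃ k, m = k + 1 := ⟨m - 1, by omega⟩
    refine ⟨n + m, ?_⟩
    have h : X.next (X.next^[n + m] s) = c.val := by
      rw [← Function.iterate_succ_apply' X.next (n + m) s, Nat.succ_eq_add_one,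
        Nat.add_assoc n m 1, Function.iterate_add_apply, hs, hn]
    rw [← h, prev_next]

theorem next_prev (c : Cyc s) : c.prev.next = c := Cyc.ext (TwoComplex.next_prev c.val)

theorem prev_next (c : Cyc s) : c.next.prev = c := Cyc.ext (TwoComplex.prev_next c.val)

theorem next_iterate_val (c : Cyc s) (n : ℕ) : (next^[n] c).val = X.next^[n] c.val := by
  induction n with
  | zero => rfl
  | succ n ih =>
    rw [Function.iterate_succ_apply' X.next, ← ih, Function.iterate_succ_apply' next]; rfl

theorem next_iterate_eq_iff (c c' : Cyc s) (n : ℕ) : next^[n] c = c ↔ next^[n] c' = c' := by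
  have key : ∀ c : Cyc s, next^[n] c = c ↔ X.next^[n] s = s := by
    intro c
    rw [Cyc.ext_iff, next_iterate_val]
    obtain ⟨c, k, rfl⟩ := c
    change X.next^[n] (X.next^[k] s) = X.next^[k] s ↔ _
    rw [← Function.iterate_add_apply, Nat.add_comm, Function.iterate_add_apply]
    exact (next_injective.iterate k).eq_iff
  rw [key c, key c']

theorem prev_iterate_of_next {n : ℕ} {c : Cyc s} (h : next^[n] c = c) : prev^[n] c = c := by
  have hl : Function.LeftInverse (prev (s := s)) next := prev_next
  conv_lhs => rw [← h]
  exact hl.iterate n c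

/-- The rotation of `∂R` taking the 1-cell `c` to the 1-cell `c'` is compatible with the attaching
map `∂R → X`. -/
def SameLabels (c c' : Cyc s) : Prop := ∀ n, X.lab (X.next^[n] c.val) = X.lab (X.next^[n] c'.val)

theorem SameLabels.next {c c' : Cyc s} (h : SameLabels c c') : SameLabels c.next c'.next :=
  fun n => h (n + 1)

theorem SameLabels.prev {c c' : Cyc s} (h : SameLabels c c') : SameLabels c.prev c'.prev := by
  obtain ⟨m, hm, hc⟩ := X.next_periodic c.val
  obtain ⟨m, rfl⟩ : ∃ k, m = k + 1 := ⟨m - 1, by omega⟩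
  have e : ∀ d : Cyc s, X.next^[m] d.val = d.prev.val := by
    intro d
    have h0 : Cyc.next^[m + 1] c = c := Cyc.ext (by rw [next_iterate_val]; exact hc)
    have h1 := congrArg Cyc.val ((next_iterate_eq_iff c d (m + 1)).1 h0)
    rw [next_iterate_val, Function.iterate_succ_apply'] at h1
    change X.next^[m] d.val = TwoComplex.prev d.val
    conv_rhs => rw [← h1]
    rw [TwoComplex.prev_next]
  intro n
  have := h (n + m)
  rwa [Function.iterate_add_apply, Function.iterate_add_apply, e, e] at this

end Cyc

/-- An oriented side of the packet of the 2-cell `R` carrying `s`.  It lies at the 1-cell `pos` of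
the circle `∂R`, belongs to the copy of `R` which is attached to this circle by the rotation taking
`cell` to `pos`, and is the side `cell` of that copy.  The rotation has to be compatible with
`∂R → X`.  The last entry is the orientation (`true` is the direction of `s`). -/
@[ext]
structure PacketSide (s : X.S) : Type u where
  pos : Cyc s
  cell : Cyc s
  same : Cyc.SameLabels pos cell
  dir : Bool

namespace PacketSide

variable {s : X.S}

/-- The successor of an oriented side of the packet. -/
def next : PacketSide s → PacketSide s
  | ⟨c, c', h, true⟩ => ⟨c.next, c'.next, h.next, true⟩
  | ⟨c, c', h, false⟩ => ⟨c.prev, c'.prev, h.prev, false⟩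

theorem next_iterate (n : ℕ) (t : PacketSide s) :
    (next^[n] t).pos = (bif t.dir then Cyc.next^[n] t.pos else Cyc.prev^[n] t.pos) ∧
    (next^[n] t).cell = (bif t.dir then Cyc.next^[n] t.cell else Cyc.prev^[n] t.cell) ∧
    (next^[n] t).dir = t.dir := by
  induction n generalizing t with
  | zero => obtain ⟨c, c', h, b⟩ := t; cases b <;> exact ⟨rfl, rfl, rfl⟩
  | succ n ih => obtain ⟨c, c', h, b⟩ := t; cases b <;> exact ih _

theorem next_iterate_eq {n : ℕ} {c : Cyc s} (h : Cyc.next^[n] c = c) (t : PacketSide s) :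
    next^[n] t = t := by
  obtain ⟨e1, e2, e3⟩ := next_iterate n t
  have h1 := (Cyc.next_iterate_eq_iff c t.pos n).1 h
  have h2 := (Cyc.next_iterate_eq_iff c t.cell n).1 h
  refine PacketSide.ext ?_ ?_ e3
  · rw [e1, h1, Cyc.prev_iterate_of_next h1, Bool.cond_self]
  · rw [e2, h2, Cyc.prev_iterate_of_next h2, Bool.cond_self]

end PacketSide

/-- The packet of the 2-cell `R` carrying `s`: the circle `∂R` with `n` copies of `R` attached by
homeomorphisms of boundaries, one for each of the `n` rotations of `∂R` that are compatible with
`∂R → X`, where `n` is the exponent of `R`. -/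
def packet (s : X.S) : TwoComplex.{u} where
  V := Cyc s
  D := Cyc s × Bool
  S := PacketSide s
  src
    | (c, true) => c
    | (c, false) => c.next
  inv d := (d.1, !d.2)
  inv_inv d := by simp
  inv_ne d h := by simpa using congrArg Prod.snd h
  next := PacketSide.next
  flip t := ⟨t.pos, t.cell, t.same, !t.dir⟩
  lab t := (t.pos, t.dir)
  flip_flip t := by simp
  next_flip_next := by
    rintro ⟨c, c', h, b⟩
    cases b <;> simp [PacketSide.next, Cyc.next_prev, Cyc.prev_next]
  next_periodic := by
    intro t
    obtain ⟨m, hm, hc⟩ := X.next_periodic t.pos.val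
    exact ⟨m, hm, PacketSide.next_iterate_eq (c := t.pos)
      (Cyc.ext (by rw [Cyc.next_iterate_val]; exact hc)) t⟩
  lab_flip t := rfl
  src_lab_next := by
    rintro ⟨c, c', h, b⟩
    cases b
    · exact Cyc.next_prev c
    · rfl
  lab_next_ne := by
    rintro ⟨c, c', h, b⟩ e
    have e' := congrArg Prod.snd e
    cases b <;> simp [PacketSide.next] at e'

/-- The map from the packet of `R` to `X` which extends `R → X`. -/
def packetMap (s : X.S) : Hom (packet s) X where
  onV (c : Cyc s) := X.src (X.lab c.val)
  onD
    | (c, true) => X.lab c.val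
    | (c, false) => X.inv (X.lab c.val)
  onS
    | ⟨_, c', _, true⟩ => c'.val
    | ⟨_, c', _, false⟩ => X.flip c'.val
  src_onD := by
    rintro ⟨c, b⟩
    cases b
    · exact (X.src_lab_next c.val).symm
    · rfl
  inv_onD := by
    rintro ⟨c, b⟩
    cases b
    · exact X.inv_inv _
    · rfl
  next_onS := by
    rintro ⟨c, c', h, b⟩
    cases b
    · exact (X.flip_flip _).symm
    · rfl
  flip_onS := by
    rintro ⟨c, c', h, b⟩
    cases b
    · exact X.flip_flip _
    · rfl
  lab_onS := by
    rintro ⟨c, c', h, b⟩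
    cases b
    · exact (X.lab_flip _).trans (congrArg X.inv (h 0).symm)
    · exact (h 0).symm
  next_iterate := by
    rintro ⟨c, c', h, b⟩ n hn
    have key : Cyc.next^[n] c' = c' := by
      refine Cyc.ext ?_
      rw [Cyc.next_iterate_val]
      cases b
      · have hn' : X.next^[n] (X.flip c'.val) = X.flip c'.val := hn
        have hf : ∀ (m : ℕ) (a : X.S), X.next^[m] (X.flip (X.next^[m] a)) = X.flip a := by
          intro m
          induction m with
          | zero => intro a; rfl
          | succ m ih =>
            intro a
            rw [Function.iterate_succ_apply' X.next m a, Function.iterate_succ_apply,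
              X.next_flip_next, ih]
        have h3 := (next_injective.iterate n) ((hf n c'.val).trans hn'.symm)
        exact (X.flip_flip _).symm.trans ((congrArg X.flip h3).trans (X.flip_flip _))
      · exact hn
    exact PacketSide.next_iterate_eq key _

end TwoComplex

/-! ### Weights and perimeters -/

open TwoComplex

/-- A weighted 2-complex: the sides have nonnegative integer weights, the perimeter of each 1-cell
(the sum of the weights of the sides present at it) is finite, and the weight of each 2-cell (the
sum of the weights of its sides) is positive. -/
structure WeightedComplex extends TwoComplex.{u} where
  wt : toTwoComplex.Side → ℕ
  perimeter_finite : ∀ e : toTwoComplex.Edge,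
    ∑' σ : {σ : toTwoComplex.Side // σ.at = e}, (wt σ : ℝ≥0∞) ≠ ⊤
  weight_pos : ∀ s : toTwoComplex.S,
    0 < ∑ i ∈ Finset.range (len s), wt (side (toTwoComplex.next^[i] s))

namespace WeightedComplex

variable (X : WeightedComplex.{u})

/-- The perimeter of a 1-cell. -/
noncomputable def edgePerimeter (e : X.Edge) : ℝ≥0∞ :=
  ∑' σ : {σ : X.Side // σ.at = e}, (X.wt σ : ℝ≥0∞)

/-- The perimeter of a path `Q → X`.  The domain of the path is a graph, so all sides are missing
at each of its 1-cells. -/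
noncomputable def pathPerimeter (q : List X.D) : ℝ≥0∞ :=
  (q.map fun d => X.edgePerimeter (edge d)).sum

variable {X}

/-- The sides of `X` which are present at the 1-cell `φ(e)` but missing at the 1-cell `e` of `Y`,
i.e. which do not lift to a side of `Y` at `e`. -/
def missing {Y : TwoComplex.{u}} (φ : Hom Y X.toTwoComplex) (e : Y.Edge) : Set X.Side :=
  {σ | σ.at = φ.onEdge e ∧ ¬ ∃ τ : Y.Side, τ.at = e ∧ φ.onSide τ = σ}

/-- The weighted perimeter of a map `φ : Y → X`. -/
noncomputable def perimeter {Y : TwoComplex.{u}} (φ : Hom Y X.toTwoComplex) : ℝ≥0∞ :=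
  ∑' e : Y.Edge, ∑' σ : missing φ e, (X.wt σ : ℝ≥0∞)

/-! ### The path reduction hypothesis -/

/-- `WeaklyReducingPush s k p p'`: the path `p'` is obtained from `p` by pushing across the 2-cell `R` carrying
`s`, where `Q` is the path of length `k` in `∂R` which starts with `s`; the complement of `Q` is the
reverse of the remaining part of the boundary path.  The push is weakly perimeter-reducing if the
perimeter of the packet of `R` is at most the perimeter of `Q`. -/
def WeaklyReducingPush (s : X.S) (k : ℕ) (p p' : List X.D) : Prop :=
  k ≤ len s ∧
  (∃ p₁ p₂ : List X.D,
    p = p₁ ++ ((boundaryPath s).take k ++ p₂) ∧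
    p' = p₁ ++ (revPath ((boundaryPath s).drop k) ++ p₂)) ∧
  perimeter (packetMap s) ≤ X.pathPerimeter ((boundaryPath s).take k)

/-- One step of a path reduction: the removal of a backtrack or a weakly perimeter-reducing push
across a 2-cell. -/
inductive ReductionStep : List X.D → List X.D → Prop
  | backtrack (p q : List X.D) (d : X.D) : ReductionStep (p ++ ([d, X.inv d] ++ q)) (p ++ q)
  | push (s : X.S) (k : ℕ) (p p' : List X.D) (h : WeaklyReducingPush s k p p') :
      ReductionStep p p'

variable (X)

/-- Every nontrivial closed null-homotopic path can be transformed into the trivial path by finitely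
many reduction steps. -/
def PathReductionHypothesis : Prop :=
  ∀ (x : X.V) (p : Walk x x), p.1 ≠ [] → NullHomotopic p →
    Relation.ReflTransGen (ReductionStep (X := X)) p.1 []

/-- For every compact connected `Y` and every based 1-immersion `φ : (Y, y) → (X, x)` which is not
`π₁`-injective, there are a compact connected `Y⁺`, a based map `φ⁺ : (Y⁺, y⁺) → (X, x)` with smaller
perimeter and the same `π₁`-image, and a based map `ι : (Y, y) → (Y⁺, y⁺)` with `φ⁺ ∘ ι = φ`. -/
def PerimeterReductionHypothesis : Prop :=
  ∀ (Y : TwoComplex.{u}) (y : Y.V) (x : X.V) (φ : Hom Y X.toTwoComplex) (h : φ.onV y = x),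
    Y.IsCompact → Y.IsConnected → φ.IsOneImmersion → ¬ Function.Injective (φ.pi1Map h) →
    ∃ (Y' : TwoComplex.{u}) (y' : Y'.V) (φ' : Hom Y' X.toTwoComplex) (h' : φ'.onV y' = x)
      (ι : Hom Y Y'),
      ι.onV y = y' ∧ φ'.comp ι = φ ∧ Y'.IsCompact ∧ Y'.IsConnected ∧
      perimeter φ' < perimeter φ ∧ (φ'.pi1Map h').range = (φ.pi1Map h).range

end WeightedComplex

/-- A group is coherent if each of its finitely generated subgroups is finitely presented. -/
def IsCoherentGroup (G : Type u) [Group G] : Prop :=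
  ∀ H : Subgroup G, H.FG → Group.IsFinitelyPresented H

namespace TwoComplex

variable {X Y Z : TwoComplex.{u}}

/-! Perimeter reduction. Let w be an essential closed path of Y whose image P in X is
null-homotopic. The reduction of P is imitated in Y. A backtrack of P lifts to a backtrack of w, by
local injectivity. For a push across R along Q, the lift of Q is prolonged along ∂R inside Y as far
as possible. If all of ∂R lifts together with R, then w is pushed across this lift of R. If the lift
stops earlier, the rest of ∂R is added as new 1-cells, folded so that the map stays locally
injective (`exists_closed_lift`), and the packet of R is attached to the resulting closed path. A
packet side at a 1-cell of the prolonged Q cannot have been present in Y, since its 2-cell would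
prolong the maximal lift. Hence attaching the packet adds at most its own perimeter and saves at
least the perimeter of Q (`perimeter_glue_le`), so a weakly reducing push does not increase the
perimeter (`exists_cell_lift`).

The path stays essential throughout: essentiality is witnessed by a group-valued cocycle on the
1-cells, and cocycles extend over each enlargement. The trivial path is not essential, so somewhere
along the sequence the remaining case must occur: ∂R lifts to a path of Y at whose start R does not
lift. Then the ends of this path can be identified and the packet attached; a side of positive
weight stops being missing, and the perimeter drops (`exists_of_boundaryPath_lift`,
`exists_smaller_extension`).

That the image of π₁ does not grow is controlled by `imageClasses`, the family over the 0-cells v of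
Y of all paths of X homotopic to images of paths from the base point to v; it plays the role of the
cosets of the image.

The argument runs in the complex obtained from X by identifying all 0-cells, where every list of
oriented 1-cells is a closed path; afterwards the 0-cells are split again and a component is taken
(`perimeterReduction`).

Coherence. A finitely generated subgroup H is the π₁-image of a compact connected complex over X
(`exists_range_eq`). Perimeters of compact complexes are natural numbers, so one of least perimeter
may be chosen and then folded to be locally injective. If it were not π₁-injective, its perimeter
could be reduced. Thus H is isomorphic to the fundamental group of a compact complex, which is
finitely presented (`isFinitelyPresented_pi1`). -/

theorem Hom.ext_maps {φ ψ : Hom Y X} (hV : ∀ v, φ.onV v = ψ.onV v) (hD : ∀ d, φ.onD d = ψ.onD d)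
    (hS : ∀ s, φ.onS s = ψ.onS s) : φ = ψ := by
  obtain ⟨a, b, c, _⟩ := φ
  obtain ⟨a', b', c', _⟩ := ψ
  obtain rfl : a = a' := funext hV
  obtain rfl : b = b' := funext hD
  obtain rfl : c = c' := funext hS
  rfl

/-! ### Paths and homotopies of lists of oriented 1-cells -/

theorem tgt_inv (d : X.D) : X.tgt (X.inv d) = X.src d := by rw [tgt, X.inv_inv]

theorem src_inv (d : X.D) : X.src (X.inv d) = X.tgt d := rfl

theorem Hom.tgt_onD (φ : Hom Y X) (d : Y.D) : X.tgt (φ.onD d) = φ.onV (Y.tgt d) := by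
  rw [tgt, φ.inv_onD, φ.src_onD, tgt]

theorem src_lab_next' (s : X.S) : X.src (X.lab (X.next s)) = X.tgt (X.lab s) := X.src_lab_next s

theorem isWalk_append_iff {a c : X.V} {p q : List X.D} :
    IsWalk a (p ++ q) c ↔ ∃ b, IsWalk a p b ∧ IsWalk b q c := by
  constructor
  · intro h
    induction p generalizing a with
    | nil => exact ⟨a, rfl, h⟩
    | cons d p ih =>
      obtain ⟨b, hb, hq⟩ := ih h.2
      exact ⟨b, ⟨h.1, hb⟩, hq⟩
  · rintro ⟨b, hp, hq⟩
    exact hp.append hq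

theorem IsWalk.end_unique {a b c : X.V} {p : List X.D} (h : IsWalk a p b) (h' : IsWalk a p c) :
    b = c := by
  induction p generalizing a with
  | nil => exact (show a = b from h).symm.trans h'
  | cons d p ih => exact ih h.2 h'.2

theorem IsWalk.single (d : X.D) : IsWalk (X.src d) [d] (X.tgt d) := ⟨rfl, rfl⟩

theorem IsWalk.snoc {a : X.V} {p : List X.D} {d : X.D} (h : IsWalk a p (X.src d)) :
    IsWalk a (p ++ [d]) (X.tgt d) := h.append (.single d)

theorem isWalk_snoc_iff {a b : X.V} {p : List X.D} {d : X.D} :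
    IsWalk a (p ++ [d]) b ↔ IsWalk a p (X.src d) ∧ X.tgt d = b := by
  rw [isWalk_append_iff]
  constructor
  · rintro ⟨c, h, rfl, h'⟩
    exact ⟨h, h'⟩
  · rintro ⟨h, rfl⟩
    exact ⟨_, h, .single d⟩

/-- Two lists of oriented 1-cells are homotopic paths from `a` to `b`. -/
def Homot (a b : X.V) (p q : List X.D) : Prop :=
  ∃ (hp : IsWalk a p b) (hq : IsWalk a q b), (walkSetoid a b).r ⟨p, hp⟩ ⟨q, hq⟩

namespace Homot

variable {a b c : X.V} {p p' q q' r : List X.D}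

theorem left (h : Homot a b p q) : IsWalk a p b := h.1

theorem right (h : Homot a b p q) : IsWalk a q b := h.2.1

protected theorem refl (hp : IsWalk a p b) : Homot a b p p := ⟨hp, hp, .refl _⟩

protected theorem symm (h : Homot a b p q) : Homot a b q p :=
  let ⟨hp, hq, h⟩ := h
  ⟨hq, hp, .symm _ _ h⟩

protected theorem trans (h : Homot a b p q) (h' : Homot a b q r) : Homot a b p r :=
  let ⟨hp, _, h⟩ := h
  let ⟨_, hr, h'⟩ := h'
  ⟨hp, hr, .trans _ _ _ h h'⟩

protected theorem append (h : Homot a b p p') (h' : Homot b c q q') :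
    Homot a c (p ++ q) (p' ++ q') :=
  let ⟨hp, hp', h⟩ := h
  let ⟨hq, hq', h'⟩ := h'
  ⟨hp.append hq, hp'.append hq', walk_append_congr h h'⟩

theorem of_move (hp : IsWalk a p b) (hq : IsWalk a q b) (h : Move p q) : Homot a b p q :=
  ⟨hp, hq, .rel _ _ h⟩

theorem append_rev (hp : IsWalk a p b) : Homot a a (p ++ revPath p) [] :=
  ⟨_, _, append_rev_homotopic ⟨p, hp⟩⟩

theorem rev_append (hp : IsWalk a p b) : Homot b b (revPath p ++ p) [] :=
  ⟨_, _, rev_append_homotopic ⟨p, hp⟩⟩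

/-- Cancelling a path which is followed by its inverse. -/
theorem cancel_right (hp : IsWalk a p b) (hq : IsWalk b q c) :
    Homot a b ((p ++ q) ++ revPath q) p := by
  have := (Homot.refl hp).append (append_rev hq)
  simpa [List.append_assoc] using this

theorem cancel_right' (hp : IsWalk a p b) (hq : IsWalk c q b) :
    Homot a b ((p ++ revPath q) ++ q) p := by
  have := cancel_right hp hq.rev
  rwa [revPath_revPath] at this

end Homot

theorem revPath_single (d : X.D) : revPath [d] = [X.inv d] := rfl

theorem revPath_append (p q : List X.D) : revPath (p ++ q) = revPath q ++ revPath p := by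
  simp [revPath]

theorem Hom.map_revPath (φ : Hom Y X) (p : List Y.D) :
    (revPath p).map φ.onD = revPath (p.map φ.onD) := by
  simp only [revPath, List.map_reverse, List.map_map]
  congr 1
  exact List.map_congr_left fun d _ => (φ.inv_onD d).symm

/-! ### Arcs of boundary paths -/

/-- The path of length `m` in the boundary of a 2-cell which starts with the oriented side `s`. -/
def arc (s : X.S) (m : ℕ) : List X.D := (List.range m).map fun i => X.lab (X.next^[i] s)

theorem boundaryPath_eq_arc (s : X.S) : boundaryPath s = arc s (len s) := rfl

@[simp] theorem length_arc (s : X.S) (m : ℕ) : (arc s m).length = m := by simp [arc]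

@[simp] theorem arc_zero (s : X.S) : arc s 0 = [] := rfl

theorem arc_succ (s : X.S) (m : ℕ) : arc s (m + 1) = arc s m ++ [X.lab (X.next^[m] s)] := by
  simp [arc, List.range_succ]

theorem arc_succ' (s : X.S) (m : ℕ) : arc s (m + 1) = X.lab s :: arc (X.next s) m := by
  simp only [arc, List.range_succ_eq_map, List.map_cons, List.map_map]
  rfl

theorem arc_add (s : X.S) (m n : ℕ) : arc s (m + n) = arc s m ++ arc (X.next^[m] s) n := by
  induction n with
  | zero => simp
  | succ n ih =>
    rw [← Nat.add_assoc, arc_succ, ih, arc_succ, List.append_assoc, ← Function.iterate_add_apply,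
      Nat.add_comm n m]

theorem isWalk_arc (s : X.S) (m : ℕ) :
    IsWalk (X.src (X.lab s)) (arc s m) (X.src (X.lab (X.next^[m] s))) := by
  induction m with
  | zero => exact rfl
  | succ m ih =>
    rw [arc_succ, Function.iterate_succ_apply', src_lab_next']
    exact ih.snoc

theorem next_iterate_len (s : X.S) : X.next^[len s] s = s := Function.iterate_minimalPeriod

theorem len_pos (s : X.S) : 0 < len s := by
  obtain ⟨n, hn, h⟩ := X.next_periodic s
  exact Function.IsPeriodicPt.minimalPeriod_pos hn h

theorem isWalk_boundaryPath (s : X.S) :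
    IsWalk (X.src (X.lab s)) (boundaryPath s) (X.src (X.lab s)) := by
  have := isWalk_arc s (len s)
  rwa [next_iterate_len] at this

theorem Homot.boundaryPath {a : X.V} (s : X.S) (h : X.src (X.lab s) = a) :
    Homot a a (boundaryPath s) [] := by
  subst h
  refine .of_move (isWalk_boundaryPath s) rfl ?_
  simpa using Move.cell [] [] s

theorem Hom.map_arc (φ : Hom Y X) (s : Y.S) (m : ℕ) :
    (arc s m).map φ.onD = arc (φ.onS s) m := by
  simp only [arc, List.map_map]
  refine List.map_congr_left fun i _ => ?_
  rw [φ.next_iterate_onS, φ.lab_onS, Function.comp_apply]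

/-- An oriented side and its flip are traversed in opposite directions. -/
theorem iterate_next_ne_flip (n : ℕ) (s : X.S) : X.next^[n] s ≠ X.flip s := by
  induction n using Nat.strong_induction_on generalizing s with
  | _ n ih =>
    intro h
    match n with
    | 0 =>
      have h' : s = X.flip s := h
      have := X.lab_flip s
      rw [← h'] at this
      exact X.inv_ne _ this.symm
    | 1 =>
      have h' : X.next s = X.flip s := h
      exact X.lab_next_ne s (by rw [h', X.lab_flip])
    | n + 2 =>
      -- Such a flip would be a reflection of the orbit. Moving both ends inwards by one step
      -- shortens the distance by two, until the centre is a fixed side or a backtrack.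
      refine ih n (by omega) (X.next s) ?_
      apply next_injective
      rw [X.next_flip_next, ← h, ← Function.iterate_succ_apply X.next, ← Function.iterate_succ_apply' X.next]

theorem iterate_next_symm {s t : X.S} {n : ℕ} (h : X.next^[n] s = t) : ∃ m, X.next^[m] t = s := by
  obtain ⟨k, hk, hs⟩ := X.next_periodic s
  -- With k a positive period of s, k * n is a multiple of the period and at least n, so the
  -- subtraction is not truncated.
  refine ⟨k * n - n, ?_⟩
  subst h
  rw [← Function.iterate_add_apply, Nat.sub_add_cancel (Nat.le_mul_of_pos_left n hk)]
  exact Function.IsPeriodicPt.mul_const hs n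

/-! ### Immersions -/

theorem Hom.IsOneImmersion.eq_of_tgt {φ : Hom Y X} (hφ : φ.IsOneImmersion) {d d' : Y.D}
    (ht : Y.tgt d = Y.tgt d') (h : φ.onD d = φ.onD d') : d = d' := by
  have := hφ (Y.inv d) (Y.inv d') ht (by rw [← φ.inv_onD, ← φ.inv_onD, h])
  rw [← Y.inv_inv d, this, Y.inv_inv]

theorem Hom.IsOneImmersion.walk_unique {φ : Hom Y X} (hφ : φ.IsOneImmersion) {a b b' : Y.V}
    {p q : List Y.D} (hp : IsWalk a p b) (hq : IsWalk a q b')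
    (h : p.map φ.onD = q.map φ.onD) : p = q := by
  induction p generalizing a q with
  | nil => simpa [eq_comm] using h
  | cons d p ih =>
    cases q with
    | nil => simp at h
    | cons e q =>
      simp only [List.map_cons, List.cons.injEq] at h
      obtain rfl : d = e := hφ d e (hp.1.trans hq.1.symm) h.1
      rw [ih hp.2 hq.2 h.2]

/-! ### The image of the fundamental group -/

/-- The paths in `X` which are homotopic to images of paths in `Y` from `y` to `v`. -/
def imageClasses (φ : Hom Y X) (x : X.V) (y v : Y.V) : Set (List X.D) :=
  {p | ∃ w, IsWalk y w v ∧ Homot x (φ.onV v) p (w.map φ.onD)}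

section imageClasses

variable {φ : Hom Y X} {x : X.V} {y v : Y.V} {p q : List X.D}

theorem isWalk_of_mem (h : p ∈ imageClasses φ x y v) : IsWalk x p (φ.onV v) :=
  let ⟨_, _, h⟩ := h
  h.left

theorem mem_of_homot (h : p ∈ imageClasses φ x y v) (hq : Homot x (φ.onV v) q p) :
    q ∈ imageClasses φ x y v :=
  let ⟨w, hw, h⟩ := h
  ⟨w, hw, hq.trans h⟩

theorem nil_mem (h : φ.onV y = x) : [] ∈ imageClasses φ x y y :=
  ⟨[], rfl, .refl h.symm⟩

theorem append_mem {v' : Y.V} {w : List Y.D} (h : p ∈ imageClasses φ x y v) (hw : IsWalk v w v') :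
    p ++ w.map φ.onD ∈ imageClasses φ x y v' := by
  obtain ⟨u, hu, h⟩ := h
  refine ⟨u ++ w, hu.append hw, ?_⟩
  rw [List.map_append]
  exact h.append (.refl (φ.isWalk hw))

theorem step_mem {d : Y.D} (h : p ∈ imageClasses φ x y (Y.src d)) :
    p ++ [φ.onD d] ∈ imageClasses φ x y (Y.tgt d) :=
  append_mem h (.single d)

theorem append_mem_iff {v' : Y.V} {w : List Y.D} (hw : IsWalk v w v')
    (hp : IsWalk x p (φ.onV v)) :
    p ++ w.map φ.onD ∈ imageClasses φ x y v' ↔ p ∈ imageClasses φ x y v := by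
  refine ⟨fun h => ?_, fun h => append_mem h hw⟩
  have h' := append_mem h hw.rev
  rw [φ.map_revPath] at h'
  exact mem_of_homot h' (Homot.cancel_right hp (φ.isWalk hw)).symm

/-- An induction principle: the image classes form the smallest family containing the empty path at
y and closed under 1-cells and homotopy. It bounds the image classes of a modified complex by a
family built from those of the old one. -/
theorem imageClasses_subset (K : Y.V → Set (List X.D)) (h0 : [] ∈ K y)
    (hstep : ∀ d, ∀ p ∈ K (Y.src d), IsWalk x p (φ.onV (Y.src d)) → p ++ [φ.onD d] ∈ K (Y.tgt d))
    (hhom : ∀ v p q, p ∈ K v → Homot x (φ.onV v) q p → q ∈ K v) (hx : φ.onV y = x) (v : Y.V) :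
    imageClasses φ x y v ⊆ K v := by
  have key : ∀ (w : List Y.D) (a : Y.V) (p : List X.D), p ∈ K a → IsWalk x p (φ.onV a) →
      IsWalk a w v → p ++ w.map φ.onD ∈ K v := by
    intro w
    induction w with
    | nil => rintro a p hp _ rfl; simpa using hp
    | cons d w ih =>
      rintro a p hp hwp ⟨rfl, hw⟩
      have := ih _ _ (hstep d p hp hwp) (by
        rw [← φ.src_onD] at hwp
        rw [← φ.tgt_onD]
        exact hwp.snoc) hw
      simpa using this
  rintro p ⟨w, hw, h⟩
  exact hhom _ _ _ (by simpa using key w y [] h0 hx.symm hw) h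

theorem mk_mem_range_iff (h : φ.onV y = x) (p : Walk x x) :
    (Quotient.mk (walkSetoid x x) p : Pi1 X x) ∈ (φ.pi1Map h).range ↔
      p.1 ∈ imageClasses φ x y y := by
  subst h
  constructor
  · rintro ⟨⟨w⟩, hw⟩
    refine ⟨w.1, w.2, ?_⟩
    have h2 : (walkSetoid _ _).r (φ.onLoop rfl w) p := Quotient.exact hw
    exact ⟨p.2, φ.isWalk w.2, .symm _ _ h2⟩
  · rintro ⟨w, hw, hp, hq, h⟩
    exact ⟨Quotient.mk _ ⟨w, hw⟩, Quotient.sound (.symm _ _ h)⟩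

/-- One inclusion suffices, because φ factors through ψ. -/
theorem range_eq_of_imageClasses {φ : Hom Y X} {ψ : Hom Z X} {ι : Hom Y Z} (h : φ.onV y = x)
    (hι : ψ.comp ι = φ) (h' : ψ.onV (ι.onV y) = x)
    (hT : imageClasses ψ x (ι.onV y) (ι.onV y) ⊆ imageClasses φ x y y) :
    (ψ.pi1Map h').range = (φ.pi1Map h).range := by
  ext g
  obtain ⟨p, rfl⟩ := Quotient.exists_rep g
  refine (mk_mem_range_iff h' p).trans (Iff.trans ⟨fun hp => hT hp, ?_⟩ (mk_mem_range_iff h p).symm)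
  subst hι
  rintro ⟨w, hw, hp⟩
  refine ⟨w.map ι.onD, ι.isWalk hw, ?_⟩
  rw [List.map_map]
  exact hp

end imageClasses

end TwoComplex

namespace TwoComplex

variable {X Y Z : TwoComplex.{u}}

/-! ### Group-valued cocycles -/

/-- A function on oriented 1-cells with values in a group whose product along every path depends
only on the homotopy class of the path. -/
structure IsCocycle {G : Type*} [Group G] (g : Y.D → G) : Prop where
  inv : ∀ d, g (Y.inv d) = (g d)⁻¹
  cell : ∀ s, ((boundaryPath s).map g).prod = 1

namespace IsCocycle

variable {G : Type*} [Group G] {g : Y.D → G}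

theorem move (hg : IsCocycle g) {p q : List Y.D} (h : Move p q) :
    (p.map g).prod = (q.map g).prod := by
  cases h with
  | backtrack p q d => simp [hg.inv]
  | cell p q s => simp [hg.cell]

theorem homot (hg : IsCocycle g) {a b : Y.V} {p q : List Y.D} (h : Homot a b p q) :
    (p.map g).prod = (q.map g).prod := by
  obtain ⟨hp, hq, h⟩ := h
  have key : ∀ p q : Walk a b, (walkSetoid a b).r p q → (p.1.map g).prod = (q.1.map g).prod := by
    intro p q h
    induction h with
    | rel p q h => exact hg.move h
    | refl p => rfl
    | symm p q _ ih => exact ih.symm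
    | trans p q r _ _ ih1 ih2 => exact ih1.trans ih2
  exact key _ _ h

/-- The homomorphism from the fundamental group which is given by a cocycle. -/
def hom (hg : IsCocycle g) (y : Y.V) : Pi1 Y y →* G where
  toFun := Quotient.lift (fun w : Walk y y => (w.1.map g).prod)
    fun p q h => hg.homot ⟨p.2, q.2, h⟩
  map_one' := rfl
  map_mul' := by
    rintro ⟨p⟩ ⟨q⟩
    exact (congrArg List.prod List.map_append).trans List.prod_append

theorem prod_revPath (hg : ∀ d, g (Y.inv d) = (g d)⁻¹) (p : List Y.D) :
    ((revPath p).map g).prod = ((p.map g).prod)⁻¹ := by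
  induction p with
  | nil => simp [revPath]
  | cons d p ih =>
    rw [← List.singleton_append, revPath_append, revPath_single]
    simp [ih, hg]

end IsCocycle

/-- The element of the fundamental group which is represented by a closed path. -/
def loopClass {y : Y.V} (p : List Y.D) (hp : IsWalk y p y) : Pi1 Y y :=
  Quotient.mk (walkSetoid y y) ⟨p, hp⟩

theorem loopClass_eq {y : Y.V} {p q : List Y.D} (h : Homot y y p q) :
    loopClass p h.left = loopClass q h.right :=
  Quotient.sound h.2.2

theorem loopClass_mul {y : Y.V} {p q : List Y.D} (hp : IsWalk y p y) (hq : IsWalk y q y) :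
    loopClass p hp * loopClass q hq = loopClass (p ++ q) (hp.append hq) := rfl

section Tree

/-- The 0-cell `v` is joined to `y` by a path. -/
def Reach (y v : Y.V) : Prop := ∃ p, IsWalk y p v

theorem Reach.trans {a b c : Y.V} (h : Reach a b) (h' : Reach b c) : Reach a c :=
  let ⟨_, hp⟩ := h
  let ⟨_, hq⟩ := h'
  ⟨_, hp.append hq⟩

theorem Reach.symm {a b : Y.V} (h : Reach a b) : Reach b a :=
  let ⟨_, hp⟩ := h
  ⟨_, hp.rev⟩

theorem IsWalk.reach {a b : Y.V} {p : List Y.D} (h : IsWalk a p b) : Reach a b := ⟨p, h⟩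

theorem reach_step (d : Y.D) : Reach (Y.src d) (Y.tgt d) := ⟨[d], .single d⟩

variable {y : Y.V} {γ : Y.V → List Y.D} (hγ : ∀ v, Reach y v → IsWalk y (γ v) v)

include hγ in
theorem isWalk_conj {a b : Y.V} {w : List Y.D} (ha : Reach y a) (hw : IsWalk a w b) :
    IsWalk y (γ a ++ w ++ revPath (γ b)) y :=
  ((hγ a ha).append hw).append (hγ b (ha.trans hw.reach)).rev

open Classical in
/-- The cocycle with values in the fundamental group given by a choice of paths from the base
point to the 0-cells of its component. -/
noncomputable def edgeClass (d : Y.D) : Pi1 Y y :=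
  if h : Reach y (Y.src d) then
    loopClass (γ (Y.src d) ++ [d] ++ revPath (γ (Y.tgt d))) (isWalk_conj hγ h (.single d))
  else 1

/-- The product telescopes: the way back to the base point in one factor cancels the way out in the
next. -/
theorem prod_edgeClass {a b : Y.V} {w : List Y.D} (ha : Reach y a) (hw : IsWalk a w b) :
    (w.map (edgeClass hγ)).prod =
      loopClass (γ a ++ w ++ revPath (γ b)) (isWalk_conj hγ ha hw) := by
  induction w generalizing a with
  | nil =>
    obtain rfl : a = b := hw
    exact (loopClass_eq (by simpa using Homot.append_rev (hγ a ha))).symm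
  | cons d w ih =>
    obtain ⟨rfl, hw⟩ := hw
    have ht := ha.trans (reach_step d)
    rw [List.map_cons, List.prod_cons, ih ht hw, edgeClass, dif_pos ha, loopClass_mul]
    refine loopClass_eq ?_
    have h1 : Homot y (Y.tgt d) (γ (Y.src d) ++ [d]) (γ (Y.src d) ++ [d]) :=
      .refl ((hγ _ ha).append (.single d))
    have h3 : Homot (Y.tgt d) y (w ++ revPath (γ b)) (w ++ revPath (γ b)) :=
      .refl (hw.append (hγ b (ht.trans hw.reach)).rev)
    have := (h1.append (Homot.rev_append (hγ (Y.tgt d) ht))).append h3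
    simpa [List.append_assoc] using this

theorem prod_edgeClass_of_not_reach {a b : Y.V} {w : List Y.D} (ha : ¬ Reach y a)
    (hw : IsWalk a w b) : (w.map (edgeClass hγ)).prod = 1 := by
  induction w generalizing a with
  | nil => rfl
  | cons d w ih =>
    obtain ⟨rfl, hw⟩ := hw
    rw [List.map_cons, List.prod_cons, ih (fun h => ha (h.trans (reach_step d).symm)) hw, edgeClass,
      dif_neg ha, one_mul]

theorem prod_edgeClass_congr {a b : Y.V} {w w' : List Y.D} (h : Homot a b w w') :
    (w.map (edgeClass hγ)).prod = (w'.map (edgeClass hγ)).prod := by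
  by_cases ha : Reach y a
  · have hb := ha.trans h.left.reach
    rw [prod_edgeClass hγ ha h.left, prod_edgeClass hγ ha h.right]
    exact loopClass_eq (((Homot.refl (hγ a ha)).append h).append (.refl (hγ b hb).rev))
  · rw [prod_edgeClass_of_not_reach hγ ha h.left, prod_edgeClass_of_not_reach hγ ha h.right]

theorem isCocycle_edgeClass : IsCocycle (edgeClass hγ) where
  inv d := by
    have h : IsWalk (Y.tgt d) [Y.inv d, d] (Y.tgt d) := ⟨Y.src_inv d, Y.tgt_inv d ▸ .single d⟩
    have h1 := Homot.of_move (p := [Y.inv d, d]) (q := []) h rfl (by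
      simpa [Y.inv_inv] using Move.backtrack [] [] (Y.inv d))
    simpa [mul_eq_one_iff_eq_inv] using prod_edgeClass_congr hγ h1
  cell s := prod_edgeClass_congr hγ (Homot.boundaryPath s rfl)

theorem prod_edgeClass_loop (h0 : γ y = []) {w : List Y.D} (hw : IsWalk y w y) :
    (w.map (edgeClass hγ)).prod = loopClass w hw := by
  rw [prod_edgeClass hγ ⟨[], rfl⟩ hw]
  refine loopClass_eq ?_
  rw [h0]
  simpa [revPath] using Homot.refl hw

end Tree

/-- No maximal tree is required: any choice of paths serves, as long as the one to y is empty, so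
that products around closed paths at y are not conjugated. -/
theorem exists_tree (y : Y.V) :
    ∃ γ : Y.V → List Y.D, (∀ v, Reach y v → IsWalk y (γ v) v) ∧ γ y = [] := by
  classical
  have h : ∀ v, ∃ p, Reach y v → IsWalk y p v := fun v => by
    by_cases hv : Reach y v
    · obtain ⟨p, hp⟩ := hv
      exact ⟨p, fun _ => hp⟩
    · exact ⟨[], fun h => absurd h hv⟩
  choose γ hγ using h
  refine ⟨Function.update γ y [], fun v hv => ?_, by simp⟩
  by_cases h : v = y
  · subst h
    rw [Function.update_self]
    exact rfl
  · rw [Function.update_of_ne h]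
    exact hγ v hv

/-- Homotopy classes of closed paths are detected by cocycles. -/
theorem exists_cocycle (y : Y.V) : ∃ g : Y.D → Pi1 Y y, IsCocycle g ∧
    ∀ w (hw : IsWalk y w y), (w.map g).prod = loopClass w hw := by
  obtain ⟨γ, hγ, h0⟩ := exists_tree y
  exact ⟨edgeClass hγ, isCocycle_edgeClass hγ, fun w hw => prod_edgeClass_loop hγ h0 hw⟩

/-! ### Fundamental groups of compact complexes -/

/-- The generators are the oriented 1-cells; the relators are the backtracks, the boundary paths and
the chosen paths γ v. Killing every γ v identifies d with the class of γ(src d) · d · γ(tgt d)⁻¹.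
Hence the tautological cocycle with values in the presented group and `edgeClass` with values in π₁
induce mutually inverse homomorphisms. -/
theorem isFinitelyPresented_pi1 (hc : Y.IsCompact) (hY : Y.IsConnected) (y : Y.V) :
    Group.IsFinitelyPresented (Pi1 Y y) := by
  obtain ⟨γ, hγ, h0⟩ := exists_tree y
  have hr : ∀ v, Reach y v := hY.2 y
  obtain ⟨_, _, _⟩ := hc
  let word : List Y.D → FreeGroup Y.D := fun p => (p.map FreeGroup.of).prod
  let rels : Set (FreeGroup Y.D) :=
    Set.range (fun d => word [d, Y.inv d]) ∪
      (Set.range (fun s => word (boundaryPath s)) ∪ Set.range (fun v => word (γ v)))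
  have hfin : Finite rels :=
    ((Set.finite_range _).union ((Set.finite_range _).union (Set.finite_range _))).to_subtype
  let g : Y.D → PresentedGroup rels := PresentedGroup.of
  have hword : ∀ p, (p.map g).prod = PresentedGroup.mk rels (word p) := by
    intro p
    rw [map_list_prod, List.map_map]
    rfl
  have hrel : ∀ p, word p ∈ rels → (p.map g).prod = 1 := fun p hp => by
    rw [hword]
    exact PresentedGroup.one_of_mem hp
  have hg : IsCocycle g :=
    { inv := fun d => by
        refine eq_inv_of_mul_eq_one_right ?_
        simpa using (hrel [d, Y.inv d] (Or.inl ⟨d, rfl⟩))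
      cell := fun s => hrel _ (Or.inr (Or.inl ⟨s, rfl⟩)) }
  have hγg : ∀ v, ((γ v).map g).prod = 1 := fun v => hrel _ (Or.inr (Or.inr ⟨v, rfl⟩))
  have hlift : ∀ p : List Y.D, FreeGroup.lift (edgeClass hγ) (word p) =
      (p.map (edgeClass hγ)).prod := by
    intro p
    rw [map_list_prod, List.map_map]
    congr 1
    exact List.map_congr_left fun d _ => by simp
  have hrels : ∀ r ∈ rels, FreeGroup.lift (edgeClass hγ) r = 1 := by
    rintro r (⟨d, rfl⟩ | ⟨s, rfl⟩ | ⟨v, rfl⟩)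
    · rw [hlift]
      simp [(isCocycle_edgeClass hγ).inv]
    · rw [hlift]
      exact (isCocycle_edgeClass hγ).cell s
    · rw [hlift, prod_edgeClass hγ ⟨[], rfl⟩ (hγ v (hr v))]
      refine loopClass_eq (q := []) ?_
      rw [h0]
      exact Homot.append_rev (hγ v (hr v))
  let F : PresentedGroup rels →* Pi1 Y y := PresentedGroup.toGroup hrels
  have hF : ∀ d, F (g d) = edgeClass hγ d := fun d => PresentedGroup.toGroup.of hrels
  have e1 : (hg.hom y).comp F = MonoidHom.id _ := by
    refine PresentedGroup.ext fun d => ?_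
    rw [MonoidHom.comp_apply]
    change hg.hom y (F (g d)) = g d
    rw [hF]
    rw [edgeClass, dif_pos (hr _)]
    change ((γ (Y.src d) ++ [d] ++ revPath (γ (Y.tgt d))).map g).prod = g d
    simp [IsCocycle.prod_revPath hg.inv, hγg]
  have e2 : F.comp (hg.hom y) = MonoidHom.id _ := by
    ext ⟨w⟩
    change F ((w.1.map g).prod) = loopClass w.1 w.2
    rw [map_list_prod, List.map_map, ← prod_edgeClass_loop hγ h0 w.2]
    congr 1
    exact List.map_congr_left fun d _ => hF d
  exact Group.IsFinitelyPresented.equiv (MonoidHom.toMulEquiv F (hg.hom y) e1 e2)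

end TwoComplex

/-! ### Sides that lift to a given 1-cell -/

namespace TwoComplex

variable {X Y Z : TwoComplex.{u}}

theorem Hom.onEdge_edge (φ : Hom Y X) (d : Y.D) : φ.onEdge (edge d) = edge (φ.onD d) := rfl

theorem Hom.comp_onEdge (ψ : Hom Z X) (ι : Hom Y Z) (e : Y.Edge) :
    (ψ.comp ι).onEdge e = ψ.onEdge (ι.onEdge e) := by
  obtain ⟨d, rfl⟩ := Quotient.exists_rep e
  rfl

theorem Hom.comp_onSide (ψ : Hom Z X) (ι : Hom Y Z) (σ : Y.Side) :
    (ψ.comp ι).onSide σ = ψ.onSide (ι.onSide σ) := by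
  obtain ⟨s, rfl⟩ := Quotient.exists_rep σ
  rfl

theorem Hom.at_onSide (φ : Hom Y X) (σ : Y.Side) : (φ.onSide σ).at = φ.onEdge σ.at := by
  obtain ⟨s, rfl⟩ := Quotient.exists_rep σ
  exact congrArg edge (φ.lab_onS s)

theorem edge_eq_iff {d e : X.D} : edge d = edge e ↔ d = e ∨ d = X.inv e :=
  ⟨fun h => Quotient.exact h, fun h => Quotient.sound h⟩

theorem edge_inv (d : X.D) : edge (X.inv d) = edge d := edge_eq_iff.2 (Or.inr rfl)

theorem side_eq_iff {s t : X.S} : side s = side t ↔ s = t ∨ s = X.flip t :=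
  ⟨fun h => Quotient.exact h, fun h => Quotient.sound h⟩

theorem side_flip (s : X.S) : side (X.flip s) = side s := side_eq_iff.2 (Or.inr rfl)

/-- Two oriented 1-cells over the same oriented 1-cell which span the same 1-cell are equal. -/
theorem Hom.eq_of_edge_eq (φ : Hom Y X) {d e : Y.D} (h : edge d = edge e)
    (h' : φ.onD d = φ.onD e) : d = e := by
  rcases edge_eq_iff.1 h with h | h
  · exact h
  · rw [h, ← φ.inv_onD] at h'
    exact absurd h' (X.inv_ne _)

/-- The side `σ` of `X` lifts to a side of `Y` at the 1-cell `e`. -/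
def Present (φ : Hom Y X) (e : Y.Edge) (σ : X.Side) : Prop :=
  ∃ τ : Y.Side, τ.at = e ∧ φ.onSide τ = σ

theorem Present.map {ψ : Hom Z X} {ι : Hom Y Z} {e : Y.Edge} {σ : X.Side}
    (h : Present (ψ.comp ι) e σ) : Present ψ (ι.onEdge e) σ := by
  obtain ⟨τ, rfl, rfl⟩ := h
  exact ⟨ι.onSide τ, ι.at_onSide τ, (ψ.comp_onSide ι τ).symm⟩

/-- Passes from unoriented to oriented sides: a lift with the wrong orientation is replaced by its
flip. -/
theorem present_iff {φ : Hom Y X} {d : Y.D} {s : X.S} (h : X.lab s = φ.onD d) :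
    Present φ (edge d) (side s) ↔ ∃ t, Y.lab t = d ∧ φ.onS t = s := by
  constructor
  · rintro ⟨τ, h1, h2⟩
    obtain ⟨t, rfl⟩ := Quotient.exists_rep τ
    have h1 : edge (Y.lab t) = edge d := h1
    have h2 : side (φ.onS t) = side s := h2
    rcases side_eq_iff.1 h2 with h2 | h2
    · refine ⟨t, φ.eq_of_edge_eq h1 ?_, h2⟩
      rw [← φ.lab_onS, h2, h]
    · refine ⟨Y.flip t, φ.eq_of_edge_eq ?_ ?_, ?_⟩
      · rw [Y.lab_flip, edge_inv, h1]
      · rw [← φ.lab_onS, ← φ.flip_onS, h2, X.flip_flip, h]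
      · rw [← φ.flip_onS, h2, X.flip_flip]
  · rintro ⟨t, rfl, rfl⟩
    exact ⟨side t, rfl, rfl⟩

end TwoComplex

/-! ### Counting missing sides -/

namespace WeightedComplex

variable {X : WeightedComplex.{u}} {Y K Z : TwoComplex.{u}}

/-- The missing sides of a map. -/
abbrev MissingSide (φ : Hom Y X.toTwoComplex) : Type u := Σ e : Y.Edge, missing φ e

theorem perimeter_eq_tsum (φ : Hom Y X.toTwoComplex) :
    perimeter φ = ∑' p : MissingSide φ, (X.wt p.2 : ℝ≥0∞) :=
  (ENNReal.tsum_sigma' fun p : MissingSide φ => (X.wt p.2 : ℝ≥0∞)).symm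

theorem MissingSide.ext {φ : Hom Y X.toTwoComplex} {p q : MissingSide φ} (h : p.1 = q.1)
    (h' : (p.2 : X.Side) = q.2) : p = q := by
  obtain ⟨e, σ, _⟩ := p
  obtain ⟨e', σ', _⟩ := q
  obtain rfl : e = e' := h
  obtain rfl : σ = σ' := h'
  rfl

theorem tsum_add_tsum_le {A B C : Type*} {a : A → ℝ≥0∞} {b : B → ℝ≥0∞} {c : C → ℝ≥0∞}
    (f : A ⊕ B → C) (hf : Function.Injective f) (ha : ∀ i, c (f (.inl i)) = a i)
    (hb : ∀ i, c (f (.inr i)) = b i) : ∑' i, a i + ∑' i, b i ≤ ∑' i, c i := by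
  have h := ENNReal.tsum_comp_le_tsum_of_injective hf c
  rw [Summable.tsum_sum ENNReal.summable ENNReal.summable] at h
  simpa only [ha, hb] using h

/-- A side missing at a 1-cell of Z is missing at every 1-cell of Y mapped to it, so a choice of
preimages embeds the missing sides of ψ into those of φ. -/
theorem perimeter_le_of_surjective {φ : Hom Y X.toTwoComplex} {ψ : Hom Z X.toTwoComplex}
    {ι : Hom Y Z} (hι : ψ.comp ι = φ) (hs : ∀ e, ∃ e', ι.onEdge e' = e) :
    perimeter ψ ≤ perimeter φ := by
  subst hι
  choose f hf using hs
  rw [perimeter_eq_tsum, perimeter_eq_tsum]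
  let F : MissingSide ψ → MissingSide (ψ.comp ι) := fun p =>
    ⟨f p.1, p.2, by rw [ψ.comp_onEdge, hf]; exact p.2.2.1, fun h => p.2.2.2 (by
      have := Present.map h
      rwa [hf] at this)⟩
  have hF : Function.Injective F := by
    intro p q h
    refine MissingSide.ext ?_ ?_
    · rw [← hf p.1, ← hf q.1]
      exact congrArg (fun r => ι.onEdge r.1) h
    · exact congrArg (fun r : MissingSide (ψ.comp ι) => (r.2 : X.Side)) h
  exact ENNReal.tsum_comp_le_tsum_of_injective hF fun p => (X.wt p.2 : ℝ≥0∞)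

/-- The embedding of missing sides used for the weak inequality does not hit the pair (e, σ),
because σ is present at the image of e. Finiteness turns the extra weight of σ into a strict
inequality. -/
theorem perimeter_lt_of_surjective {φ : Hom Y X.toTwoComplex} {ψ : Hom Z X.toTwoComplex}
    {ι : Hom Y Z} (hι : ψ.comp ι = φ) (hs : ∀ e, ∃ e', ι.onEdge e' = e)
    (hfin : perimeter φ ≠ ⊤) {e : Y.Edge} {σ : X.Side} (he : σ.at = φ.onEdge e)
    (hm : ¬ Present φ e σ) (hp : Present ψ (ι.onEdge e) σ) (hσ : 0 < X.wt σ) :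
    perimeter ψ < perimeter φ := by
  have key : perimeter ψ + ∑' _ : Unit, (X.wt σ : ℝ≥0∞) ≤ perimeter φ := by
    subst hι
    choose f hf using hs
    rw [perimeter_eq_tsum, perimeter_eq_tsum]
    let F : MissingSide ψ ⊕ Unit → MissingSide (ψ.comp ι) := Sum.elim (fun p =>
      ⟨f p.1, p.2, by rw [ψ.comp_onEdge, hf]; exact p.2.2.1, fun h => p.2.2.2 (by
        have := Present.map h
        rwa [hf] at this)⟩) fun _ => ⟨e, σ, he, hm⟩
    have hF : Function.Injective F := by
      have h12 : ∀ p u, F (.inl p) ≠ F (.inr u) := by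
        intro p u h
        have h1 : f p.1 = e := congrArg (fun r => r.1) h
        have h2 : (p.2 : X.Side) = σ :=
          congrArg (fun r : MissingSide (ψ.comp ι) => (r.2 : X.Side)) h
        refine p.2.2.2 ?_
        rw [← h1, hf, ← h2] at hp
        exact hp
      rintro (p | u) (q | v) h
      · refine congrArg Sum.inl (MissingSide.ext ?_ ?_)
        · rw [← hf p.1, ← hf q.1]
          exact congrArg (fun r => ι.onEdge r.1) h
        · exact congrArg (fun r : MissingSide (ψ.comp ι) => (r.2 : X.Side)) h
      · exact absurd h (h12 _ _)
      · exact absurd h.symm (h12 _ _)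
      · rfl
    exact tsum_add_tsum_le (c := fun p => (X.wt p.2 : ℝ≥0∞)) F hF (fun _ => rfl) fun _ => rfl
  rw [tsum_fintype, Finset.univ_unique, Finset.sum_singleton] at key
  refine lt_of_lt_of_le (ENNReal.lt_add_right ?_ (by exact_mod_cast hσ.ne')) key
  exact ne_top_of_le_ne_top hfin (le_self_add.trans key)

/-- The perimeter of a complex which is covered by two others, in terms of a set of common
1-cells. -/
theorem perimeter_add_le {φ : Hom Y X.toTwoComplex} {κ : Hom K X.toTwoComplex}
    {ψ : Hom Z X.toTwoComplex} {ι : Hom Y Z} {ρ : Hom K Z} (hι : ψ.comp ι = φ)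
    (hρ : ψ.comp ρ = κ) {I : Type*} (y : I → Y.Edge) (r : I → K.Edge)
    (hr : Function.Injective r) (hyr : ∀ i, ι.onEdge (y i) = ρ.onEdge (r i))
    (hcov : ∀ e, (∃ e', ι.onEdge e' = e) ∨ ∃ e', ρ.onEdge e' = e)
    (hm : ∀ i σ, Present κ (r i) σ → ¬ Present φ (y i) σ)
    (hd : ∀ i j σ, Present κ (r i) σ → Present κ (r j) σ → y i = y j → i = j) :
    perimeter ψ + ∑' i, X.edgePerimeter (φ.onEdge (y i)) ≤ perimeter φ + perimeter κ := by
  classical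
  subst hι hρ
  let C := MissingSide ψ
  let D := Σ i : I, {σ : X.Side // σ.at = (ψ.comp ι).onEdge (y i)}
  let A := MissingSide (ψ.comp ι)
  let B := MissingSide (ψ.comp ρ)
  -- A side missing in Z is charged to a 1-cell of Y over its place if there is one, and to K only
  -- otherwise.
  have hC : ∀ p : C, (∃ q : A, ι.onEdge q.1 = p.1 ∧ (q.2 : X.Side) = p.2) ∨
      ((¬ ∃ e', ι.onEdge e' = p.1) ∧ ∃ q : B, ρ.onEdge q.1 = p.1 ∧ (q.2 : X.Side) = p.2) := by
    rintro ⟨e, σ, h1, h2⟩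
    by_cases h : ∃ e', ι.onEdge e' = e
    · left
      obtain ⟨e', rfl⟩ := h
      exact ⟨⟨e', σ, by rw [ψ.comp_onEdge]; exact h1, fun h => h2 (Present.map h)⟩, rfl, rfl⟩
    · right
      refine ⟨h, ?_⟩
      obtain ⟨e', rfl⟩ := (hcov e).resolve_left h
      exact ⟨⟨e', σ, by rw [ψ.comp_onEdge]; exact h1, fun h => h2 (Present.map h)⟩, rfl, rfl⟩
  -- A side at `y i` is charged to Y if it is present in K at `r i`, being then missing in Y by
  -- `hm`; otherwise it is missing in K itself.
  have hD : ∀ p : D, (Present (ψ.comp ρ) (r p.1) p.2 ∧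
        ∃ q : A, q.1 = y p.1 ∧ (q.2 : X.Side) = p.2) ∨
      ∃ q : B, q.1 = r p.1 ∧ (q.2 : X.Side) = p.2 := by
    rintro ⟨i, σ, h1⟩
    by_cases h : Present (ψ.comp ρ) (r i) σ
    · exact Or.inl ⟨h, ⟨y i, σ, h1, hm i σ h⟩, rfl, rfl⟩
    · refine Or.inr ⟨⟨r i, σ, ?_, h⟩, rfl, rfl⟩
      rw [ψ.comp_onEdge, ← hyr, ← ψ.comp_onEdge, h1]
  have hF : ∃ F : C ⊕ D → A ⊕ B, Function.Injective F ∧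
      ∀ p, (Sum.elim (fun q : A => (q.2 : X.Side)) (fun q : B => (q.2 : X.Side)) (F p)) =
        Sum.elim (fun q : C => (q.2 : X.Side)) (fun q : D => (q.2 : X.Side)) p := by
    let RC : C → A ⊕ B → Prop := fun p q => (∃ q', q = .inl q' ∧ ι.onEdge q'.1 = p.1 ∧
      (q'.2 : X.Side) = p.2) ∨ ((¬ ∃ e', ι.onEdge e' = p.1) ∧ ∃ q', q = .inr q' ∧
        ρ.onEdge q'.1 = p.1 ∧ (q'.2 : X.Side) = p.2)
    let RD : D → A ⊕ B → Prop := fun p q => (Present (ψ.comp ρ) (r p.1) p.2 ∧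
      ∃ q', q = .inl q' ∧ q'.1 = y p.1 ∧ (q'.2 : X.Side) = p.2) ∨
        ∃ q', q = .inr q' ∧ q'.1 = r p.1 ∧ (q'.2 : X.Side) = p.2
    have hRC : ∀ p, ∃ q, RC p q := fun p => by
      rcases hC p with ⟨q, h⟩ | ⟨h', q, h⟩
      · exact ⟨.inl q, Or.inl ⟨q, rfl, h⟩⟩
      · exact ⟨.inr q, Or.inr ⟨h', q, rfl, h⟩⟩
    have hRD : ∀ p, ∃ q, RD p q := fun p => by
      rcases hD p with ⟨h', q, h⟩ | ⟨q, h⟩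
      · exact ⟨.inl q, Or.inl ⟨h', q, rfl, h⟩⟩
      · exact ⟨.inr q, Or.inr ⟨q, rfl, h⟩⟩
    -- The two kinds of charges do not collide. In Y, the second kind concerns sides present in K at
    -- an identified 1-cell, which are therefore present in Z. In K, the first kind avoids the
    -- 1-cells identified with 1-cells of Y, while every `r i` is one of these.
    have hCD : ∀ p p' q, RC p q → RD p' q → False := by
      rintro p p' q (⟨a, rfl, h1, h2⟩ | ⟨h, a, rfl, h1, h2⟩) (⟨h', b, hb, h3, h4⟩ | ⟨b, hb, h3, h4⟩)
      · obtain rfl := Sum.inl.inj hb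
        refine p.2.2.2 ?_
        have := Present.map h'
        rw [← hyr, ← h4, h2, ← h3, h1] at this
        exact this
      · cases hb
      · cases hb
      · obtain rfl := Sum.inr.inj hb
        exact h ⟨y p'.1, by rw [hyr, ← h3, h1]⟩
    choose f hf using hRC
    choose g hg using hRD
    refine ⟨Sum.elim f g, ?_, ?_⟩
    · rintro (p | p) (q | q) h
      · have h' : f p = f q := h
        have hp := hf p
        have hq := hf q
        rw [h'] at hp
        congr 1
        rcases hp with ⟨a, ha, h1, h2⟩ | ⟨-, a, ha, h1, h2⟩ <;>
          rcases hq with ⟨b, hb, h3, h4⟩ | ⟨-, b, hb, h3, h4⟩ <;> rw [ha] at hb <;> cases hb <;>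
          exact MissingSide.ext (h1.symm.trans h3) (h2.symm.trans h4)
      · exact (hCD p q _ (hf p) ((show f p = g q from h) ▸ hg q)).elim
      · exact (hCD q p _ (hf q) ((show g p = f q from h) ▸ hg p)).elim
      · have h' : g p = g q := h
        have hp := hg p
        have hq := hg q
        rw [h'] at hp
        congr 1
        have key : p.1 = q.1 → (p.2 : X.Side) = q.2 → p = q := by
          intro h1 h2
          obtain ⟨i, σ, _⟩ := p
          obtain ⟨j, τ, _⟩ := q
          obtain rfl : i = j := h1
          obtain rfl : σ = τ := h2
          rfl
        rcases hp with ⟨h0, a, ha, h1, h2⟩ | ⟨a, ha, h1, h2⟩ <;>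
          rcases hq with ⟨h0', b, hb, h3, h4⟩ | ⟨b, hb, h3, h4⟩ <;> rw [ha] at hb <;> cases hb
        · exact key (hd _ _ _ h0 (by rw [← h2, h4]; exact h0') (h1.symm.trans h3))
            (h2.symm.trans h4)
        · exact key (hr (h1.symm.trans h3)) (h2.symm.trans h4)
    · rintro (p | p)
      · rcases hf p with ⟨a, ha, h1, h2⟩ | ⟨-, a, ha, h1, h2⟩ <;>
          rw [Sum.elim_inl, ha] <;> exact h2
      · rcases hg p with ⟨-, a, ha, h1, h2⟩ | ⟨a, ha, h1, h2⟩ <;>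
          rw [Sum.elim_inr, ha] <;> exact h2
  obtain ⟨F, hF, hw⟩ := hF
  have e1 : ∑' i, X.edgePerimeter ((ψ.comp ι).onEdge (y i)) = ∑' p : D, (X.wt p.2 : ℝ≥0∞) :=
    (ENNReal.tsum_sigma' fun p : D => (X.wt p.2 : ℝ≥0∞)).symm
  have e2 : perimeter (ψ.comp ι) + perimeter (ψ.comp ρ) =
      ∑' q : A ⊕ B, (X.wt (Sum.elim (fun q : A => (q.2 : X.Side)) (fun q : B => (q.2 : X.Side)) q)
        : ℝ≥0∞) := by
    rw [Summable.tsum_sum ENNReal.summable ENNReal.summable, perimeter_eq_tsum, perimeter_eq_tsum]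
    rfl
  rw [e1, e2, perimeter_eq_tsum]
  refine tsum_add_tsum_le F hF (fun p => ?_) fun p => ?_
  · rw [hw]; rfl
  · rw [hw]; rfl

/-! ### Perimeters of compact complexes -/

theorem edgePerimeter_ne_top (e : X.Edge) : X.edgePerimeter e ≠ ⊤ := X.perimeter_finite e

theorem perimeter_ne_top (hY : Y.IsCompact) (φ : Hom Y X.toTwoComplex) : perimeter φ ≠ ⊤ := by
  have := hY.2.1
  have : Finite Y.Edge := Quotient.finite _
  have := Fintype.ofFinite Y.Edge
  rw [perimeter, tsum_fintype]
  refine ENNReal.sum_ne_top.2 fun e _ => ne_top_of_le_ne_top (edgePerimeter_ne_top (φ.onEdge e)) ?_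
  exact ENNReal.tsum_comp_le_tsum_of_injective
    (f := fun σ : missing φ e => (⟨σ.1, σ.2.1⟩ : {σ : X.Side // σ.at = φ.onEdge e}))
    (fun a b h => Subtype.ext (congrArg (fun r => r.1) h)) fun σ => (X.wt σ : ℝ≥0∞)

theorem pathPerimeter_ne_top (p : List X.D) : X.pathPerimeter p ≠ ⊤ := by
  induction p with
  | nil => simp [pathPerimeter]
  | cons d p ih =>
    rw [pathPerimeter, List.map_cons, List.sum_cons]
    exact ENNReal.add_ne_top.2 ⟨edgePerimeter_ne_top _, ih⟩

/-- Only finitely many terms are at least 1, and a natural number below 1 vanishes. -/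
theorem exists_nat_eq_tsum {A : Type*} (f : A → ℕ) (h : ∑' i, (f i : ℝ≥0∞) ≠ ⊤) :
    ∃ n : ℕ, ∑' i, (f i : ℝ≥0∞) = n := by
  have hfin := ENNReal.finite_const_le_of_tsum_ne_top h one_ne_zero
  refine ⟨∑ i ∈ hfin.toFinset, f i, ?_⟩
  rw [Nat.cast_sum]
  refine tsum_eq_sum fun i hi => ?_
  simp only [Set.Finite.mem_toFinset, Set.mem_ofPred_eq, not_le] at hi
  have : f i < 1 := by exact_mod_cast hi
  simp [Nat.lt_one_iff.1 this]

theorem exists_nat_eq_perimeter (hY : Y.IsCompact) (φ : Hom Y X.toTwoComplex) :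
    ∃ n : ℕ, perimeter φ = n := by
  have := perimeter_ne_top hY φ
  rw [perimeter_eq_tsum] at this ⊢
  exact exists_nat_eq_tsum _ this

end WeightedComplex

/-! ### Extensions over X: quotients, new 1-cells, new 2-cells -/

namespace TwoComplex

variable {X Y Z W K : TwoComplex.{u}}

theorem Hom.prod_boundaryPath {G : Type*} [Group G] (ι : Hom Y Z) (g : Z.D → G) (s : Y.S) :
    ((boundaryPath (ι.onS s)).map g).prod =
      ((boundaryPath s).map fun d => g (ι.onD d)).prod := by
  rw [← ι.map_boundaryPath, List.map_map]
  rfl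

theorem isConnected_of_base (z : Z.V) (h : ∀ v, ∃ p, IsWalk z p v) : Z.IsConnected := by
  refine ⟨⟨z⟩, fun a b => ?_⟩
  obtain ⟨p, hp⟩ := h a
  obtain ⟨q, hq⟩ := h b
  exact ⟨_, hp.rev.append hq⟩

theorem IsConnected.of_surjective (hY : Y.IsConnected) (ι : Hom Y Z)
    (h : Function.Surjective ι.onV) : Z.IsConnected := by
  obtain ⟨y⟩ := hY.1
  refine isConnected_of_base (ι.onV y) fun v => ?_
  obtain ⟨v, rfl⟩ := h v
  obtain ⟨p, hp⟩ := hY.2 y v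
  exact ⟨_, ι.isWalk hp⟩

/-- A based map `Y → Z` over `X` such that `Z` inherits finiteness, connectedness and the image of
the fundamental group from `Y`. -/
structure IsExtension (φ : Hom Y X) (ψ : Hom Z X) (ι : Hom Y Z) (x : X.V) (y : Y.V) : Prop where
  comp : ψ.comp ι = φ
  compact : Y.IsCompact → Z.IsCompact
  connected : Y.IsConnected → Z.IsConnected
  image : imageClasses ψ x (ι.onV y) (ι.onV y) ⊆ imageClasses φ x y y

/-- Cocycles on `Y` extend to `Z`. -/
def ExtendsCocycles (ι : Hom Y Z) : Prop :=
  ∀ (G : Type u) [Group G] (g : Y.D → G), IsCocycle g →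
    ∃ g' : Z.D → G, IsCocycle g' ∧ ∀ d, g' (ι.onD d) = g d

/-- The identity map. -/
def Hom.id (Y : TwoComplex.{u}) : Hom Y Y where
  onV v := v
  onD d := d
  onS s := s
  src_onD _ := rfl
  inv_onD _ := rfl
  next_onS _ := rfl
  flip_onS _ := rfl
  lab_onS _ := rfl
  next_iterate _ _ h := h

theorem IsExtension.refl (φ : Hom Y X) (x : X.V) (y : Y.V) : IsExtension φ φ (Hom.id Y) x y :=
  ⟨rfl, fun h => h, fun h => h, fun _ h => h⟩

theorem ExtendsCocycles.refl : ExtendsCocycles (Hom.id Y) := fun _ _ g hg => ⟨g, hg, fun _ => rfl⟩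

theorem IsExtension.trans {φ : Hom Y X} {ψ : Hom Z X} {χ : Hom W X} {ι : Hom Y Z} {κ : Hom Z W}
    {x : X.V} {y : Y.V} (h : IsExtension φ ψ ι x y) (h' : IsExtension ψ χ κ x (ι.onV y)) :
    IsExtension φ χ (κ.comp ι) x y where
  comp := by rw [← h.comp, ← h'.comp]; rfl
  compact hc := h'.compact (h.compact hc)
  connected hc := h'.connected (h.connected hc)
  image := fun _ hp => h.image (h'.image hp)

/-! ### Quotients -/

section Quot

variable {α : Type*} {φ : Hom Y X} {τ : Y.V → α}
  (h1 : ∀ v v', τ v = τ v' → φ.onV v = φ.onV v')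
  (h2 : ∀ d d', τ (Y.src d) = τ (Y.src d') → φ.onD d = φ.onD d' → τ (Y.tgt d) = τ (Y.tgt d'))

/-- The quotient of a complex over `X` which identifies the 0-cells with the same value of `τ`,
and the oriented 1-cells which have the same image in `X` and start at identified 0-cells. -/
def quot : TwoComplex.{u} where
  V := Quotient (Setoid.ker τ)
  D := Quotient (Setoid.ker fun d => (τ (Y.src d), φ.onD d))
  -- The 2-cells are kept apart even if they become parallel; perimeters only depend on which sides
  -- are present, not on how often.
  S := Y.S
  src := Quotient.map Y.src fun _ _ h => congrArg Prod.fst h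
  inv := Quotient.map Y.inv fun d d' h => by
    have e1 : τ (Y.src d) = τ (Y.src d') := congrArg Prod.fst h
    have e2 : φ.onD d = φ.onD d' := congrArg Prod.snd h
    exact Prod.ext (h2 d d' e1 e2) (by
      change φ.onD (Y.inv d) = φ.onD (Y.inv d')
      rw [← φ.inv_onD, e2, φ.inv_onD])
  inv_inv := by
    rintro ⟨d⟩
    exact congrArg (Quotient.mk _) (Y.inv_inv d)
  inv_ne := by
    rintro ⟨d⟩ h
    have e : φ.onD (Y.inv d) = φ.onD d := congrArg Prod.snd (Quotient.exact h)
    rw [← φ.inv_onD] at e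
    exact X.inv_ne _ e
  next := Y.next
  flip := Y.flip
  lab s := Quotient.mk _ (Y.lab s)
  flip_flip := Y.flip_flip
  next_flip_next := Y.next_flip_next
  next_periodic := Y.next_periodic
  lab_flip s := congrArg (Quotient.mk _) (Y.lab_flip s)
  src_lab_next s := congrArg (Quotient.mk _) (Y.src_lab_next s)
  lab_next_ne s h := by
    have e : φ.onD (Y.lab (Y.next s)) = φ.onD (Y.inv (Y.lab s)) :=
      congrArg Prod.snd (Quotient.exact h)
    rw [← φ.lab_onS, ← φ.inv_onD, ← φ.lab_onS, ← φ.next_onS] at e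
    exact X.lab_next_ne _ e

/-- The map from the quotient to `X`. -/
def quotMap : Hom (quot h2) X where
  onV := Quotient.lift φ.onV fun v v' h => h1 v v' h
  onD := Quotient.lift φ.onD fun _ _ h => congrArg Prod.snd h
  onS := φ.onS
  src_onD := by
    rintro ⟨d⟩
    exact φ.src_onD d
  inv_onD := by
    rintro ⟨d⟩
    exact φ.inv_onD d
  next_onS := φ.next_onS
  flip_onS := φ.flip_onS
  lab_onS := φ.lab_onS
  next_iterate := φ.next_iterate

/-- The projection to the quotient. -/
def quotProj : Hom Y (quot h2) where
  onV := Quotient.mk _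
  onD := Quotient.mk _
  onS s := s
  src_onD _ := rfl
  inv_onD _ := rfl
  next_onS _ := rfl
  flip_onS _ := rfl
  lab_onS _ := rfl
  next_iterate _ _ h := h

theorem quot_isOneImmersion : (quotMap h1 h2).IsOneImmersion := by
  rintro ⟨d⟩ ⟨d'⟩ h h'
  exact Quotient.sound (Prod.ext (Quotient.exact h) h')

theorem quot_edge_surjective (e : (quot h2).Edge) : ∃ e', (quotProj h2).onEdge e' = e := by
  obtain ⟨⟨d⟩, rfl⟩ := Quotient.exists_rep e
  exact ⟨edge d, rfl⟩

theorem quot_isCompact (hY : Y.IsCompact) : (quot h2).IsCompact := by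
  obtain ⟨_, _, h⟩ := hY
  exact ⟨Quotient.finite _, Quotient.finite _, h⟩

theorem quot_isConnected (hY : Y.IsConnected) : (quot h2).IsConnected :=
  hY.of_surjective (quotProj h2) Quotient.mk_surjective

end Quot

/-- Let `K v` be a set of paths from `x` to `φ v` which is closed under homotopy and compatible
with the 1-cells.  Identifying the 0-cells with the same `K v` gives a complex whose fundamental
group has its image in `K y`. -/
theorem exists_quot {φ : Hom Y X} {x : X.V} {y : Y.V} (h : φ.onV y = x)
    (K : Y.V → Set (List X.D)) (h0 : [] ∈ K y) (hwalk : ∀ v, ∀ p ∈ K v, IsWalk x p (φ.onV v))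
    (hstep : ∀ d, ∀ p ∈ K (Y.src d), p ++ [φ.onD d] ∈ K (Y.tgt d))
    (hhom : ∀ v p q, p ∈ K v → Homot x (φ.onV v) q p → q ∈ K v) :
    ∃ (Z : TwoComplex.{u}) (ψ : Hom Z X) (ι : Hom Y Z), ψ.comp ι = φ ∧
      (Y.IsCompact → Z.IsCompact) ∧ (Y.IsConnected → Z.IsConnected) ∧
      imageClasses ψ x (ι.onV y) (ι.onV y) ⊆ K y ∧
      ψ.IsOneImmersion ∧ (∀ e, ∃ e', ι.onEdge e' = e) ∧
      ∀ v v', φ.onV v = φ.onV v' → K v = K v' → ι.onV v = ι.onV v' := by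
  let τ : Y.V → X.V × Set (List X.D) := fun v => (φ.onV v, K v)
  have h1 : ∀ v v', τ v = τ v' → φ.onV v = φ.onV v' := fun v v' e => congrArg Prod.fst e
  -- Steps can be undone up to homotopy, so the set at the end of d is determined by the set at its
  -- start and by the image of d. This is the compatibility which `quot` needs.
  have key : ∀ d p, IsWalk x p (φ.onV (Y.tgt d)) →
      (p ∈ K (Y.tgt d) ↔ p ++ [X.inv (φ.onD d)] ∈ K (Y.src d)) := by
    intro d p hp
    refine ⟨fun hm => ?_, fun hm => ?_⟩
    · have := hstep (Y.inv d) p hm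
      rwa [Y.tgt_inv, ← φ.inv_onD] at this
    · refine hhom _ _ _ (hstep d _ hm) ?_
      have hw : IsWalk (φ.onV (Y.tgt d)) [X.inv (φ.onD d)] (φ.onV (Y.src d)) :=
        ⟨φ.tgt_onD d, (X.tgt_inv _).trans (φ.src_onD d)⟩
      simpa [revPath, X.inv_inv] using (Homot.cancel_right hp hw).symm
  have h2 : ∀ d d', τ (Y.src d) = τ (Y.src d') → φ.onD d = φ.onD d' →
      τ (Y.tgt d) = τ (Y.tgt d') := by
    intro d d' e e'
    have e1 : φ.onV (Y.tgt d) = φ.onV (Y.tgt d') := by rw [← φ.tgt_onD, e', φ.tgt_onD]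
    have e2 : K (Y.src d) = K (Y.src d') := congrArg Prod.snd e
    refine Prod.ext e1 ?_
    ext p
    change p ∈ K (Y.tgt d) ↔ p ∈ K (Y.tgt d')
    constructor
    · intro hp
      have hw := hwalk _ _ hp
      rw [key d' p (e1 ▸ hw), ← e', ← e2]
      exact (key d p hw).1 hp
    · intro hp
      have hw := hwalk _ _ hp
      rw [key d p (e1 ▸ hw), e', e2]
      exact (key d' p hw).1 hp
  refine ⟨quot h2, quotMap h1 h2, quotProj h2, rfl, quot_isCompact h2, quot_isConnected h2, ?_,
    quot_isOneImmersion h1 h2, quot_edge_surjective h2, ?_⟩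
  · let T : (quot h2).V → Set (List X.D) :=
      Quotient.lift K fun v v' e => congrArg Prod.snd e
    refine imageClasses_subset (φ := quotMap h1 h2) (y := (quotProj h2).onV y) T h0 ?_ ?_ h _
    · rintro ⟨d⟩ p hp -
      exact hstep d p hp
    · rintro ⟨v⟩ p q hp hq
      exact hhom v p q hp hq
  · intro v v' e e'
    exact Quotient.sound (Prod.ext e e')

/-- Identifying the 0-cells which are the end points of the same paths, up to the image of the
fundamental group, does not change this image. -/
theorem exists_quot_image {φ : Hom Y X} {x : X.V} {y : Y.V} (h : φ.onV y = x) :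
    ∃ (Z : TwoComplex.{u}) (ψ : Hom Z X) (ι : Hom Y Z), IsExtension φ ψ ι x y ∧
      ψ.IsOneImmersion ∧ (∀ e, ∃ e', ι.onEdge e' = e) ∧
      ∀ v v', φ.onV v = φ.onV v' → imageClasses φ x y v = imageClasses φ x y v' →
        ι.onV v = ι.onV v' := by
  obtain ⟨Z, ψ, ι, h1, h2, h3, h4, h5⟩ := exists_quot h (imageClasses φ x y) (nil_mem h)
    (fun _ _ => isWalk_of_mem) (fun _ _ => step_mem) fun _ _ _ => mem_of_homot
  exact ⟨Z, ψ, ι, ⟨h1, h2, h3, h4⟩, h5⟩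

/-! ### Adding a 1-cell -/

section AddEdge

variable {V' : Type u} (j : Y.V → V') (a b : V')

/-- The complex obtained from `Y` by a change of the 0-cells and the addition of a 1-cell from `a`
to `b`. -/
def addEdge : TwoComplex.{u} where
  V := V'
  D := Y.D ⊕ ULift.{u} Bool
  S := Y.S
  src := Sum.elim (fun d => j (Y.src d)) fun t => bif t.down then a else b
  inv := Sum.map Y.inv fun t => ⟨!t.down⟩
  inv_inv := by
    rintro (d | ⟨_ | _⟩)
    · exact congrArg Sum.inl (Y.inv_inv d)
    · rfl
    · rfl
  inv_ne := by
    rintro (d | ⟨t⟩) h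
    · exact Y.inv_ne d (Sum.inl.inj h)
    · exact absurd (congrArg ULift.down (Sum.inr.inj h)) (by simp)
  next := Y.next
  flip := Y.flip
  lab s := Sum.inl (Y.lab s)
  flip_flip := Y.flip_flip
  next_flip_next := Y.next_flip_next
  next_periodic := Y.next_periodic
  lab_flip s := congrArg Sum.inl (Y.lab_flip s)
  src_lab_next s := congrArg j (Y.src_lab_next s)
  lab_next_ne s h := Y.lab_next_ne s (Sum.inl.inj h)

/-- The map from `Y` to the complex with an additional 1-cell. -/
def addEdgeIncl : Hom Y (addEdge j a b) where
  onV := j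
  onD := Sum.inl
  onS s := s
  src_onD _ := rfl
  inv_onD _ := rfl
  next_onS _ := rfl
  flip_onS _ := rfl
  lab_onS _ := rfl
  next_iterate _ _ h := h

/-- The additional oriented 1-cell. -/
def newEdge : (addEdge j a b).D := Sum.inr ⟨true⟩

/-- The map from the complex with an additional 1-cell to `X`. -/
def addEdgeMap {φ : Hom Y X} {vX : V' → X.V} {e : X.D} (hj : ∀ v, vX (j v) = φ.onV v)
    (ha : X.src e = vX a) (hb : X.tgt e = vX b) : Hom (addEdge j a b) X where
  onV := vX
  onD := Sum.elim φ.onD fun t => bif t.down then e else X.inv e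
  onS := φ.onS
  src_onD := by
    rintro (d | ⟨_ | _⟩)
    · exact (φ.src_onD d).trans (hj _).symm
    · exact hb
    · exact ha
  inv_onD := by
    rintro (d | ⟨_ | _⟩)
    · exact φ.inv_onD d
    · exact X.inv_inv e
    · rfl
  next_onS := φ.next_onS
  flip_onS := φ.flip_onS
  lab_onS := φ.lab_onS
  next_iterate := φ.next_iterate

theorem addEdge_isCompact [Finite V'] (hY : Y.IsCompact) : (addEdge j a b).IsCompact := by
  obtain ⟨_, _, h⟩ := hY
  exact ⟨‹Finite V'›, (inferInstance : Finite (Y.D ⊕ ULift.{u} Bool)), h⟩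

theorem addEdge_isOneImmersion {φ : Hom Y X} {vX : V' → X.V} {e : X.D}
    (hj : ∀ v, vX (j v) = φ.onV v) (ha : X.src e = vX a) (hb : X.tgt e = vX b)
    (hφ : φ.IsOneImmersion) (hinj : Function.Injective j)
    (h1 : ∀ d, j (Y.src d) = a → φ.onD d ≠ e) (h2 : ∀ d, j (Y.src d) = b → φ.onD d ≠ X.inv e) :
    (addEdgeMap j a b hj ha hb).IsOneImmersion := by
  rintro (d | ⟨_ | _⟩) (d' | ⟨_ | _⟩) h h'
  · exact congrArg Sum.inl (hφ d d' (hinj h) h')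
  · exact absurd h' (h2 d h)
  · exact absurd h' (h1 d h)
  · exact absurd h'.symm (h2 d' h.symm)
  · rfl
  · exact absurd h' (X.inv_ne e)
  · exact absurd h'.symm (h1 d' h.symm)
  · exact absurd h'.symm (X.inv_ne e)
  · rfl

/-- No 2-cell runs over the new 1-cell, so the value there is free. -/
theorem addEdge_cocycle {G : Type*} [Group G] {g : Y.D → G} (hg : IsCocycle g) (t : G) :
    ∃ g' : (addEdge j a b).D → G, IsCocycle g' ∧ (∀ d, g' ((addEdgeIncl j a b).onD d) = g d) ∧
      g' (newEdge j a b) = t := by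
  refine ⟨Sum.elim g fun s => bif s.down then t else t⁻¹, ⟨?_, ?_⟩, fun _ => rfl, rfl⟩
  · rintro (d | ⟨_ | _⟩)
    · exact hg.inv d
    · exact (_root_.inv_inv t).symm
    · rfl
  · intro s
    exact ((addEdgeIncl j a b).prod_boundaryPath _ s).trans (hg.cell s)

theorem addEdge_cover (d : (addEdge j a b).D) : (∃ d', (addEdgeIncl j a b).onD d' = d) ∨
    d = newEdge j a b ∨ d = (addEdge j a b).inv (newEdge j a b) := by
  rcases d with d | ⟨_ | _⟩
  · exact Or.inl ⟨d, rfl⟩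
  · exact Or.inr (Or.inr rfl)
  · exact Or.inr (Or.inl rfl)

end AddEdge

/-- Attaching a 1-cell at one of its ends. -/
theorem exists_pendant {φ : Hom Y X} {x : X.V} {y : Y.V} (h : φ.onV y = x) (b : Y.V) (e : X.D)
    (he : X.src e = φ.onV b) :
    ∃ (Z : TwoComplex.{u}) (ψ : Hom Z X) (ι : Hom Y Z) (e' : Z.D), IsExtension φ ψ ι x y ∧
      ExtendsCocycles ι ∧ Function.Injective ι.onV ∧ Z.src e' = ι.onV b ∧ ψ.onD e' = e ∧
      (∀ d, (∃ d', ι.onD d' = d) ∨ d = e' ∨ d = Z.inv e') ∧ (∀ v, ι.onV v ≠ Z.tgt e') ∧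
      (φ.IsOneImmersion → (∀ d, Y.src d = b → φ.onD d ≠ e) → ψ.IsOneImmersion) := by
  let j : Y.V → Option Y.V := some
  let vX : Option Y.V → X.V := fun o => o.elim (X.tgt e) φ.onV
  let ψ := addEdgeMap (φ := φ) (vX := vX) (e := e) j (some b) none (fun _ => rfl) he rfl
  let ι := addEdgeIncl (Y := Y) j (some b) none
  refine ⟨addEdge j (some b) none, ψ, ι, newEdge j (some b) none, ⟨rfl, fun hc => ?_, fun hc => ?_,
    ?_⟩, ?_, Option.some_injective _, rfl, rfl, addEdge_cover _ _ _,
    fun v hv => Option.some_ne_none v hv, ?_⟩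
  · have := hc.1
    exact addEdge_isCompact j _ _ hc
  · refine isConnected_of_base (ι.onV y) ?_
    have hs : ∀ v, ∃ p, IsWalk (ι.onV y) p (ι.onV v) := fun v => by
      obtain ⟨p, hp⟩ := hc.2 y v
      exact ⟨_, ι.isWalk hp⟩
    rintro (_ | v)
    · obtain ⟨p, hp⟩ := hs b
      exact ⟨p ++ [newEdge j (some b) none], hp.append ⟨rfl, rfl⟩⟩
    · exact hs v
  -- The new 0-cell receives the paths which fall into the class at b after returning along e. Since
  -- its only 1-cell leads back to b, no new classes arise at y.
  · let T : Option Y.V → Set (List X.D) := fun o =>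
      o.elim {p | p ++ [X.inv e] ∈ imageClasses φ x y b} (imageClasses φ x y)
    refine imageClasses_subset (φ := ψ) (y := ι.onV y) T (nil_mem h) ?_ ?_ h (ι.onV y)
    · rintro (d | ⟨_ | _⟩) p hp hw
      · exact step_mem (d := d) hp
      · exact hp
      · refine mem_of_homot hp ?_
        have hw' : IsWalk x p (φ.onV b) := hw
        exact Homot.cancel_right (q := [e]) hw' ⟨he, rfl⟩
    · rintro (_ | v) p q hp hq
      · have hp' : p ++ [X.inv e] ∈ imageClasses φ x y b := hp
        have hq' : Homot x (X.tgt e) q p := hq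
        refine mem_of_homot hp' (hq'.append (.refl ?_))
        exact ⟨rfl, (X.tgt_inv e).trans he⟩
      · exact mem_of_homot hp hq
  · intro G _ g hg
    obtain ⟨g', hg', h1, -⟩ := addEdge_cocycle j (some b) none hg 1
    exact ⟨g', hg', h1⟩
  · intro hφ hb
    refine addEdge_isOneImmersion _ _ _ _ _ _ hφ (Option.some_injective _) ?_ ?_
    · intro d hd
      exact hb d (Option.some_injective _ hd)
    · intro d hd
      exact absurd hd (Option.some_ne_none _)

/-! ### Attaching 2-cells -/

/-- A map over `X` from the 1-skeleton of `K` to the 1-skeleton of `Y`. -/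
structure GraphMap (κ : Hom K X) (φ : Hom Y X) where
  onV : K.V → Y.V
  onD : K.D → Y.D
  src_onD : ∀ d, Y.src (onD d) = onV (K.src d)
  inv_onD : ∀ d, Y.inv (onD d) = onD (K.inv d)
  comp_onV : ∀ v, φ.onV (onV v) = κ.onV v
  comp_onD : ∀ d, φ.onD (onD d) = κ.onD d

section Glue

variable {κ : Hom K X} {φ : Hom Y X} (f : GraphMap κ φ)

/-- The complex obtained from `Y` by attaching the 2-cells of `K` along a map of 1-skeletons. -/
def glue : TwoComplex.{u} where
  V := Y.V
  D := Y.D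
  S := Y.S ⊕ K.S
  src := Y.src
  inv := Y.inv
  inv_inv := Y.inv_inv
  inv_ne := Y.inv_ne
  next := Sum.map Y.next K.next
  flip := Sum.map Y.flip K.flip
  lab := Sum.elim Y.lab fun s => f.onD (K.lab s)
  flip_flip := by
    rintro (s | s)
    · exact congrArg Sum.inl (Y.flip_flip s)
    · exact congrArg Sum.inr (K.flip_flip s)
  next_flip_next := by
    rintro (s | s)
    · exact congrArg Sum.inl (Y.next_flip_next s)
    · exact congrArg Sum.inr (K.next_flip_next s)
  next_periodic := by
    rintro (s | s)
    · obtain ⟨n, hn, h⟩ := Y.next_periodic s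
      refine ⟨n, hn, ?_⟩
      rw [← (Function.Semiconj.iterate_right (f := Sum.inl) (fun _ => rfl) n).eq, h]
    · obtain ⟨n, hn, h⟩ := K.next_periodic s
      refine ⟨n, hn, ?_⟩
      rw [← (Function.Semiconj.iterate_right (f := Sum.inr) (fun _ => rfl) n).eq, h]
  lab_flip := by
    rintro (s | s)
    · exact Y.lab_flip s
    · exact (congrArg f.onD (K.lab_flip s)).trans (f.inv_onD _).symm
  src_lab_next := by
    rintro (s | s)
    · exact Y.src_lab_next s
    · change Y.src (f.onD (K.lab (K.next s))) = Y.src (Y.inv (f.onD (K.lab s)))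
      rw [f.inv_onD, f.src_onD, f.src_onD, K.src_lab_next]
  lab_next_ne := by
    rintro (s | s)
    · exact Y.lab_next_ne s
    · intro h
      have h' : f.onD (K.lab (K.next s)) = Y.inv (f.onD (K.lab s)) := h
      rw [f.inv_onD] at h'
      have := congrArg φ.onD h'
      rw [f.comp_onD, f.comp_onD, ← κ.inv_onD, ← κ.lab_onS, ← κ.lab_onS, ← κ.next_onS] at this
      exact X.lab_next_ne _ this

theorem glue_next_iterate_inl (n : ℕ) (s : Y.S) :
    (glue f).next^[n] (Sum.inl s) = Sum.inl (Y.next^[n] s) :=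
  ((Function.Semiconj.iterate_right (f := Sum.inl) (fun _ => rfl) n).eq s).symm

theorem glue_next_iterate_inr (n : ℕ) (s : K.S) :
    (glue f).next^[n] (Sum.inr s) = Sum.inr (K.next^[n] s) :=
  ((Function.Semiconj.iterate_right (f := Sum.inr) (fun _ => rfl) n).eq s).symm

/-- The map to `X`. -/
def glueMap : Hom (glue f) X where
  onV := φ.onV
  onD := φ.onD
  onS := Sum.elim φ.onS κ.onS
  src_onD := φ.src_onD
  inv_onD := φ.inv_onD
  next_onS := by
    rintro (s | s)
    · exact φ.next_onS s
    · exact κ.next_onS s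
  flip_onS := by
    rintro (s | s)
    · exact φ.flip_onS s
    · exact κ.flip_onS s
  lab_onS := by
    rintro (s | s)
    · exact φ.lab_onS s
    · exact (κ.lab_onS s).trans (f.comp_onD _).symm
  next_iterate := by
    rintro (s | s) n h
    · rw [glue_next_iterate_inl, φ.next_iterate s n h]
    · rw [glue_next_iterate_inr, κ.next_iterate s n h]

/-- The inclusion of `Y`. -/
def glueInl : Hom Y (glue f) where
  onV v := v
  onD d := d
  onS := Sum.inl
  src_onD _ := rfl
  inv_onD _ := rfl
  next_onS _ := rfl
  flip_onS _ := rfl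
  lab_onS _ := rfl
  next_iterate s n h := by
    rw [glue_next_iterate_inl] at h
    exact Sum.inl_injective h

/-- The map from `K`. -/
def glueInr : Hom K (glue f) where
  onV := f.onV
  onD := f.onD
  onS := Sum.inr
  src_onD := f.src_onD
  inv_onD := f.inv_onD
  next_onS _ := rfl
  flip_onS _ := rfl
  lab_onS _ := rfl
  next_iterate s n h := by
    rw [glue_next_iterate_inr] at h
    exact Sum.inr_injective h

theorem glueMap_comp_inr : (glueMap f).comp (glueInr f) = κ :=
  Hom.ext_maps f.comp_onV f.comp_onD fun _ => rfl

/-- Image classes are formed with paths in the 1-skeleton, which is unchanged, and with homotopies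
in X; additional 2-cells do not matter. -/
theorem glue_imageClasses (x : X.V) (y v : Y.V) (hx : φ.onV y = x) :
    imageClasses (glueMap f) x y v ⊆ imageClasses φ x y v := by
  refine imageClasses_subset (φ := glueMap f) (fun v : Y.V => imageClasses φ x y v) (nil_mem hx)
    ?_ ?_ hx v
  · intro d p hp _
    exact step_mem (φ := φ) (d := d) hp
  · intro v p q hp hq
    exact mem_of_homot (φ := φ) hp hq

theorem isExtension_glue [Finite K.S] {x : X.V} {y : Y.V} (hx : φ.onV y = x) :
    IsExtension φ (glueMap f) (glueInl f) x y where
  comp := rfl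
  compact := by
    rintro ⟨hV, hD, hS⟩
    exact ⟨hV, hD, (inferInstance : Finite (Y.S ⊕ K.S))⟩
  connected hc := hc.of_surjective (glueInl f) fun v => ⟨v, rfl⟩
  image := glue_imageClasses f x y y hx

theorem glue_cocycle {G : Type*} [Group G] {g : Y.D → G} (hg : IsCocycle g)
    (h : ∀ s, ((boundaryPath s).map fun d => g (f.onD d)).prod = 1) :
    IsCocycle (Y := glue f) g where
  inv := hg.inv
  cell := by
    rintro (s | s)
    · exact ((glueInl f).prod_boundaryPath g s).trans (hg.cell s)
    · exact ((glueInr f).prod_boundaryPath g s).trans (h s)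

end Glue

end TwoComplex

namespace TwoComplex

variable {X Y Z K : TwoComplex.{u}}

/-! ### Entries of paths -/

section Entries

variable {a b : Y.V} {w : List Y.D}

theorem IsWalk.drop (hw : IsWalk a w b) {i : ℕ} (hi : i < w.length) :
    IsWalk (Y.src w[i]) (w.drop i) b := by
  rw [← List.take_append_drop i w, List.drop_eq_getElem_cons hi] at hw
  obtain ⟨c, -, h⟩ := isWalk_append_iff.1 hw
  rw [List.drop_eq_getElem_cons hi]
  exact ⟨rfl, h.2⟩

theorem IsWalk.take (hw : IsWalk a w b) {i : ℕ} (hi : i < w.length) :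
    IsWalk a (w.take i) (Y.src w[i]) := by
  rw [← List.take_append_drop i w, List.drop_eq_getElem_cons hi] at hw
  obtain ⟨c, h, h'⟩ := isWalk_append_iff.1 hw
  rwa [h'.1]

theorem IsWalk.src_getElem_zero (hw : IsWalk a w b) (hi : 0 < w.length) : Y.src w[0] = a :=
  (hw.take hi : a = Y.src w[0]).symm

theorem IsWalk.src_getElem_succ (hw : IsWalk a w b) {i : ℕ} (hi : i + 1 < w.length) :
    Y.src w[i + 1] = Y.tgt w[i] := by
  have := hw.drop (Nat.lt_of_succ_lt hi)
  rw [List.drop_eq_getElem_cons (Nat.lt_of_succ_lt hi), List.drop_eq_getElem_cons hi] at this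
  exact this.2.1

theorem IsWalk.tgt_getElem_last (hw : IsWalk a w b) {i : ℕ} (hi : i < w.length)
    (h : i + 1 = w.length) : Y.tgt w[i] = b := by
  have := hw.drop hi
  rw [List.drop_eq_getElem_cons hi, List.drop_of_length_le h.ge] at this
  exact this.2

/-- Going around a closed path. -/
theorem IsWalk.src_getElem_mod (hw : IsWalk a w a) (h : 0 < w.length) (n : ℕ) :
    Y.src (w[(n + 1) % w.length]'(Nat.mod_lt _ h)) = Y.tgt (w[n % w.length]'(Nat.mod_lt _ h)) := by
  have hlt := Nat.mod_lt n h
  by_cases hn : n % w.length + 1 = w.length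
  · have e : (n + 1) % w.length = 0 := by
      rw [Nat.add_mod]
      rcases Nat.lt_or_ge 1 w.length with h1 | h1
      · rw [Nat.mod_eq_of_lt h1, hn, Nat.mod_self]
      · have : w.length = 1 := by omega
        rw [this, Nat.mod_one]
    rw [hw.tgt_getElem_last hlt hn]
    simp only [e]
    exact hw.src_getElem_zero h
  · have e : (n + 1) % w.length = n % w.length + 1 := by
      have h1 : 1 < w.length := by omega
      rw [Nat.add_mod, Nat.mod_eq_of_lt h1, Nat.mod_eq_of_lt (by omega)]
    simp only [e]
    exact hw.src_getElem_succ _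

theorem onD_getElem {φ : Hom Y X} {s : X.S} {m : ℕ} (h : w.map φ.onD = arc s m) {i : ℕ}
    (hi : i < w.length) : φ.onD w[i] = X.lab (X.next^[i] s) := by
  have h1 : (w.map φ.onD)[i]? = (arc s m)[i]? := by rw [h]
  have hl : w.length = m := by simpa using congrArg List.length h
  have hm : i < m := hl ▸ hi
  simpa [arc, hi, hm] using h1

theorem length_eq_of_map {φ : Hom Y X} {s : X.S} {m : ℕ} (h : w.map φ.onD = arc s m) :
    w.length = m := by simpa using congrArg List.length h

end Entries

/-! ### Boundary paths and cocycles -/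

theorem iterate_next_flip (n : ℕ) (s : X.S) : X.next^[n] (X.flip (X.next^[n] s)) = X.flip s := by
  induction n generalizing s with
  | zero => rfl
  | succ n ih =>
    rw [Function.iterate_succ_apply' X.next n s, Function.iterate_succ_apply, X.next_flip_next, ih]

theorem len_flip (s : X.S) : len (X.flip s) = len s := by
  have key : ∀ s : X.S, len (X.flip s) ∣ len s := fun s => by
    refine Function.IsPeriodicPt.minimalPeriod_dvd ?_
    have := iterate_next_flip (len s) s
    rwa [next_iterate_len] at this
  refine Nat.dvd_antisymm (key s) ?_
  have := key (X.flip s)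
  rwa [X.flip_flip] at this

theorem len_next (s : X.S) : len (X.next s) = len s := by
  have hp : ∀ n, X.next^[n] (X.next s) = X.next s ↔ X.next^[n] s = s := fun n => by
    rw [← Function.iterate_succ_apply, Function.iterate_succ_apply']
    exact next_injective.eq_iff
  refine Nat.dvd_antisymm ?_ ?_
  · exact Function.IsPeriodicPt.minimalPeriod_dvd ((hp _).2 (next_iterate_len s))
  · exact Function.IsPeriodicPt.minimalPeriod_dvd ((hp _).1 (next_iterate_len (X.next s)))

theorem len_iterate_next (n : ℕ) (s : X.S) : len (X.next^[n] s) = len s := by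
  induction n with
  | zero => rfl
  | succ n ih => rw [Function.iterate_succ_apply', len_next, ih]

theorem arc_flip (n : ℕ) (s : X.S) :
    arc (X.flip (X.next^[n] s)) (n + 1) = revPath (arc s (n + 1)) := by
  induction n with
  | zero => simp [arc_succ, X.lab_flip, revPath]
  | succ n ih =>
    rw [arc_succ', Function.iterate_succ_apply', X.next_flip_next, ih, arc_succ s (n + 1),
      revPath_append, revPath_single, X.lab_flip, Function.iterate_succ_apply']
    rfl

/-- The reversed boundary path starts with the flip of the last side, and `flip (prev s)` is `next
(flip s)`. -/
theorem boundaryPath_next_flip (s : X.S) :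
    boundaryPath (X.next (X.flip s)) = revPath (boundaryPath s) := by
  obtain ⟨n, hn⟩ : ∃ n, len s = n + 1 := ⟨len s - 1, by have := len_pos s; omega⟩
  rw [boundaryPath_eq_arc, boundaryPath_eq_arc, len_next, len_flip, hn, ← arc_flip]
  congr 1
  apply next_injective.iterate n
  rw [iterate_next_flip, ← Function.iterate_succ_apply]
  have := next_iterate_len (X.flip s)
  rwa [len_flip, hn] at this

section Products

variable {G : Type*} [Group G] {g : X.D → G}

theorem prod_boundaryPath_next (s : X.S) :
    ((boundaryPath (X.next s)).map g).prod = 1 ↔ ((boundaryPath s).map g).prod = 1 := by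
  obtain ⟨n, hn⟩ : ∃ n, len s = n + 1 := ⟨len s - 1, by have := len_pos s; omega⟩
  have e : X.next^[n] (X.next s) = s := by
    rw [← Function.iterate_succ_apply, Nat.succ_eq_add_one, ← hn, next_iterate_len]
  rw [boundaryPath_eq_arc, boundaryPath_eq_arc, len_next, hn, arc_succ, arc_succ', e]
  simp only [List.map_append, List.prod_append, List.map_cons, List.prod_cons, List.map_nil,
    List.prod_nil, mul_one]
  rw [mul_eq_one_iff_eq_inv, mul_eq_one_iff_eq_inv']

theorem prod_boundaryPath_iterate_next (n : ℕ) (s : X.S) :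
    ((boundaryPath (X.next^[n] s)).map g).prod = 1 ↔ ((boundaryPath s).map g).prod = 1 := by
  induction n with
  | zero => rfl
  | succ n ih => rw [Function.iterate_succ_apply', prod_boundaryPath_next, ih]

theorem prod_boundaryPath_flip (hg : ∀ d, g (X.inv d) = (g d)⁻¹) {s : X.S}
    (h : ((boundaryPath s).map g).prod = 1) : ((boundaryPath (X.flip s)).map g).prod = 1 := by
  rw [← prod_boundaryPath_next, boundaryPath_next_flip, IsCocycle.prod_revPath hg, h, inv_one]

end Products

/-! ### Packets -/

instance (s : X.S) : Finite (Cyc s) := by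
  refine Finite.of_surjective
    (fun i : Fin (len s) => (⟨X.next^[(i : ℕ)] s, ⟨i, rfl⟩⟩ : Cyc s)) ?_
  rintro ⟨_, n, rfl⟩
  refine ⟨⟨n % len s, Nat.mod_lt _ (len_pos s)⟩, Cyc.ext ?_⟩
  exact Function.iterate_mod_minimalPeriod_eq

instance (s : X.S) : Finite (packet s).S := by
  refine Finite.of_injective
    (fun t : PacketSide s => (t.pos, t.cell, t.dir)) fun t t' h => ?_
  simp only [Prod.mk.injEq] at h
  exact PacketSide.ext h.1 h.2.1 h.2.2

theorem present_packetMap {s : X.S} {c : Cyc s} {σ : X.Side}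
    (h : Present (packetMap s) (edge (X := packet s) (c, true)) σ) :
    ∃ c' : Cyc s, Cyc.SameLabels c c' ∧ σ = side c'.val := by
  obtain ⟨τ, h1, rfl⟩ := h
  obtain ⟨⟨c₁, c', hs, b⟩, rfl⟩ := Quotient.exists_rep τ
  have h1 : edge (X := packet s) (c₁, b) = edge (X := packet s) (c, true) := h1
  obtain rfl : c₁ = c := by
    rcases edge_eq_iff.1 h1 with h | h <;> exact congrArg Prod.fst h
  refine ⟨c', hs, ?_⟩
  cases b
  · exact side_flip c'.val
  · rfl

theorem packet_edge_injective {s : X.S} {c c' : Cyc s}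
    (h : edge (X := packet s) (c, true) = edge (X := packet s) (c', true)) : c = c' := by
  rcases edge_eq_iff.1 h with h | h <;> exact congrArg Prod.fst h

theorem packet_edge_eq {s : X.S} (e : (packet s).Edge) :
    ∃ c : Cyc s, e = edge (X := packet s) (c, true) := by
  obtain ⟨⟨c, b⟩, rfl⟩ := Quotient.exists_rep e
  refine ⟨c, ?_⟩
  cases b
  · exact edge_inv (X := packet s) (c, true)
  · rfl

theorem iterate_next_inj {s : X.S} {i j : ℕ} (hi : i < len s) (hj : j < len s)
    (h : X.next^[i] s = X.next^[j] s) : i = j :=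
  Function.iterate_injOn_Iio_minimalPeriod hi hj h

/-- A closed lift of the boundary path of a 2-cell gives a map of the 1-skeleton of its packet. -/
theorem exists_graphMap {φ : Hom Y X} {s s' : X.S} (hs : ∃ n, X.next^[n] s' = s) {a : Y.V}
    {w : List Y.D} (hw : IsWalk a w a) (hl : w.map φ.onD = boundaryPath s') :
    ∃ f : GraphMap (packetMap s) φ, (∀ (i : ℕ) (hi : i < w.length) (c : Cyc s),
      c.val = X.next^[i] s' → f.onD (c, true) = w[i]) ∧
      ∀ (G : Type u) [Group G] (g : Y.D → G), (∀ d, g (Y.inv d) = (g d)⁻¹) →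
        (w.map g).prod = 1 →
          ∀ t : (packet s).S, ((boundaryPath t).map fun d => g (f.onD d)).prod = 1 := by
  have hlen : w.length = len s' := length_eq_of_map hl
  have hpos : 0 < w.length := hlen ▸ len_pos s'
  have hidx : ∀ c : Cyc s, ∃ i, i < w.length ∧ X.next^[i] s' = c.val := by
    rintro ⟨_, n, rfl⟩
    obtain ⟨m, rfl⟩ := hs
    refine ⟨(n + m) % len s', hlen.symm ▸ Nat.mod_lt _ (len_pos s'), ?_⟩
    change X.next^[(n + m) % len s'] s' = X.next^[n] (X.next^[m] s')
    rw [← Function.iterate_add_apply]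
    exact Function.iterate_mod_minimalPeriod_eq
  choose idx hidx hval using hidx
  have huniq : ∀ (c : Cyc s) (n : ℕ), c.val = X.next^[n] s' → idx c = n % w.length := by
    intro c n h
    refine iterate_next_inj (s := s') (hlen ▸ hidx c) (hlen ▸ Nat.mod_lt _ hpos) ?_
    rw [hval, h, hlen]
    exact Function.iterate_mod_minimalPeriod_eq.symm
  have hℓ : ∀ c : Cyc s, φ.onD (w[idx c]'(hidx c)) = X.lab c.val := fun c => by
    rw [onD_getElem hl, hval]
  have hnext : ∀ c : Cyc s, Y.src (w[idx c.next]'(hidx _)) = Y.tgt (w[idx c]'(hidx c)) := by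
    intro c
    have h1 := huniq c.next (idx c + 1) (by
      rw [Function.iterate_succ_apply', hval]; rfl)
    have h2 := hw.src_getElem_mod hpos (idx c)
    simp only [Nat.mod_eq_of_lt (hidx c)] at h2
    simp only [h1]
    exact h2
  let f : GraphMap (packetMap s) φ :=
    { onV := fun c : Cyc s => Y.src (w[idx c]'(hidx c))
      onD := fun d : Cyc s × Bool => bif d.2 then w[idx d.1]'(hidx _) else
        Y.inv (w[idx d.1]'(hidx _))
      src_onD := by
        rintro ⟨c, _ | _⟩
        · exact (hnext c).symm
        · rfl
      inv_onD := by
        rintro ⟨c, _ | _⟩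
        · exact Y.inv_inv _
        · rfl
      comp_onV := fun c : Cyc s => (φ.src_onD _).symm.trans (congrArg X.src (hℓ c))
      comp_onD := by
        rintro ⟨c, _ | _⟩
        · change φ.onD (Y.inv _) = X.inv _
          rw [← φ.inv_onD, hℓ]
        · exact hℓ c }
  have hf : ∀ (i : ℕ) (hi : i < w.length) (c : Cyc s),
      c.val = X.next^[i] s' → f.onD (c, true) = w[i] := by
    intro i hi c h
    have := huniq c i h
    rw [Nat.mod_eq_of_lt hi] at this
    subst this
    rfl
  refine ⟨f, hf, ?_⟩
  intro G _ g hg hw1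
  have hginv : ∀ d, g (f.onD ((packet s).inv d)) = (g (f.onD d))⁻¹ := fun d => by
    rw [← f.inv_onD, hg]
  -- Every 2-cell of the packet is attached along the whole circle, so its boundary path maps to w
  -- up to rotation and reversal. Rotation conjugates the product and reversal inverts it.
  have htrue : ∀ t : PacketSide s, t.dir = true →
      ((boundaryPath (X := packet s) t).map fun d => g (f.onD d)).prod = 1 := by
    intro t ht
    obtain ⟨n, hn⟩ : ∃ n, X.next^[n] t.pos.val = s' := by
      have h0 := hval t.pos
      exact iterate_next_symm h0
    refine (prod_boundaryPath_iterate_next (X := packet s) n t).1 ?_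
    obtain ⟨e1, e2, e3⟩ := PacketSide.next_iterate n t
    rw [ht] at e1 e3
    change ((boundaryPath (X := packet s) (PacketSide.next^[n] t)).map fun d =>
      g (f.onD d)).prod = 1
    generalize PacketSide.next^[n] t = t' at e1 e3
    have hpos' : t'.pos.val = s' := by
      rw [e1, cond_true, Cyc.next_iterate_val, hn]
    have hlt : len (X := packet s) t' = w.length := by
      rw [hlen, ← (packetMap s).len_onS t']
      have hc : ∃ k, X.next^[k] s' = t'.cell.val := ⟨_, hval t'.cell⟩
      obtain ⟨k, hk⟩ := hc
      have : (packetMap s).onS t' = t'.cell.val := by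
        obtain ⟨p, c, h, b⟩ := t'
        obtain rfl : b = true := e3
        rfl
      rw [this, ← hk, len_iterate_next]
    have hb : boundaryPath (X := packet s) t' = arc (X := packet s) t' w.length := by
      rw [← hlt]
      rfl
    have : (arc (X := packet s) t' w.length).map (fun d => g (f.onD d)) = w.map g := by
      refine List.ext_getElem (by
        rw [List.length_map, List.length_map]
        exact length_arc (X := packet s) t' _) fun i h1 h2 => ?_
      have hi : i < w.length := by simpa using h2
      simp only [arc, List.map_map, List.getElem_map, List.getElem_range, Function.comp_apply]
      congr 1
      obtain ⟨e4, -, e6⟩ := PacketSide.next_iterate i t'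
      rw [e3] at e4 e6
      have e7 : (packet s).lab ((packet s).next^[i] t') = (Cyc.next^[i] t'.pos, true) :=
        Prod.ext e4 e6
      rw [e7]
      refine hf i hi _ ?_
      rw [Cyc.next_iterate_val, hpos']
    exact (congrArg (fun l : List (packet s).D => (l.map fun d => g (f.onD d)).prod) hb).trans
      ((congrArg List.prod this).trans hw1)
  intro t
  cases ht : t.dir with
  | true => exact htrue t ht
  | false =>
    have h1 := htrue ((packet s).flip t) (by
      change (!t.dir) = true
      rw [ht]; rfl)
    have h2 := prod_boundaryPath_flip hginv h1
    rwa [(packet s).flip_flip] at h2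

/-! ### Lifts of 2-cells -/

section Lifts

variable {φ : Hom Y X} {a b : Y.V} {w : List Y.D} {s : X.S} {m : ℕ}

theorem Hom.prev_onS (φ : Hom Y X) (t : Y.S) : prev (φ.onS t) = φ.onS (prev t) := by
  rw [prev, φ.flip_onS, φ.next_onS, φ.flip_onS, prev]

/-- Walking backwards around the lifted 2-cell retraces w to its start, by local injectivity at the
terminal ends. -/
theorem exists_lift_start (hφ : φ.IsOneImmersion) (hw : IsWalk a w b) (hl : w.map φ.onD = arc s m)
    {i : ℕ} (hi : i < w.length) {t : Y.S} (ht : φ.onS t = X.next^[i] s) (hd : Y.lab t = w[i]) :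
    ∃ t₀, φ.onS t₀ = s ∧ Y.src (Y.lab t₀) = a := by
  induction i generalizing t with
  | zero => exact ⟨t, ht, by rw [hd, hw.src_getElem_zero]⟩
  | succ i ih =>
    have hS : φ.onS (prev t) = X.next^[i] s := by
      rw [← φ.prev_onS, ht, Function.iterate_succ_apply', prev_next]
    refine ih (Nat.lt_of_succ_lt hi) hS (hφ.eq_of_tgt ?_ ?_)
    · rw [← hw.src_getElem_succ hi, ← hd, ← src_lab_next', next_prev]
    · rw [← φ.lab_onS, hS, onD_getElem hl]

end Lifts

end TwoComplex

/-! ### Attaching a 2-cell whose boundary path lifts -/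

namespace WeightedComplex

variable {X : WeightedComplex.{u}} {Y : TwoComplex.{u}}

/-- If the boundary path of a 2-cell lifts to `Y` and the 2-cell does not, then the 2-cell can be
attached, which reduces the perimeter. -/
theorem exists_of_boundaryPath_lift {φ : Hom Y X.toTwoComplex} {x : X.V} {y : Y.V}
    (hx : φ.onV y = x) (hc : Y.IsCompact) (hφ : φ.IsOneImmersion) {a b : Y.V} {w : List Y.D}
    {s : X.S} (hw : IsWalk a w b) (hl : w.map φ.onD = boundaryPath s)
    (hs : ¬ ∃ t, φ.onS t = s ∧ Y.src (Y.lab t) = a) :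
    ∃ (Z : TwoComplex.{u}) (ψ : Hom Z X.toTwoComplex) (ι : Hom Y Z), IsExtension φ ψ ι x y ∧
      perimeter ψ < perimeter φ := by
  -- The lift of the boundary path need not be closed in Y. Its ends have the same image classes,
  -- because the boundary path is null-homotopic in X, so they coincide in this quotient.
  obtain ⟨Z, ψ, ι, hext, -, hedge, hid⟩ := exists_quot_image hx
  have hwX := φ.isWalk hw
  rw [hl] at hwX
  have ha : φ.onV a = X.src (X.lab s) := by
    obtain ⟨n, hn⟩ : ∃ n, len s = n + 1 := ⟨len s - 1, by have := len_pos s; omega⟩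
    rw [boundaryPath_eq_arc, hn, arc_succ'] at hwX
    exact hwX.1.symm
  have hb : φ.onV a = φ.onV b := by
    rw [ha] at hwX ⊢
    exact (isWalk_boundaryPath s).end_unique hwX
  have hab : ι.onV a = ι.onV b := by
    refine hid a b hb ?_
    ext p
    have key : IsWalk x p (φ.onV a) → (p ∈ imageClasses φ x y a ↔ p ∈ imageClasses φ x y b) := by
      intro hp
      rw [← append_mem_iff hw hp, hl]
      have := (Homot.refl hp).append (Homot.boundaryPath s ha.symm)
      rw [List.append_nil, hb] at this
      exact ⟨fun h => mem_of_homot h this.symm, fun h => mem_of_homot h this⟩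
    exact ⟨fun h => (key (isWalk_of_mem h)).1 h, fun h => (key (hb ▸ isWalk_of_mem h)).2 h⟩
  have hw' := ι.isWalk hw
  rw [← hab] at hw'
  have hl' : (w.map ι.onD).map ψ.onD = boundaryPath s := by
    rw [← hl, ← hext.comp, List.map_map]
    rfl
  obtain ⟨f, hf, -⟩ := exists_graphMap (s := s) ⟨0, rfl⟩ hw' hl'
  have hxz : ψ.onV (ι.onV y) = x := by
    rw [← hx, ← hext.comp]
    rfl
  refine ⟨glue f, glueMap f, (glueInl f).comp ι, hext.trans (isExtension_glue f hxz), ?_⟩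
  -- The total weight of the 2-cell is positive, so some side has positive weight. It is missing in
  -- Y at the corresponding 1-cell of the lift, since otherwise the 2-cell would lift at a.
  obtain ⟨i, hi, hwt⟩ : ∃ i < len s, 0 < X.wt (side (X.next^[i] s)) := by
    by_contra! h
    refine (X.weight_pos s).ne' (Finset.sum_eq_zero fun i hi => ?_)
    exact Nat.le_zero.1 (h i (Finset.mem_range.1 hi))
  have hlen : w.length = len s := length_eq_of_map hl
  have hi' : i < w.length := hlen ▸ hi
  refine perimeter_lt_of_surjective (ι := (glueInl f).comp ι) (e := edge w[i]) (σ := side (X.next^[i] s)) (by rw [← hext.comp]; rfl)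
    ?_ (perimeter_ne_top hc φ) ?_ ?_ ?_ hwt
  · intro e
    obtain ⟨d, rfl⟩ := Quotient.exists_rep e
    obtain ⟨e', he⟩ := hedge (edge (X := Z) d)
    refine ⟨e', ?_⟩
    rw [Hom.comp_onEdge, he]
    rfl
  · rw [φ.onEdge_edge, onD_getElem hl]
    rfl
  · rw [present_iff (onD_getElem hl hi').symm]
    rintro ⟨t, ht, ht'⟩
    exact hs (exists_lift_start hφ hw hl hi' ht' ht)
  · let c : Cyc s := ⟨X.next^[i] s, i, rfl⟩
    have h1 : Present (packetMap s) (edge (X := packet s) (c, true)) (side (X.next^[i] s)) :=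
      ⟨side (X := packet s) ⟨c, c, fun _ => rfl, true⟩, rfl, rfl⟩
    rw [← glueMap_comp_inr f] at h1
    have h2 := h1.map
    have h3 := hf i (by simpa using hi') c rfl
    rw [List.getElem_map] at h3
    change Present (glueMap f) (edge (X := glue f) (f.onD (c, true))) _ at h2
    rw [h3] at h2
    exact h2

end WeightedComplex

namespace TwoComplex

variable {X Y Z K : TwoComplex.{u}}

/-! ### Completing partial lifts of boundary paths -/

/-- A lift from `a` to `b` of the arc of length `m` starting with `s` cannot be extended. -/
def IsMaximalLift (φ : Hom Y X) (s : X.S) (m : ℕ) (a b : Y.V) : Prop :=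
  (∀ d, Y.src d = b → φ.onD d ≠ X.lab (X.next^[m] s)) ∧
    ∀ d, Y.tgt d = a → φ.onD d ≠ X.lab (prev s)

/-- By local injectivity an endless walk reading the labels of ∂R from position i on follows w to
its end and then prolongs it. Such walks arise from a 2-cell of Y along w, and from a closed piece
of w that can be repeated. -/
theorem IsMaximalLift.not_forward_lift {φ : Hom Y X} (hφ : φ.IsOneImmersion) {s : X.S} {m : ℕ}
    {a b : Y.V} (h : IsMaximalLift φ s m a b) {w : List Y.D} (hw : IsWalk a w b)
    (hl : w.map φ.onD = arc s m) {i : ℕ} (hi : i < w.length) (e : ℕ → Y.D) (h0 : e 0 = w[i])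
    (hs : ∀ n, Y.src (e (n + 1)) = Y.tgt (e n))
    (hlab : ∀ n, φ.onD (e n) = X.lab (X.next^[i + n] s)) : False := by
  have hlen := length_eq_of_map hl
  have key : ∀ n (hn : i + n < w.length), e n = w[i + n] := by
    intro n
    induction n with
    | zero => intro _; exact h0
    | succ n ih =>
      intro hn
      have hn' : i + n < w.length := by omega
      refine hφ _ _ ?_ ?_
      · rw [hs, ih hn']
        exact (hw.src_getElem_succ (i := i + n) hn).symm
      · rw [hlab, onD_getElem hl]
  obtain ⟨n, hn⟩ : ∃ n, i + n + 1 = w.length := ⟨w.length - 1 - i, by omega⟩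
  refine h.1 (e (n + 1)) ?_ ?_
  · rw [hs, key n (by omega)]
    exact hw.tgt_getElem_last _ hn
  · rw [hlab, ← hlen, ← hn, Nat.add_assoc]

theorem arc_prev (s : X.S) (m : ℕ) : arc (prev s) (m + 1) = X.lab (prev s) :: arc s m := by
  rw [arc_succ', next_prev]

/-- Closing up a lift of all but one of the 1-cells of the boundary path of a 2-cell. -/
theorem exists_closing_edge {φ : Hom Y X} (hφ : φ.IsOneImmersion) {x : X.V} {y : Y.V}
    (hx : φ.onV y = x) {s : X.S} {m : ℕ} {a b : Y.V} {w : List Y.D} (hw : IsWalk a w b)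
    (hl : w.map φ.onD = arc s m) (hab : φ.onV a = X.src (X.lab s))
    (hmax : IsMaximalLift φ s m a b) (hm : m + 1 = len s) :
    ∃ (Z : TwoComplex.{u}) (ψ : Hom Z X) (ι : Hom Y Z) (e : Z.D), IsExtension φ ψ ι x y ∧
      ψ.IsOneImmersion ∧ Z.src e = ι.onV b ∧ Z.tgt e = ι.onV a ∧
      ψ.onD e = X.lab (X.next^[m] s) ∧ (∀ d, (∃ d', ι.onD d' = d) ∨ d = e ∨ d = Z.inv e) ∧
      ∀ (G : Type u) [Group G] (g : Y.D → G), IsCocycle g → ∃ g' : Z.D → G, IsCocycle g' ∧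
        (∀ d, g' (ι.onD d) = g d) ∧ g' e = ((w.map g).prod)⁻¹ := by
  set e := X.lab (X.next^[m] s) with he
  have hwX := φ.isWalk hw
  have hb : X.src e = φ.onV b := by
    rw [hl, hab] at hwX
    exact (isWalk_arc s m).end_unique hwX
  have hns : X.next (X.next^[m] s) = s := by
    rw [← Function.iterate_succ_apply' X.next, Nat.succ_eq_add_one, hm, next_iterate_len]
  have ha : X.tgt e = φ.onV a := by rw [he, ← src_lab_next', hns, hab]
  have he1 : IsWalk (φ.onV b) [e] (φ.onV a) := ⟨hb, ha⟩
  have hloop : Homot (φ.onV a) (φ.onV a) (w.map φ.onD ++ [e]) [] := by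
    rw [hl, he, ← arc_succ, hm]
    exact Homot.boundaryPath s hab.symm
  -- Across the 2-cell, the new 1-cell is homotopic in X to the reverse of the lift, so the image
  -- classes of Y are already closed under traversing it in either direction.
  have k1 : Homot (φ.onV a) (φ.onV b) [X.inv e] (w.map φ.onD) :=
    (((Homot.cancel_right hwX he1).symm).trans (hloop.append (.refl he1.rev))).symm
  have k2 : Homot (φ.onV b) (φ.onV a) [e] (revPath (w.map φ.onD)) := by
    have h1 := (Homot.rev_append hwX).append (.refl he1)
    rw [List.append_assoc] at h1
    have h2 := (Homot.refl hwX.rev).append hloop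
    rw [List.append_nil] at h2
    exact h1.symm.trans h2
  let ψ := addEdgeMap (φ := φ) (vX := φ.onV) (e := e) id b a (fun _ => rfl) hb ha
  let ι := addEdgeIncl (Y := Y) id b a
  refine ⟨addEdge id b a, ψ, ι, newEdge id b a, ⟨rfl, fun hc => ?_, fun hc => ?_, ?_⟩, ?_, rfl, rfl,
    rfl, addEdge_cover _ _ _, ?_⟩
  · have := hc.1
    exact addEdge_isCompact id _ _ hc
  · exact hc.of_surjective ι fun v => ⟨v, rfl⟩
  · refine imageClasses_subset (φ := ψ) (y := y) (fun v : Y.V => imageClasses φ x y v)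
      (nil_mem hx) ?_ ?_ hx y
    · rintro (d | ⟨_ | _⟩) p hp hwp
      · exact step_mem (d := d) hp
      · have hp' : p ∈ imageClasses φ x y a := hp
        have hwp' : IsWalk x p (φ.onV a) := hwp
        exact mem_of_homot (append_mem hp' hw) ((Homot.refl hwp').append k1)
      · have hp' : p ∈ imageClasses φ x y b := hp
        have hwp' : IsWalk x p (φ.onV b) := hwp
        refine mem_of_homot (append_mem hp' hw.rev) ?_
        rw [φ.map_revPath]
        exact (Homot.refl hwp').append k2
    · intro v p q hp hq
      exact mem_of_homot (φ := φ) hp hq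
  -- Local injectivity at the two ends of the new 1-cell is maximality of the lift at b and at a:
  -- the single missing side is also `prev s`.
  · refine addEdge_isOneImmersion _ _ _ _ _ _ hφ Function.injective_id hmax.1 ?_
    intro d hd h
    refine hmax.2 (Y.inv d) ((Y.tgt_inv d).trans hd) ?_
    have hprev : prev s = X.next^[m] s := by rw [← prev_next (X.next^[m] s), hns]
    rw [← φ.inv_onD, h, X.inv_inv, hprev]
  · intro G _ g hg
    exact addEdge_cocycle id b a hg _

/-- A lift of an arc of the boundary path of a 2-cell which cannot be extended is a part of a
closed lift of the boundary path to a larger complex. -/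
theorem exists_closed_lift (n : ℕ) : ∀ {Y : TwoComplex.{u}} {φ : Hom Y X}, φ.IsOneImmersion →
    ∀ {x : X.V} {y : Y.V}, φ.onV y = x → ∀ {s : X.S} {m : ℕ} {a b : Y.V} {w : List Y.D},
    IsWalk a w b → w.map φ.onD = arc s m → φ.onV a = X.src (X.lab s) →
    IsMaximalLift φ s m a b → m + (n + 1) = len s →
    ∃ (Z : TwoComplex.{u}) (ψ : Hom Z X) (ι : Hom Y Z) (s' : X.S) (a' : Z.V) (l r : List Z.D),
      IsExtension φ ψ ι x y ∧ ψ.IsOneImmersion ∧ X.next^[l.length] s' = s ∧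
      IsWalk a' l (ι.onV a) ∧ IsWalk (ι.onV b) r a' ∧ r ≠ [] ∧
      (l ++ (w.map ι.onD ++ r)).map ψ.onD = boundaryPath s' ∧
      (∀ d, (∃ d', ι.onD d' = d) ∨ d ∈ l ++ (w.map ι.onD ++ r) ∨
        Z.inv d ∈ l ++ (w.map ι.onD ++ r)) ∧
      ∀ (G : Type u) [Group G] (g : Y.D → G), IsCocycle g → ∃ g' : Z.D → G, IsCocycle g' ∧
        (∀ d, g' (ι.onD d) = g d) ∧ ((l ++ (w.map ι.onD ++ r)).map g').prod = 1 := by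
  induction n using Nat.strong_induction_on with
  | _ n ih =>
  intro Y φ hφ x y hx s m a b w hw hl hab hmax hm
  have hmapι : ∀ {Z : TwoComplex.{u}} {ψ : Hom Z X} {ι : Hom Y Z}, IsExtension φ ψ ι x y →
      (w.map ι.onD).map ψ.onD = arc s m := by
    intro Z ψ ι h
    rw [← hl, ← h.comp, List.map_map]
    rfl
  rcases n with _ | n
  · obtain ⟨Z, ψ, ι, e, hext, hψ, hsrc, htgt, hlab, hcov, hcoc⟩ :=
      exists_closing_edge hφ hx hw hl hab hmax hm
    refine ⟨Z, ψ, ι, s, ι.onV a, [], [e], hext, hψ, rfl, rfl, ⟨hsrc, htgt⟩, by simp, ?_, ?_, ?_⟩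
    · rw [List.nil_append, List.map_append, hmapι hext, List.map_singleton, hlab, ← arc_succ, hm]
      rfl
    · intro d
      rcases hcov d with h | rfl | rfl
      · exact Or.inl h
      · exact Or.inr (Or.inl (by simp))
      · exact Or.inr (Or.inr (by simp [Z.inv_inv]))
    · intro G _ g hg
      obtain ⟨g', hg', h1, h2⟩ := hcoc G g hg
      refine ⟨g', hg', h1, ?_⟩
      simp [h2, Function.comp_def, h1]
  · set e := X.lab (X.next^[m] s) with he
    have hb : X.src e = φ.onV b := by
      have hwX := φ.isWalk hw
      rw [hl, hab] at hwX
      exact (isWalk_arc s m).end_unique hwX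
    -- The next 1-cell of ∂R is attached at b with a free far end. Only its inverse starts there,
    -- and ∂R has no backtracks, so the lengthened lift is again maximal on the right.
    obtain ⟨Z, ψ, ι, e', hext, hcoc, hinj, hsrc, hlab, hcov, htgt, himm⟩ :=
      exists_pendant hx b e hb
    have hψ := himm hφ hmax.1
    have hxz : ψ.onV (ι.onV y) = x := by
      rw [← hx, ← hext.comp]; rfl
    have hcompD : ∀ d, ψ.onD (ι.onD d) = φ.onD d := fun d => by rw [← hext.comp]; rfl
    have hcompV : ∀ d, ψ.onV (ι.onV d) = φ.onV d := fun d => by rw [← hext.comp]; rfl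
    have htgt' : ∀ d, Z.src d = Z.tgt e' → d = Z.inv e' := by
      intro d hd
      rcases hcov d with ⟨d, rfl⟩ | rfl | rfl
      · rw [ι.src_onD] at hd
        exact absurd hd (htgt _)
      · rw [hsrc] at hd
        exact absurd hd (htgt _)
      · rfl
    have hw1 : IsWalk (ι.onV a) (w.map ι.onD ++ [e']) (Z.tgt e') := by
      have := ι.isWalk hw
      rw [← hsrc] at this
      exact this.snoc
    have hl1 : (w.map ι.onD ++ [e']).map ψ.onD = arc s (m + 1) := by
      rw [List.map_append, hmapι hext, List.map_singleton, hlab, arc_succ]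
    have hright : ∀ d, Z.src d = Z.tgt e' → ψ.onD d ≠ X.lab (X.next^[m + 1] s) := by
      intro d hd
      rw [htgt' d hd, ← ψ.inv_onD, hlab, Function.iterate_succ_apply']
      exact (X.lab_next_ne _).symm
    by_cases hleft : ∀ d, Z.tgt d = ι.onV a → ψ.onD d ≠ X.lab (prev s)
    · obtain ⟨Z', ψ', ι', s', a', l, r, hext', hψ', hs', hl', hr', hr0, hlab', hcov', hcoc'⟩ :=
        ih n (Nat.lt_succ_self n) hψ hxz hw1 hl1 ((hcompV a).trans hab) ⟨hright, hleft⟩ (by omega)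
      have hlist : l ++ ((w.map ι.onD ++ [e']).map ι'.onD ++ r) =
          l ++ (w.map (ι'.comp ι).onD ++ (ι'.onD e' :: r)) := by
        simp [Hom.comp]
      rw [hlist] at hlab' hcov' hcoc'
      refine ⟨Z', ψ', ι'.comp ι, s', a', l, ι'.onD e' :: r, hext.trans hext', hψ', hs', hl',
        ⟨?_, ?_⟩, by simp, hlab', ?_, ?_⟩
      · rw [ι'.src_onD, hsrc]; rfl
      · rw [ι'.tgt_onD]; exact hr'
      · intro d
        rcases hcov' d with ⟨d, rfl⟩ | h
        · rcases hcov d with ⟨d, rfl⟩ | rfl | rfl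
          · exact Or.inl ⟨d, rfl⟩
          · exact Or.inr (Or.inl (by simp))
          · exact Or.inr (Or.inr (by simp [ι'.inv_onD, Z.inv_inv]))
        · exact Or.inr h
      · intro G _ g hg
        obtain ⟨g₁, hg₁, h₁⟩ := hcoc G g hg
        obtain ⟨g₂, hg₂, h₂, h₃⟩ := hcoc' G g₁ hg₁
        exact ⟨g₂, hg₂, fun d => (h₂ _).trans (h₁ d), h₃⟩
    · push Not at hleft
      -- The lift was maximal at a, so only the inverse of the new 1-cell can prolong it on the
      -- left. This happens when a = b and the labels at the two ends of the missing arc are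
      -- inverse: these ends fold together, and the new 1-cell serves for both.
      obtain ⟨d, hd, hd'⟩ := hleft
      obtain rfl : d = Z.inv e' := by
        rcases hcov d with ⟨d, rfl⟩ | rfl | rfl
        · rw [ι.tgt_onD] at hd
          rw [hcompD] at hd'
          exact absurd hd' (hmax.2 d (hinj hd))
        · exact absurd hd.symm (htgt a)
        · rfl
      rw [← ψ.inv_onD, hlab] at hd'
      have hw2 : IsWalk (Z.tgt e') (Z.inv e' :: (w.map ι.onD ++ [e'])) (Z.tgt e') :=
        ⟨rfl, by rw [hd]; exact hw1⟩
      have hl2 : (Z.inv e' :: (w.map ι.onD ++ [e'])).map ψ.onD = arc (prev s) (m + 2) := by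
        rw [List.map_cons, hl1, ← ψ.inv_onD, hlab, hd', arc_prev s (m + 1)]
      have hlab2 : ψ.onV (Z.tgt e') = X.src (X.lab (prev s)) := by
        rw [← ψ.tgt_onD, hlab, ← hd']; rfl
      -- If these two were the only missing 1-cells, they would be consecutive in ∂R with inverse
      -- labels, a backtrack.
      have hn : n ≠ 0 := by
        rintro rfl
        have h1 : X.next^[m + 1] s = prev s := by
          apply next_injective
          rw [next_prev, ← Function.iterate_succ_apply' X.next]
          have := next_iterate_len s
          rwa [← hm] at this
        apply X.lab_next_ne (X.next^[m] s)
        rw [← Function.iterate_succ_apply' X.next, Nat.succ_eq_add_one, h1, ← hd']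
      have hmax2 : IsMaximalLift ψ (prev s) (m + 2) (Z.tgt e') (Z.tgt e') := by
        constructor
        · intro d hd
          rw [Function.iterate_succ_apply, next_prev]
          exact hright d hd
        · intro d hd h
          have h1 : d = e' := by
            rw [← Z.inv_inv d, htgt' (Z.inv d) hd, Z.inv_inv]
          rw [h1, hlab] at h
          apply X.lab_next_ne (prev (prev s))
          rw [next_prev, ← h, hd']
      -- Two of the n + 2 missing 1-cells have been covered; n = (n - 1) + 1 remain.
      obtain ⟨Z', ψ', ι', s', a', l, r, hext', hψ', hs', hl', hr', hr0, hlab', hcov', hcoc'⟩ :=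
        ih (n - 1) (by omega) hψ hxz hw2 hl2 hlab2 hmax2 (by
          rw [← len_next (prev s), next_prev]
          omega)
      have hlist : l ++ ((Z.inv e' :: (w.map ι.onD ++ [e'])).map ι'.onD ++ r) =
          (l ++ [ι'.onD (Z.inv e')]) ++ (w.map (ι'.comp ι).onD ++ (ι'.onD e' :: r)) := by
        simp [Hom.comp]
      rw [hlist] at hlab' hcov' hcoc'
      refine ⟨Z', ψ', ι'.comp ι, s', a', l ++ [ι'.onD (Z.inv e')], ι'.onD e' :: r,
        hext.trans hext', hψ', ?_, ?_, ⟨?_, ?_⟩, by simp, hlab', ?_, ?_⟩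
      · rw [List.length_append, List.length_singleton, Function.iterate_succ_apply', hs', next_prev]
      · rw [isWalk_snoc_iff, ι'.src_onD, ι'.tgt_onD, hd]
        exact ⟨hl', rfl⟩
      · rw [ι'.src_onD, hsrc]; rfl
      · rw [ι'.tgt_onD]; exact hr'
      · intro d
        rcases hcov' d with ⟨d, rfl⟩ | h
        · rcases hcov d with ⟨d, rfl⟩ | rfl | rfl
          · exact Or.inl ⟨d, rfl⟩
          · exact Or.inr (Or.inl (by simp))
          · exact Or.inr (Or.inl (by simp))
        · exact Or.inr h
      · intro G _ g hg
        obtain ⟨g₁, hg₁, h₁⟩ := hcoc G g hg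
        obtain ⟨g₂, hg₂, h₂, h₃⟩ := hcoc' G g₁ hg₁
        exact ⟨g₂, hg₂, fun d => (h₂ _).trans (h₁ d), h₃⟩

end TwoComplex

/-! ### The perimeter after attaching a packet -/

namespace WeightedComplex

variable {X : WeightedComplex.{u}} {Y Z : TwoComplex.{u}}

theorem pathPerimeter_append (p q : List X.D) :
    X.pathPerimeter (p ++ q) = X.pathPerimeter p + X.pathPerimeter q := by
  simp [pathPerimeter]

theorem pathPerimeter_map (φ : Hom Y X.toTwoComplex) (w : List Y.D) :
    X.pathPerimeter (w.map φ.onD) = ∑' i : Fin w.length, X.edgePerimeter (φ.onEdge (edge w[i])) := by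
  rw [tsum_fintype]
  have := Fin.sum_univ_fun_getElem w fun d => X.edgePerimeter (φ.onEdge (edge d))
  refine Eq.trans ?_ this.symm
  rw [pathPerimeter, List.map_map]
  rfl

/-- Attaching a packet along a lift of an arc of a boundary path which cannot be extended. -/
theorem perimeter_glue_le {φ : Hom Y X.toTwoComplex} (hφ : φ.IsOneImmersion) {s₀ s : X.S} {m : ℕ}
    {a b : Y.V} {w : List Y.D} (hw : IsWalk a w b) (hl : w.map φ.onD = arc s m)
    (hmax : IsMaximalLift φ s m a b) (hm : m ≤ len s) (hs : ∃ n, X.next^[n] s₀ = s)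
    {ψ : Hom Z X.toTwoComplex} {ι : Hom Y Z} (hι : ψ.comp ι = φ) {ρ : Hom (packet s₀) Z}
    (hρ : ψ.comp ρ = packetMap s₀)
    (hyr : ∀ (i : ℕ) (hi : i < w.length) (c : Cyc s₀), c.val = X.next^[i] s →
      ρ.onD (c, true) = ι.onD w[i])
    (hcov : ∀ e, (∃ e', ι.onEdge e' = e) ∨ ∃ e', ρ.onEdge e' = e) :
    perimeter ψ + X.pathPerimeter (w.map φ.onD) ≤ perimeter φ + perimeter (packetMap s₀) := by
  have hlen := length_eq_of_map hl
  have hmem : ∀ i, ∃ n, X.next^[n] s₀ = X.next^[i] s := by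
    rintro i
    obtain ⟨n, rfl⟩ := hs
    exact ⟨i + n, Function.iterate_add_apply _ _ _ _⟩
  let c : Fin w.length → Cyc s₀ := fun i => ⟨X.next^[(i : ℕ)] s, hmem i⟩
  rw [pathPerimeter_map]
  -- The index runs over the positions of w, so a 1-cell of Y traversed repeatedly is counted with
  -- multiplicity. Since m ≤ |∂R|, the corresponding 1-cells of the packet circle are distinct.
  refine perimeter_add_le hι hρ (fun i : Fin w.length => edge w[i])
    (fun i => edge (X := packet s₀) (c i, true)) ?_ ?_ hcov ?_ ?_
  · intro i j h
    have := congrArg Cyc.val (packet_edge_injective h)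
    exact Fin.ext (iterate_next_inj (by omega) (by omega) this)
  · intro i
    have := hyr i i.2 (c i) rfl
    change edge (ι.onD w[(i : ℕ)]) = edge (ρ.onD (c i, true))
    rw [this]
  -- A packet side already present in Y lies on a 2-cell of Y with the same labels from position i
  -- on; going round its boundary endlessly contradicts maximality.
  · intro i σ hσ hσ'
    obtain ⟨c', hc', rfl⟩ := present_packetMap hσ
    have h0 : X.lab c'.val = φ.onD w[i] := by
      rw [Fin.getElem_fin, onD_getElem hl]
      exact (hc' 0).symm
    obtain ⟨t, ht, ht'⟩ := (present_iff h0).1 hσ'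
    refine hmax.not_forward_lift hφ hw hl i.2 (fun n => Y.lab (Y.next^[n] t)) ht ?_ ?_
    · intro n
      rw [Function.iterate_succ_apply', src_lab_next']
    · intro n
      rw [← φ.lab_onS, ← φ.next_iterate_onS, ht', ← hc' n, Nat.add_comm,
        Function.iterate_add_apply]
  -- If w traverses the same oriented 1-cell at positions i < j with the same labels ahead, then the
  -- piece of w between them is closed and reads these labels periodically. Repeating it contradicts
  -- maximality, so no missing side of Y is charged twice.
  · have key : ∀ i j : Fin w.length, (i : ℕ) < j → Cyc.SameLabels (c i) (c j) →
        w[i] = w[j] → False := by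
      intro i j hij hsame hw'
      let p := (j : ℕ) - i
      have hp : 0 < p := Nat.sub_pos_of_lt hij
      have hji : (i : ℕ) + p = j := Nat.add_sub_of_le hij.le
      have hdrop := hw.drop i.2
      have hpl : p < (w.drop i).length := by
        rw [List.length_drop]
        exact Nat.sub_lt_sub_right hij.le j.2
      have htake := hdrop.take hpl
      have hend : (w.drop i)[p] = w[(i : ℕ)] := by
        rw [List.getElem_drop]
        simp only [hji]
        exact hw'.symm
      rw [hend] at htake
      have hul : ((w.drop i).take p).length = p := by
        rw [List.length_take]
        exact Nat.min_eq_left hpl.le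
      have hpos : 0 < ((w.drop i).take p).length := by omega
      refine hmax.not_forward_lift hφ hw hl i.2
        (fun n => ((w.drop i).take p)[n % ((w.drop i).take p).length]'(Nat.mod_lt _ hpos)) ?_
        (htake.src_getElem_mod hpos) ?_
      · simp
      · intro n
        have hper : Function.Periodic (fun n => X.lab (X.next^[n] (X.next^[(i : ℕ)] s))) p := by
          intro n
          have h1 := hsame n
          change X.lab (X.next^[n] (X.next^[(i : ℕ)] s)) =
            X.lab (X.next^[n] (X.next^[(j : ℕ)] s)) at h1
          simp only [← Function.iterate_add_apply] at h1 ⊢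
          rw [h1, ← hji, Nat.add_assoc, Nat.add_comm p]
        have h2 := hper.map_mod_nat n
        simp only [List.getElem_take, List.getElem_drop, hul]
        rw [onD_getElem hl, Nat.add_comm, Function.iterate_add_apply, Nat.add_comm _ n,
          Function.iterate_add_apply]
        exact h2
    intro i j σ hi hj hij
    obtain ⟨c₁, h₁, rfl⟩ := present_packetMap hi
    obtain ⟨c₂, h₂, h⟩ := present_packetMap hj
    -- Both sides point in the direction of s, so they cannot be flips of one another.
    have hcc : c₁ = c₂ := by
      rcases side_eq_iff.1 h with h | h
      · exact Cyc.ext h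
      · obtain ⟨n₁, hn₁⟩ := c₁.mem
        obtain ⟨n₂, hn₂⟩ := c₂.mem
        obtain ⟨k, hk⟩ := iterate_next_symm hn₂
        refine absurd ?_ (iterate_next_ne_flip (n₁ + k) c₂.val)
        rw [Function.iterate_add_apply, hk, hn₁, h]
    subst hcc
    have hsame : Cyc.SameLabels (c i) (c j) := fun n => (h₁ n).trans (h₂ n).symm
    have hwij : w[i] = w[j] := by
      refine φ.eq_of_edge_eq hij ?_
      rw [Fin.getElem_fin, Fin.getElem_fin, onD_getElem hl, onD_getElem hl]
      exact hsame 0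
    by_contra hne
    rcases Nat.lt_or_gt_of_ne (fun h => hne (Fin.ext h)) with h | h
    · exact key i j h hsame hwij
    · exact key j i h (fun n => (hsame n).symm) hwij.symm

end WeightedComplex

/-! ### Following a path reduction in Y -/

namespace WeightedComplex

variable {X : WeightedComplex.{u}} {Y Z : TwoComplex.{u}}

/-- If all 2-cells whose boundary paths lift to `Y` lift themselves, then `Y` can be extended by
a lift of a 2-cell along an arc of large perimeter, without increasing the perimeter. -/
theorem exists_cell_lift {φ : Hom Y X.toTwoComplex} (hφ : φ.IsOneImmersion) {x : X.V} {y : Y.V}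
    (hx : φ.onV y = x)
    (hfull : ∀ (s : X.S) (a b : Y.V) (w : List Y.D), IsWalk a w b → w.map φ.onD = boundaryPath s →
      ∃ t, φ.onS t = s ∧ Y.src (Y.lab t) = a)
    {s : X.S} {a b : Y.V} {w : List Y.D} (hw : IsWalk a w b)
    (hP : perimeter (packetMap s) ≤ X.pathPerimeter (w.map φ.onD)) (n : ℕ) :
    ∀ {s' : X.S} {m : ℕ} {a' b' : Y.V} {l r : List Y.D}, IsWalk a' l a → IsWalk b r b' →
      (l ++ (w ++ r)).map φ.onD = arc s' m → φ.onV a' = X.src (X.lab s') →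
      X.next^[l.length] s' = s → m + n = len s →
      ∃ (Z : TwoComplex.{u}) (ψ : Hom Z X.toTwoComplex) (ι : Hom Y Z), IsExtension φ ψ ι x y ∧
        ExtendsCocycles ι ∧ ψ.IsOneImmersion ∧ perimeter ψ ≤ perimeter φ ∧
        ∃ t, ψ.onS t = s ∧ Z.src (Z.lab t) = ι.onV a := by
  induction n with
  -- The whole boundary path lifts, so the 2-cell lifts at a' by `hfull`. Advancing by the length of
  -- l gives the lift that starts at a.
  | zero =>
    intro s' m a' b' l r hl hr hmap ha' hs hm
    have hlen : len s = len s' := by rw [← hs, len_iterate_next]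
    have hfl : (l ++ (w ++ r)).map φ.onD = boundaryPath s' := by
      rw [hmap, boundaryPath_eq_arc, ← hlen, ← hm]
      rfl
    obtain ⟨t, ht, hta⟩ := hfull s' a' b' _ (hl.append (hw.append hr)) hfl
    refine ⟨Y, φ, Hom.id Y, .refl φ x y, .refl, hφ, le_rfl, Y.next^[l.length] t, ?_, ?_⟩
    · rw [← φ.next_iterate_onS, ht, hs]
    · have h1 := isWalk_arc t l.length
      rw [hta] at h1
      have h2 : arc t l.length = l := by
        refine hφ.walk_unique h1 hl ?_
        rw [φ.map_arc, ht]
        have h3 : l.length ≤ m := by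
          rw [← length_eq_of_map hmap]
          simp
        have h4 := congrArg (List.take l.length) hmap
        rw [List.map_append, List.take_left' (by simp)] at h4
        rw [h4]
        obtain ⟨k, rfl⟩ := Nat.exists_eq_add_of_le h3
        rw [arc_add, List.take_left' (by simp)]
      rw [h2] at h1
      exact h1.end_unique hl
  | succ n ih =>
    intro s' m a' b' l r hl hr hmap ha' hs hm
    have hlen : len s = len s' := by rw [← hs, len_iterate_next]
    have hww := hl.append (hw.append hr)
    -- The partial lift is prolonged in Y at either end as long as possible, each time reducing the
    -- number n of missing 1-cells; a maximal one is completed by new cells.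
    by_cases hmax : IsMaximalLift φ s' m a' b'
    · obtain ⟨Z, ψ, ι, s'', a'', l', r', hext, hψ, hs'', hl', hr', hr0, hmap', hcov, hcoc⟩ :=
        exists_closed_lift n hφ hx hww hmap ha' hmax (by rw [hm, hlen])
      have hclosed : IsWalk a'' (l' ++ ((l ++ (w ++ r)).map ι.onD ++ r')) a'' :=
        hl'.append ((ι.isWalk hww).append hr')
      have horb : X.next^[l.length + l'.length] s'' = s := by
        rw [Function.iterate_add_apply, hs'', hs]
      obtain ⟨f, hf, hfc⟩ := exists_graphMap (s := s) ⟨_, horb⟩ hclosed hmap'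
      have hxz : ψ.onV (ι.onV y) = x := by
        rw [← hx, ← hext.comp]; rfl
      refine ⟨glue f, glueMap f, (glueInl f).comp ι, hext.trans (isExtension_glue f hxz), ?_, hψ,
        ?_, ?_⟩
      · intro G _ g hg
        obtain ⟨g', hg', h1, h2⟩ := hcoc G g hg
        exact ⟨g', glue_cocycle f hg' (hfc G g' hg'.inv h2), h1⟩
      · have hle := perimeter_glue_le (ψ := glueMap f) (ι := (glueInl f).comp ι) (ρ := glueInr f)
          (s₀ := s) hφ hww hmap hmax (by omega) (iterate_next_symm hs)
          (by rw [← hext.comp]; rfl) (glueMap_comp_inr f) ?_ ?_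
        -- Prolonging Q only increases its perimeter, so the push inequality is inherited.
        · have hle' : perimeter (packetMap s) ≤ X.pathPerimeter ((l ++ (w ++ r)).map φ.onD) := by
            refine hP.trans ?_
            rw [List.map_append, List.map_append, pathPerimeter_append, pathPerimeter_append]
            exact le_add_left le_self_add
          exact ENNReal.le_of_add_le_add_right (pathPerimeter_ne_top _)
            (hle.trans (add_le_add_right hle' _))
        · intro i hi c hc
          have hi' : l'.length + i < (l' ++ ((l ++ (w ++ r)).map ι.onD ++ r')).length := by
            simp only [List.length_append, List.length_map] at hi ⊢
            omega
          have h1 := hf (l'.length + i) hi' c (by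
            rw [hc, ← hs'', ← Function.iterate_add_apply, Nat.add_comm])
          refine h1.trans ?_
          rw [List.getElem_append_right (by omega), List.getElem_append_left (by
            rw [List.length_map]; omega)]
          simp only [Nat.add_sub_cancel_left, List.getElem_map]
          rfl
        · intro e
          obtain ⟨d, rfl⟩ := Quotient.exists_rep e
          have key : ∀ d ∈ l' ++ ((l ++ (w ++ r)).map ι.onD ++ r'),
              ∃ e', (glueInr f).onEdge e' = edge (X := glue f) d := by
            intro d hd
            obtain ⟨i, hi, rfl⟩ := List.getElem_of_mem hd
            obtain ⟨k, hk⟩ := iterate_next_symm horb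
            refine ⟨edge (X := packet s) (⟨X.next^[i] s'', i + k, ?_⟩, true), ?_⟩
            · rw [Function.iterate_add_apply, hk]
            · exact congrArg (edge (X := glue f)) (hf i hi _ rfl)
          rcases hcov d with ⟨d', rfl⟩ | h | h
          · exact Or.inl ⟨edge d', rfl⟩
          · exact Or.inr (key d h)
          · obtain ⟨e', he'⟩ := key _ h
            exact Or.inr ⟨e', he'.trans (edge_inv (X := glue f) d)⟩
      · let c : Cyc s := ⟨s, 0, rfl⟩
        refine ⟨Sum.inr (⟨c, c, fun _ => rfl, true⟩ : PacketSide s), rfl, ?_⟩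
        have hi : l'.length + l.length < (l' ++ ((l ++ (w ++ r)).map ι.onD ++ r')).length := by
          have := List.length_pos_iff.2 hr0
          simp only [List.length_append, List.length_map]
          omega
        have h1 := hf (l'.length + l.length) hi c (by rw [Nat.add_comm, horb])
        change Z.src (f.onD (c, true)) = ι.onV a
        rw [h1]
        have h2 := hclosed.take hi
        have h3 : (l' ++ ((l ++ (w ++ r)).map ι.onD ++ r')).take (l'.length + l.length) =
            l' ++ l.map ι.onD := by
          rw [List.map_append, List.append_assoc, ← List.append_assoc, List.take_left' (by simp)]
        rw [h3] at h2
        exact h2.end_unique (hl'.append (ι.isWalk hl))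
    · rw [IsMaximalLift, not_and_or] at hmax
      push Not at hmax
      rcases hmax with ⟨d, hd, hd'⟩ | ⟨d, hd, hd'⟩
      · subst hd
        refine ih hl hr.snoc (m := m + 1) ?_ ha' hs (by omega)
        rw [← List.append_assoc, ← List.append_assoc, List.append_assoc l, List.map_append, hmap,
          List.map_singleton, hd', arc_succ]
      · subst hd
        have hl2 : IsWalk (Y.src d) (d :: l) a := ⟨rfl, hl⟩
        refine ih hl2 hr (s' := prev s') (m := m + 1) ?_ ?_ ?_ (by omega)
        · rw [List.cons_append, List.map_cons, hmap, hd', arc_prev]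
        · rw [← φ.src_onD, hd']
        · rw [List.length_cons, Function.iterate_succ_apply, next_prev, hs]

/-- A closed path in `Y` which is detected by a cocycle and whose image can be reduced to the
trivial path leads to an extension with smaller perimeter.  The complex `X` has a single 0-cell, so
that all sequences of oriented 1-cells are closed paths. -/
theorem exists_smaller_extension [Subsingleton X.V] {P : List X.D}
    (hP : Relation.ReflTransGen (ReductionStep (X := X)) P []) :
    ∀ {Y : TwoComplex.{u}} {φ : Hom Y X.toTwoComplex}, φ.IsOneImmersion → Y.IsCompact →
      ∀ {x : X.V} {y : Y.V}, φ.onV y = x → ∀ {G : Type u} [Group G] {g : Y.D → G}, IsCocycle g →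
      ∀ {a : Y.V} {w : List Y.D}, IsWalk a w a → w.map φ.onD = P → (w.map g).prod ≠ 1 →
      ∃ (Z : TwoComplex.{u}) (ψ : Hom Z X.toTwoComplex) (ι : Hom Y Z), IsExtension φ ψ ι x y ∧
        perimeter ψ < perimeter φ := by
  induction hP using Relation.ReflTransGen.head_induction_on with
  -- The trivial path is detected by no cocycle, so the sequence cannot be followed to its end
  -- without meeting a strict decrease.
  | refl =>
    intro Y φ _ _ x y _ G _ g _ a w _ hmap hne
    rw [List.map_eq_nil_iff] at hmap
    subst hmap
    exact absurd rfl hne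
  | head hstep _ ih =>
    intro Y φ hφ hc x y hx G _ g hg a w hw hmap hne
    cases hstep with
    | backtrack p q d =>
      obtain ⟨w₁, w', rfl, rfl, hw'⟩ := List.map_eq_append_iff.1 hmap
      obtain ⟨w₂, w₃, rfl, h2, rfl⟩ := List.map_eq_append_iff.1 hw'
      obtain ⟨e, w₂, rfl, rfl, h2⟩ := List.map_eq_cons_iff.1 h2
      obtain ⟨e', w₂, rfl, he', h2⟩ := List.map_eq_cons_iff.1 h2
      obtain rfl := List.map_eq_nil_iff.1 h2
      obtain ⟨v, hw₁, h3, h4, h5⟩ := isWalk_append_iff.1 hw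
      subst h3
      -- Local injectivity lifts the backtrack to Y.
      obtain rfl : e' = Y.inv e := by
        refine hφ _ _ h4 ?_
        rw [he', φ.inv_onD]
      refine ih hφ hc hx hg (w := w₁ ++ w₃) (hw₁.append ?_) List.map_append ?_
      · rwa [Y.tgt_inv] at h5
      · simpa [hg.inv] using hne
    | push s k _ p' h =>
      obtain ⟨hk, ⟨p₁, p₂, rfl, rfl⟩, hper⟩ := h
      -- If some boundary path lifts without its 2-cell, the perimeter drops at once. Otherwise Y is
      -- enlarged, without increase of perimeter, until R lifts along the lift of Q.
      by_cases hfull : ∀ (s : X.S) (a b : Y.V) (w : List Y.D), IsWalk a w b →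
          w.map φ.onD = boundaryPath s → ∃ t, φ.onS t = s ∧ Y.src (Y.lab t) = a
      · have htake : (boundaryPath s).take k = arc s k := by
          obtain ⟨j, hj⟩ := Nat.exists_eq_add_of_le hk
          rw [boundaryPath_eq_arc, hj, arc_add, List.take_left' (by simp)]
        rw [htake] at hper hmap
        obtain ⟨w₁, w', rfl, rfl, hw'⟩ := List.map_eq_append_iff.1 hmap
        obtain ⟨w₂, w₃, rfl, h2, rfl⟩ := List.map_eq_append_iff.1 hw'
        obtain ⟨v, hw₁, h3⟩ := isWalk_append_iff.1 hw
        obtain ⟨v', hw₂, hw₃⟩ := isWalk_append_iff.1 h3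
        obtain ⟨j, hj⟩ := Nat.exists_eq_add_of_le hk
        -- For k = 0 nothing ties R to the 0-cell v, as Q is empty; the condition on the starting
        -- point holds because X has a single 0-cell.
        obtain ⟨Z, ψ, ι, hext, hcoc, hψ, hle, t, ht, hta⟩ :=
          exists_cell_lift hφ hx hfull hw₂ (s := s) (by rw [h2]; exact hper) j (s' := s) (m := k)
            (l := []) (r := []) rfl rfl (by simpa using h2) (Subsingleton.elim _ _) rfl hj.symm
        obtain ⟨g', hg', hgg'⟩ := hcoc G g hg
        have hxz : ψ.onV (ι.onV y) = x := by
          rw [← hx, ← hext.comp]; rfl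
        have hcomp : ∀ u : List Y.D, (u.map ι.onD).map ψ.onD = u.map φ.onD := fun u => by
          rw [← hext.comp, List.map_map]; rfl
        -- By uniqueness of lifts, the boundary of the lifted 2-cell starts with the lift of Q, so
        -- the path can be pushed across it in Z.
        have hbt : boundaryPath t = w₂.map ι.onD ++ (boundaryPath t).drop k := by
          conv_lhs => rw [← List.take_append_drop k (boundaryPath t)]
          congr 1
          have hbw := isWalk_boundaryPath t
          rw [hta] at hbw
          rw [← List.take_append_drop k (boundaryPath t)] at hbw
          obtain ⟨z, hz, -⟩ := isWalk_append_iff.1 hbw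
          refine hψ.walk_unique hz (ι.isWalk hw₂) ?_
          rw [List.map_take, ψ.map_boundaryPath, ht, htake, hcomp, h2]
        have hbw := isWalk_boundaryPath t
        rw [hta, hbt] at hbw
        obtain ⟨z, hz, hz'⟩ := isWalk_append_iff.1 hbw
        obtain rfl := hz.end_unique (ι.isWalk hw₂)
        have hmap' : (w₁.map ι.onD ++ (revPath ((boundaryPath t).drop k) ++ w₃.map ι.onD)).map ψ.onD
            = w₁.map φ.onD ++ (revPath ((boundaryPath s).drop k) ++ w₃.map φ.onD) := by
          rw [List.map_append, List.map_append, hcomp, hcomp, ψ.map_revPath, List.map_drop,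
            ψ.map_boundaryPath, ht]
        have hne' : ((w₁.map ι.onD ++
            (revPath ((boundaryPath t).drop k) ++ w₃.map ι.onD)).map g').prod ≠ 1 := by
          have hprod : ∀ u : List Y.D, ((u.map ι.onD).map g').prod = (u.map g).prod := fun u => by
            rw [List.map_map]
            congr 1
            exact List.map_congr_left fun d _ => hgg' d
          have hcell := hg'.cell t
          rw [hbt, List.map_append, List.prod_append, hprod, mul_eq_one_iff_eq_inv] at hcell
          rw [List.map_append, List.prod_append, List.map_append, List.prod_append, hprod, hprod,
            IsCocycle.prod_revPath hg'.inv, ← hcell]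
          simpa using hne
        obtain ⟨Z', ψ', ι', hext', hlt⟩ := ih hψ (hext.compact hc) hxz hg' (a := ι.onV a)
          ((ι.isWalk hw₁).append (hz'.rev.append (ι.isWalk hw₃))) hmap' hne'
        exact ⟨Z', ψ', ι'.comp ι, hext.trans hext', hlt.trans_le hle⟩
      · push Not at hfull
        obtain ⟨s, a, b, w, hw, hl, hs⟩ := hfull
        exact exists_of_boundaryPath_lift hx hc hφ hw hl fun ⟨t, ht, ht'⟩ => hs t ht ht'

end WeightedComplex

namespace TwoComplex

variable {X Y Z : TwoComplex.{u}}

/-! ### Components -/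

/-- The component of a 0-cell. -/
def component (Z : TwoComplex.{u}) (z : Z.V) : TwoComplex.{u} where
  V := {v : Z.V // Reach z v}
  D := {d : Z.D // Reach z (Z.src d)}
  S := {s : Z.S // Reach z (Z.src (Z.lab s))}
  src d := ⟨Z.src d.1, d.2⟩
  inv d := ⟨Z.inv d.1, d.2.trans (reach_step d.1)⟩
  inv_inv d := Subtype.ext (Z.inv_inv d.1)
  inv_ne d h := Z.inv_ne d.1 (congrArg Subtype.val h)
  next s := ⟨Z.next s.1, by rw [src_lab_next']; exact s.2.trans (reach_step _)⟩
  flip s := ⟨Z.flip s.1, by rw [Z.lab_flip]; exact s.2.trans (reach_step _)⟩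
  lab s := ⟨Z.lab s.1, s.2⟩
  flip_flip s := Subtype.ext (Z.flip_flip s.1)
  next_flip_next s := Subtype.ext (Z.next_flip_next s.1)
  next_periodic s := by
    obtain ⟨n, hn, h⟩ := Z.next_periodic s.1
    refine ⟨n, hn, Subtype.ext ?_⟩
    rw [(Function.Semiconj.iterate_right (f := Subtype.val) (ga := _) (gb := Z.next)
      (fun _ => rfl) n).eq, h]
  lab_flip s := Subtype.ext (Z.lab_flip s.1)
  src_lab_next s := Subtype.ext (Z.src_lab_next s.1)
  lab_next_ne s h := Z.lab_next_ne s.1 (congrArg Subtype.val h)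

theorem component_next_iterate (z : Z.V) (n : ℕ) (s : (component Z z).S) :
    ((component Z z).next^[n] s).1 = Z.next^[n] s.1 :=
  (Function.Semiconj.iterate_right (f := Subtype.val) (ga := (component Z z).next) (gb := Z.next)
    (fun _ => rfl) n).eq s

/-- The inclusion of a component. -/
def componentIncl (Z : TwoComplex.{u}) (z : Z.V) : Hom (component Z z) Z where
  onV := Subtype.val
  onD := Subtype.val
  onS := Subtype.val
  src_onD _ := rfl
  inv_onD _ := rfl
  next_onS _ := rfl
  flip_onS _ := rfl
  lab_onS _ := rfl
  next_iterate s n h := Subtype.ext ((component_next_iterate z n s).trans h)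

/-- A map whose image lies in a component. -/
def toComponent (ι : Hom Y Z) (z : Z.V) (h : ∀ v, Reach z (ι.onV v)) :
    Hom Y (component Z z) where
  onV v := ⟨ι.onV v, h v⟩
  onD d := ⟨ι.onD d, by rw [ι.src_onD]; exact h _⟩
  onS s := ⟨ι.onS s, by rw [ι.lab_onS, ι.src_onD]; exact h _⟩
  src_onD d := Subtype.ext (ι.src_onD d)
  inv_onD d := Subtype.ext (ι.inv_onD d)
  next_onS s := Subtype.ext (ι.next_onS s)
  flip_onS s := Subtype.ext (ι.flip_onS s)
  lab_onS s := Subtype.ext (ι.lab_onS s)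
  next_iterate s n h' := ι.next_iterate s n
    ((component_next_iterate z n _).symm.trans (congrArg Subtype.val h'))

theorem component_isConnected (z : Z.V) : (component Z z).IsConnected := by
  have key : ∀ (p : List Z.D) (a b : (component Z z).V), IsWalk a.1 p b.1 →
      ∃ q, IsWalk a q b := by
    intro p
    induction p with
    | nil => intro a b h; exact ⟨[], Subtype.ext h⟩
    | cons d p ih =>
      intro a b h
      have hd : Reach z (Z.src d) := by rw [h.1]; exact a.2
      obtain ⟨q, hq⟩ := ih ⟨Z.tgt d, hd.trans (reach_step d)⟩ b h.2
      exact ⟨⟨d, hd⟩ :: q, Subtype.ext h.1, hq⟩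
  refine isConnected_of_base ⟨z, [], rfl⟩ fun v => ?_
  obtain ⟨p, hp⟩ := v.2
  exact key p _ v hp

/-- In a component every 0-cell other than z is the source of a 1-cell, so finitely many 1-cells
suffice. The complex `split` may have infinitely many 0-cells. -/
theorem component_isCompact (z : Z.V) (hD : Finite Z.D) (hS : Finite Z.S) :
    (component Z z).IsCompact := by
  refine ⟨?_, inferInstanceAs (Finite {d : Z.D // _}), inferInstanceAs (Finite {s : Z.S // _})⟩
  have : Finite (Option (component Z z).D) :=
    inferInstanceAs (Finite (Option {d : Z.D // Reach z (Z.src d)}))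
  refine Finite.of_surjective (fun o : Option (component Z z).D =>
    o.elim (⟨z, [], rfl⟩ : (component Z z).V) (component Z z).src) ?_
  rintro ⟨v, p, hp⟩
  rcases p.eq_nil_or_concat with rfl | ⟨q, d, rfl⟩
  · obtain rfl : z = v := hp
    exact ⟨none, rfl⟩
  · rw [List.concat_eq_append, isWalk_snoc_iff] at hp
    obtain ⟨hq, rfl⟩ := hp
    exact ⟨some ⟨Z.inv d, hq.reach.trans (reach_step d)⟩, rfl⟩

/-! ### Collapsing the 0-cells -/

/-- The complex with the same 1-cells and 2-cells in which all 0-cells are identified. -/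
def collapse (X : TwoComplex.{u}) : TwoComplex.{u} where
  V := PUnit
  D := X.D
  S := X.S
  src _ := ⟨⟩
  inv := X.inv
  inv_inv := X.inv_inv
  inv_ne := X.inv_ne
  next := X.next
  flip := X.flip
  lab := X.lab
  flip_flip := X.flip_flip
  next_flip_next := X.next_flip_next
  next_periodic := X.next_periodic
  lab_flip := X.lab_flip
  src_lab_next _ := rfl
  lab_next_ne := X.lab_next_ne

/-- The projection which identifies all 0-cells. -/
def toCollapse (X : TwoComplex.{u}) : Hom X X.collapse where
  onV _ := ⟨⟩
  onD d := d
  onS s := s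
  src_onD _ := rfl
  inv_onD _ := rfl
  next_onS _ := rfl
  flip_onS _ := rfl
  lab_onS _ := rfl
  next_iterate _ _ h := h

/-- The map of packets. -/
def packetToCollapse (s : X.S) : Hom (packet s) (packet (X := X.collapse) s) where
  onV := fun c : Cyc s => (⟨c.val, c.mem⟩ : Cyc (X := X.collapse) s)
  onD := fun d : Cyc s × Bool => ((⟨d.1.val, d.1.mem⟩ : Cyc (X := X.collapse) s), d.2)
  onS := fun t : PacketSide s => (⟨⟨t.pos.val, t.pos.mem⟩, ⟨t.cell.val, t.cell.mem⟩, t.same, t.dir⟩ :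
    PacketSide (X := X.collapse) s)
  src_onD := by rintro ⟨c, _ | _⟩ <;> rfl
  inv_onD _ := rfl
  next_onS := by rintro ⟨c, c', h, _ | _⟩ <;> rfl
  flip_onS _ := rfl
  lab_onS _ := rfl
  next_iterate := by
    rintro t n h
    have h1 := (packetMap (X := X.collapse) s).next_iterate_onS
      (⟨⟨t.pos.val, t.pos.mem⟩, ⟨t.cell.val, t.cell.mem⟩, t.same, t.dir⟩ :
        PacketSide (X := X.collapse) s) n
    rw [h] at h1
    refine (packetMap s).next_iterate t n ?_
    obtain ⟨c, c', hs, _ | _⟩ := t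
    · exact h1
    · exact h1

/-- The complex over `X` obtained from a complex over the collapse of `X` by splitting 0-cells. -/
def split {W : TwoComplex.{u}} (ψ : Hom W X.collapse) : TwoComplex.{u} where
  V := W.V × X.V
  D := W.D
  S := W.S
  src d := (W.src d, X.src (ψ.onD d))
  inv := W.inv
  inv_inv := W.inv_inv
  inv_ne := W.inv_ne
  next := W.next
  flip := W.flip
  lab := W.lab
  flip_flip := W.flip_flip
  next_flip_next := W.next_flip_next
  next_periodic := W.next_periodic
  lab_flip := W.lab_flip
  src_lab_next s := by
    refine Prod.ext (W.src_lab_next s) ?_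
    change X.src (ψ.onD (W.lab (W.next s))) = X.src (ψ.onD (W.inv (W.lab s)))
    rw [← ψ.inv_onD, ← ψ.lab_onS, ← ψ.lab_onS, ← ψ.next_onS]
    exact X.src_lab_next _
  lab_next_ne := W.lab_next_ne

section Split

variable {W : TwoComplex.{u}} (ψ : Hom W X.collapse)

/-- The map to `X`. -/
def splitMap : Hom (split ψ) X where
  onV := Prod.snd
  onD := ψ.onD
  onS := ψ.onS
  src_onD _ := rfl
  inv_onD := ψ.inv_onD
  next_onS := ψ.next_onS
  flip_onS := ψ.flip_onS
  lab_onS := ψ.lab_onS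
  next_iterate := ψ.next_iterate

/-- The projection to the original complex. -/
def splitProj : Hom (split ψ) W where
  onV := Prod.fst
  onD d := d
  onS s := s
  src_onD _ := rfl
  inv_onD _ := rfl
  next_onS _ := rfl
  flip_onS _ := rfl
  lab_onS _ := rfl
  next_iterate _ _ h := h

/-- The map from a complex over `X`. -/
def toSplit {φ : Hom Y X} {ι : Hom Y W} (h : ψ.comp ι = X.toCollapse.comp φ) :
    Hom Y (split ψ) where
  onV v := (ι.onV v, φ.onV v)
  onD := ι.onD
  onS := ι.onS
  src_onD d := by
    refine Prod.ext (ι.src_onD d) ?_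
    have : ψ.onD (ι.onD d) = φ.onD d := congrArg (fun f => Hom.onD f d) h
    change X.src (ψ.onD (ι.onD d)) = φ.onV (Y.src d)
    rw [← φ.src_onD]
    exact congrArg X.src this
  inv_onD := ι.inv_onD
  next_onS := ι.next_onS
  flip_onS := ι.flip_onS
  lab_onS := ι.lab_onS
  next_iterate := ι.next_iterate

end Split

/-- The conditions on a cocycle do not mention 0-cells. A cocycle detecting the fundamental group of
X is therefore one on the collapse, and is invariant under homotopies that pass through lists which
are not paths of X. -/
theorem homot_of_homot_collapse {x : X.V} {p q : List X.D} (hp : IsWalk x p x)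
    (hq : IsWalk x q x) {a b : X.collapse.V} (h : Homot (X := X.collapse) a b p q) :
    Homot x x p q := by
  obtain ⟨g, hg, hloop⟩ := exists_cocycle x
  have hg' : IsCocycle (Y := X.collapse) g := ⟨hg.inv, hg.cell⟩
  have h1 : (p.map g).prod = (q.map g).prod := hg'.homot h
  rw [hloop p hp, hloop q hq] at h1
  exact ⟨hp, hq, Quotient.exact h1⟩

end TwoComplex

/-! ### From the collapsed complex back to X -/

namespace WeightedComplex

variable {X : WeightedComplex.{u}} {Y Z : TwoComplex.{u}}

/-- Y is a subcomplex containing every 2-cell of Z along its 1-cells, so what is missing in Y is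
missing in Z. -/
theorem perimeter_comp_le_of_full (ψ : Hom Z X.toTwoComplex) (j : Hom Y Z)
    (hj : Function.Injective j.onD)
    (hfull : ∀ d t, Z.lab t = j.onD d → ∃ t', Y.lab t' = d ∧ j.onS t' = t) :
    perimeter (ψ.comp j) ≤ perimeter ψ := by
  have hje : Function.Injective j.onEdge := by
    intro e e' h
    obtain ⟨d, rfl⟩ := Quotient.exists_rep e
    obtain ⟨d', rfl⟩ := Quotient.exists_rep e'
    rcases edge_eq_iff.1 (show edge (j.onD d) = edge (j.onD d') from h) with h | h
    · exact congrArg edge (hj h)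
    · rw [j.inv_onD] at h
      exact edge_eq_iff.2 (Or.inr (hj h))
  have hp : ∀ (e : Y.Edge) (σ : X.Side), Present ψ (j.onEdge e) σ → Present (ψ.comp j) e σ := by
    rintro e σ ⟨τ, h1, rfl⟩
    obtain ⟨d, rfl⟩ := Quotient.exists_rep e
    obtain ⟨t, rfl⟩ := Quotient.exists_rep τ
    rcases edge_eq_iff.1 (show edge (Z.lab t) = edge (j.onD d) from h1) with h | h
    · obtain ⟨t', rfl, rfl⟩ := hfull d t h
      exact ⟨side t', rfl, rfl⟩
    · rw [j.inv_onD] at h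
      obtain ⟨t', h2, rfl⟩ := hfull _ t h
      exact ⟨side t', (congrArg edge h2).trans (edge_inv d), rfl⟩
  rw [perimeter_eq_tsum, perimeter_eq_tsum]
  let F : MissingSide (ψ.comp j) → MissingSide ψ := fun p =>
    ⟨j.onEdge p.1, p.2, (ψ.comp_onEdge j p.1) ▸ p.2.2.1, fun h => p.2.2.2 (hp _ _ h)⟩
  have hF : Function.Injective F := fun p q h =>
    MissingSide.ext (hje (congrArg (fun r => r.1) h))
      (congrArg (fun r : MissingSide ψ => (r.2 : X.Side)) h)
  exact ENNReal.tsum_comp_le_tsum_of_injective hF fun p => (X.wt p.2 : ℝ≥0∞)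

/-- The weighted complex in which all 0-cells are identified. -/
def collapse (X : WeightedComplex.{u}) : WeightedComplex.{u} where
  toTwoComplex := X.toTwoComplex.collapse
  wt := X.wt
  perimeter_finite := X.perimeter_finite
  weight_pos := X.weight_pos

instance : Subsingleton X.collapse.V := inferInstanceAs (Subsingleton PUnit)

theorem perimeter_toCollapse (φ : Hom Y X.toTwoComplex) :
    perimeter (X := X.collapse) (X.toTwoComplex.toCollapse.comp φ) = perimeter φ := rfl

theorem perimeter_splitMap (ψ : Hom Y X.collapse.toTwoComplex) :
    perimeter (X := X) (splitMap (X := X.toTwoComplex) ψ) = perimeter (X := X.collapse) ψ := rfl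

/-- Packets are determined by the labels of the boundary path and do not depend on the 0-cells of X.
-/
theorem reductionStep_collapse {p q : List X.D} (h : ReductionStep (X := X) p q) :
    ReductionStep (X := X.collapse) p q := by
  cases h with
  | backtrack p q d => exact .backtrack (X := X.collapse) p q d
  | push s k _ _ h =>
    refine .push (X := X.collapse) s k p q ⟨h.1, h.2.1, le_trans ?_ h.2.2⟩
    refine le_trans (perimeter_le_of_surjective (X := X.collapse)
      (φ := X.toTwoComplex.toCollapse.comp (packetMap s))
      (ι := packetToCollapse (X := X.toTwoComplex) s) ?_ ?_) (perimeter_toCollapse _).le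
    · refine Hom.ext_maps (fun _ => rfl) ?_ ?_
      · rintro ⟨c, _ | _⟩ <;> rfl
      · rintro ⟨c, c', h, _ | _⟩ <;> rfl
    · intro e
      obtain ⟨c, rfl⟩ := packet_edge_eq e
      exact ⟨edge (X := packet s) (⟨c.val, c.mem⟩, true), rfl⟩

/-- Path reduction implies perimeter reduction. -/
theorem perimeterReduction (hX : X.PathReductionHypothesis) : X.PerimeterReductionHypothesis := by
  intro Y y x φ h hc hY hφ hinj
  obtain ⟨w, hw, hne, hnull⟩ : ∃ (w : List Y.D) (hw : IsWalk y w y), loopClass w hw ≠ 1 ∧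
      NullHomotopic (φ.onLoop h ⟨w, hw⟩) := by
    rw [injective_iff_map_eq_one] at hinj
    push Not at hinj
    obtain ⟨g, hg, hg1⟩ := hinj
    obtain ⟨⟨w, hw⟩, rfl⟩ := Quotient.exists_rep g
    exact ⟨w, hw, hg1, Quotient.exact hg⟩
  obtain ⟨g, hg, hloop⟩ := exists_cocycle y
  have hwne : w.map φ.onD ≠ [] := by
    intro h0
    rw [List.map_eq_nil_iff] at h0
    subst h0
    exact hne rfl
  -- A push along an empty Q need not use a 2-cell based at the current 0-cell, so the intermediate
  -- lists may fail to be paths of X. In the collapse all of them are closed paths.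
  have hred : Relation.ReflTransGen (ReductionStep (X := X.collapse)) (w.map φ.onD) [] :=
    Relation.ReflTransGen.mono (r := ReductionStep (X := X))
      (fun _ _ => reductionStep_collapse) _ _ (hX x (φ.onLoop h ⟨w, hw⟩) hwne hnull)
  let q := X.toTwoComplex.toCollapse
  obtain ⟨W, ψ, ι, hext, hlt⟩ := exists_smaller_extension (X := X.collapse) hred
    (φ := q.comp φ) hφ hc (x := q.onV x) (y := y) (Subsingleton.elim _ _) hg hw rfl
    (by rwa [hloop w hw])
  -- The 0-cells are separated again according to their position in X. This may disconnect the
  -- complex, whence the passage to the component of the base point.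
  let ι₁ := toSplit (X := X.toTwoComplex) ψ hext.comp
  let z := ι₁.onV y
  let j := componentIncl (split (X := X.toTwoComplex) ψ) z
  let ι₂ := toComponent ι₁ z fun v => by
    obtain ⟨p, hp⟩ := hY.2 y v
    exact ⟨_, ι₁.isWalk hp⟩
  let φ' := (splitMap (X := X.toTwoComplex) ψ).comp j
  have hD : ∀ d, ψ.onD (ι.onD d) = φ.onD d := fun d =>
    congrArg (fun f : Hom Y X.collapse.toTwoComplex => f.onD d) hext.comp
  have hS : ∀ s, ψ.onS (ι.onS s) = φ.onS s := fun s =>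
    congrArg (fun f : Hom Y X.collapse.toTwoComplex => f.onS s) hext.comp
  have hcomp : φ'.comp ι₂ = φ := Hom.ext_maps (fun _ => rfl) hD hS
  have hWc := hext.compact hc
  have h' : φ'.onV (ι₂.onV y) = x := h
  refine ⟨component (split (X := X.toTwoComplex) ψ) z, ι₂.onV y, φ', h', ι₂, rfl, hcomp,
    component_isCompact z hWc.2.1 hWc.2.2, component_isConnected z, ?_, ?_⟩
  · refine lt_of_le_of_lt ?_ hlt
    refine (perimeter_comp_le_of_full _ j Subtype.val_injective ?_).trans
      (perimeter_splitMap ψ).le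
    rintro ⟨d, hd⟩ t (ht : (split (X := X.toTwoComplex) ψ).lab t = d)
    subst ht
    exact ⟨⟨t, hd⟩, rfl, rfl⟩
  · refine range_eq_of_imageClasses h hcomp h' ?_
    rintro p ⟨u, hu, hp⟩
    have hu' : IsWalk (ι.onV y) (u.map j.onD) (ι.onV y) := by
      have := (splitProj (X := X.toTwoComplex) ψ).isWalk (j.isWalk hu)
      have e : (u.map j.onD).map (splitProj (X := X.toTwoComplex) ψ).onD = u.map j.onD :=
        List.map_id _
      exact (congrArg (fun l => IsWalk (X := W) (ι.onV y) l (ι.onV y)) e).mp this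
    -- A closed path of the component is one of W, so its image is homotopic in the collapse to the
    -- image of a closed path of Y. Both images are closed paths of X at x, hence homotopic in X.
    obtain ⟨v, hv, hpv⟩ := hext.image ⟨u.map j.onD, hu', .refl (ψ.isWalk hu')⟩
    refine ⟨v, hv, hp.trans ?_⟩
    have hv' := φ.isWalk hv
    have hu2 := φ'.isWalk hu
    rw [h'] at hu2
    have : φ'.onV (ι₂.onV y) = φ.onV y := h'.trans h.symm
    rw [h] at hv'
    have key : Homot x x (u.map φ'.onD) (v.map φ.onD) := by
      refine homot_of_homot_collapse hu2 hv' (a := q.onV x) (b := ψ.onV (ι.onV y)) ?_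
      have e : u.map φ'.onD = (u.map j.onD).map ψ.onD :=
        (List.map_map (l := u) (f := j.onD) (g := ψ.onD)).symm
      rw [e]
      exact hpv
    rw [h']
    exact key

end WeightedComplex

namespace TwoComplex

variable {X Y Z : TwoComplex.{u}}

/-! ### Realizing finitely generated subgroups -/

/-- The closed paths whose classes belong to a subgroup of the fundamental group. -/
def loopSet {x : X.V} (H : Subgroup (Pi1 X x)) : Set (List X.D) :=
  {p | ∃ hp : IsWalk x p x, loopClass p hp ∈ H}

section LoopSet

variable {x : X.V} {H : Subgroup (Pi1 X x)} {p q : List X.D}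

theorem nil_mem_loopSet : [] ∈ loopSet H := ⟨rfl, H.one_mem⟩

theorem append_mem_loopSet_iff_left (hq : q ∈ loopSet H) :
    p ++ q ∈ loopSet H ↔ p ∈ loopSet H := by
  obtain ⟨hq, hqH⟩ := hq
  constructor
  · rintro ⟨hpq, h⟩
    obtain ⟨b, hp, hq'⟩ := isWalk_append_iff.1 hpq
    have hb := hq'.rev.end_unique hq.rev
    subst hb
    exact ⟨hp, (H.mul_mem_cancel_right hqH).1 ((loopClass_mul hp hq) ▸ h)⟩
  · rintro ⟨hp, h⟩
    exact ⟨hp.append hq, (loopClass_mul hp hq) ▸ H.mul_mem h hqH⟩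

theorem mem_loopSet_of_homot (hp : p ∈ loopSet H) (h : Homot x x q p) : q ∈ loopSet H :=
  ⟨h.left, loopClass_eq h ▸ hp.2⟩

theorem range_le_iff {φ : Hom Y X} {y : Y.V} (h : φ.onV y = x) :
    (φ.pi1Map h).range ≤ H ↔ imageClasses φ x y y ⊆ loopSet H := by
  constructor
  · intro hH p hp
    have hw := isWalk_of_mem hp
    rw [h] at hw
    exact ⟨hw, hH ((mk_mem_range_iff h ⟨p, hw⟩).2 hp)⟩
  · intro hH g hg
    obtain ⟨p, rfl⟩ := Quotient.exists_rep g
    exact (hH ((mk_mem_range_iff h p).1 hg)).2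

/-- The paths which, up to homotopy, start with a closed path representing an element of `H` and
continue with the image of a path from `y` to `v`. -/
def cosetSet (φ : Hom Y X) (y : Y.V) (H : Subgroup (Pi1 X x)) (v : Y.V) : Set (List X.D) :=
  {p | ∃ k ∈ loopSet H, ∃ q ∈ imageClasses φ x y v, Homot x (φ.onV v) p (k ++ q)}

/-- At every 0-cell over x reached by a path representing an element of H, the coset set is that of
the base point. The corresponding quotient thus closes up all such paths while its π₁-image stays in
H. -/
theorem cosetSet_eq_loopSet {φ : Hom Y X} {y v : Y.V} (h : φ.onV y = x)
    (hH : (φ.pi1Map h).range ≤ H) (hv : φ.onV v = x) (hpv : p ∈ imageClasses φ x y v)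
    (hp : p ∈ loopSet H) : cosetSet φ y H v = loopSet H := by
  rw [range_le_iff] at hH
  have hcancel : ∀ q, IsWalk x q x → Homot x x ((q ++ revPath p) ++ p) q := fun q hq =>
    Homot.cancel_right' hq hp.1
  ext q
  constructor
  · rintro ⟨k, hk, r, hr, hq⟩
    have hrw := isWalk_of_mem hr
    rw [hv] at hrw
    have hrp : r ++ revPath p ∈ imageClasses φ x y y := by
      obtain ⟨w, hw, hpw⟩ := hpv
      obtain ⟨w', hw', hrw'⟩ := hr
      refine ⟨w' ++ revPath w, hw'.append hw.rev, ?_⟩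
      rw [List.map_append, φ.map_revPath]
      rw [hv] at hpw hrw'
      rw [h]
      refine hrw'.append ?_
      obtain ⟨h1, h2, h3⟩ := hpw
      exact ⟨h1.rev, h2.rev, walk_rev_congr h3⟩
    have hrH : r ∈ loopSet H :=
      mem_loopSet_of_homot ((append_mem_loopSet_iff_left hp).2 (hH hrp)) (hcancel r hrw).symm
    rw [hv] at hq
    exact mem_loopSet_of_homot ((append_mem_loopSet_iff_left hrH).2 hk) hq
  · intro hq
    refine ⟨q ++ revPath p, (append_mem_loopSet_iff_left hp).1
      (mem_loopSet_of_homot hq (hcancel q hq.1)), p, hpv, ?_⟩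
    rw [hv]
    exact (hcancel q hq.1).symm

end LoopSet

/-- A path in `X` which starts at the image of a 0-cell can be lifted to an extension. -/
theorem exists_walk_extension {x : X.V} (p : List X.D) {c : X.V} :
    ∀ {Y : TwoComplex.{u}} {φ : Hom Y X} {y : Y.V} (_ : φ.onV y = x) (b : Y.V),
      IsWalk (φ.onV b) p c → ∃ (Z : TwoComplex.{u}) (ψ : Hom Z X) (ι : Hom Y Z) (w : List Z.D)
        (v : Z.V), IsExtension φ ψ ι x y ∧ IsWalk (ι.onV b) w v ∧ w.map ψ.onD = p := by
  induction p with
  | nil => exact fun {Y φ y} h b _ => ⟨Y, φ, Hom.id Y, [], b, .refl φ x y, rfl, rfl⟩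
  | cons e p ih =>
    rintro Y φ y h b ⟨he, hp⟩
    obtain ⟨Z, ψ, ι, e', hext, -, -, hs, rfl, -⟩ := exists_pendant h b e he
    have hι : ψ.onV (ι.onV y) = x := by
      rw [← h, ← hext.comp]
      rfl
    rw [ψ.tgt_onD] at hp
    obtain ⟨W, χ, κ, w, v, hext', hw, rfl⟩ := ih hι (Z.tgt e') hp
    have hD : χ.onD (κ.onD e') = ψ.onD e' := congrArg (fun f => Hom.onD f e') hext'.comp
    refine ⟨W, χ, κ.comp ι, κ.onD e' :: w, v, hext.trans hext', ⟨?_, ?_⟩, ?_⟩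
    · rw [κ.src_onD, hs]
      rfl
    · rwa [κ.tgt_onD]
    · rw [List.map_cons, hD]

theorem range_le_range_comp {φ : Hom Y X} {ψ : Hom Z X} {ι : Hom Y Z} {x : X.V} {y : Y.V}
    (h : φ.onV y = x) (hι : ψ.comp ι = φ) (h' : ψ.onV (ι.onV y) = x) :
    (φ.pi1Map h).range ≤ (ψ.pi1Map h').range := by
  subst hι
  rintro _ ⟨⟨w⟩, rfl⟩
  refine ⟨Quotient.mk _ ⟨w.1.map ι.onD, ι.isWalk w.2⟩, ?_⟩
  exact congrArg (Quotient.mk _) (Subtype.ext (List.map_map (f := ι.onD) (g := ψ.onD)))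

/-- If the image of the fundamental group is contained in `H`, it can be enlarged by an element of
`H`. -/
theorem exists_loop_extension {φ : Hom Y X} {x : X.V} {y : Y.V} (h : φ.onV y = x)
    {H : Subgroup (Pi1 X x)} (hH : (φ.pi1Map h).range ≤ H) {g : Pi1 X x} (hg : g ∈ H) :
    ∃ (Z : TwoComplex.{u}) (ψ : Hom Z X) (z : Z.V) (h' : ψ.onV z = x),
      (Y.IsCompact → Z.IsCompact) ∧ (Y.IsConnected → Z.IsConnected) ∧
      (φ.pi1Map h).range ≤ (ψ.pi1Map h').range ∧ g ∈ (ψ.pi1Map h').range ∧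
      (ψ.pi1Map h').range ≤ H := by
  obtain ⟨⟨p, hp⟩, rfl⟩ := Quotient.exists_rep g
  obtain ⟨W, χ, κ, w, v, hext, hw, rfl⟩ := exists_walk_extension p h y (c := x) (h.symm ▸ hp)
  have hκ : χ.onV (κ.onV y) = x := by
    rw [← h, ← hext.comp]
    rfl
  have hv : χ.onV v = x := (χ.isWalk hw).end_unique (hκ.symm ▸ hp)
  have hHχ : (χ.pi1Map hκ).range ≤ H := by
    rw [range_le_iff] at hH ⊢
    exact hext.image.trans hH
  have hvw : w.map χ.onD ∈ imageClasses χ x (κ.onV y) v := append_mem (nil_mem hκ) hw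
  have hwH : w.map χ.onD ∈ loopSet H := ⟨hp, hg⟩
  have hK := cosetSet_eq_loopSet hκ hHχ hκ (nil_mem hκ) nil_mem_loopSet
  obtain ⟨Z, ψ, ι, hcomp, hcp, hcn, him, -, -, hid⟩ := exists_quot hκ (cosetSet χ (κ.onV y) H)
    (hK ▸ nil_mem_loopSet) (fun _ _ ⟨_, _, _, _, h⟩ => h.left)
    (fun d p ⟨k, hk, q, hq, h⟩ => ⟨k, hk, q ++ [χ.onD d], step_mem hq, by
      have h1 : IsWalk (χ.onV (W.src d)) [χ.onD d] (χ.onV (W.tgt d)) := χ.isWalk (.single d)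
      simpa using h.append (.refl h1)⟩)
    fun v p q ⟨k, hk, r, hr, h⟩ h' => ⟨k, hk, r, hr, h'.trans h⟩
  have hιv : ι.onV (κ.onV y) = ι.onV v := hid _ _ (hκ.trans hv.symm)
    (hK.trans (cosetSet_eq_loopSet hκ hHχ hv hvw hwH).symm)
  have h' : ψ.onV (ι.onV (κ.onV y)) = x := by
    rw [← hκ, ← hcomp]
    rfl
  refine ⟨Z, ψ, ι.onV (κ.onV y), h', hcp ∘ hext.compact, hcn ∘ hext.connected,
    (range_le_range_comp h hext.comp hκ).trans (range_le_range_comp hκ hcomp h'), ?_, ?_⟩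
  · refine (mk_mem_range_iff h' _).2 ⟨w.map ι.onD, ?_, ?_⟩
    · have := ι.isWalk hw
      rwa [← hιv] at this
    · rw [h']
      subst hcomp
      rw [List.map_map]
      exact .refl hp
  · rw [range_le_iff, ← hK]
    exact him

/-- The complex consisting of one 0-cell. -/
def point : TwoComplex.{u} where
  V := PUnit
  D := PEmpty
  S := PEmpty
  src := PEmpty.elim
  inv := PEmpty.elim
  inv_inv := nofun
  inv_ne := nofun
  next := PEmpty.elim
  flip := PEmpty.elim
  lab := PEmpty.elim
  flip_flip := nofun
  next_flip_next := nofun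
  next_periodic := nofun
  lab_flip := nofun
  src_lab_next := nofun
  lab_next_ne := nofun

/-- The map of a point. -/
def pointMap (x : X.V) : Hom point X where
  onV _ := x
  onD := PEmpty.elim
  onS := PEmpty.elim
  src_onD := nofun
  inv_onD := nofun
  next_onS := nofun
  flip_onS := nofun
  lab_onS := nofun
  next_iterate := nofun

/-- Finitely generated subgroups are the images of the fundamental groups of compact connected
complexes. -/
theorem exists_range_eq {x : X.V} {H : Subgroup (Pi1 X x)} (hH : H.FG) :
    ∃ (Y : TwoComplex.{u}) (φ : Hom Y X) (y : Y.V) (h : φ.onV y = x), Y.IsCompact ∧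
      Y.IsConnected ∧ (φ.pi1Map h).range = H := by
  classical
  obtain ⟨S, hS⟩ := hH
  have key : ∀ T : Finset (Pi1 X x), (T : Set (Pi1 X x)) ⊆ H →
      ∃ (Y : TwoComplex.{u}) (φ : Hom Y X) (y : Y.V) (h : φ.onV y = x), Y.IsCompact ∧
        Y.IsConnected ∧ (T : Set (Pi1 X x)) ⊆ (φ.pi1Map h).range ∧
        (φ.pi1Map h).range ≤ H := by
    intro T
    induction T using Finset.induction_on with
    | empty =>
      refine fun _ => ⟨point, pointMap x, ⟨⟩, rfl, ⟨inferInstanceAs (Finite PUnit),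
        inferInstanceAs (Finite PEmpty), inferInstanceAs (Finite PEmpty)⟩,
        ⟨⟨⟨⟩⟩, fun _ _ => ⟨[], rfl⟩⟩, by simp, ?_⟩
      rintro _ ⟨⟨⟨_ | ⟨d, _⟩, _⟩⟩, rfl⟩
      · exact H.one_mem
      · exact d.elim
    | insert g T _ ih =>
      intro hT
      rw [Finset.coe_insert, Set.insert_subset_iff] at hT
      obtain ⟨Y, φ, y, h, hc, hY, h1, h2⟩ := ih hT.2
      obtain ⟨Z, ψ, z, h', hc', hY', h3, h4, h5⟩ := exists_loop_extension h h2 hT.1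
      refine ⟨Z, ψ, z, h', hc' hc, hY' hY, ?_, h5⟩
      rw [Finset.coe_insert, Set.insert_subset_iff]
      exact ⟨h4, h1.trans h3⟩
  obtain ⟨Y, φ, y, h, hc, hY, h1, h2⟩ := key S (hS ▸ Subgroup.subset_closure)
  exact ⟨Y, φ, y, h, hc, hY, le_antisymm h2 (hS ▸ (Subgroup.closure_le _).2 h1)⟩

end TwoComplex

namespace WeightedComplex

variable {X : WeightedComplex.{u}}

/-- Perimeter reduction implies coherence. -/
theorem isCoherentGroup (hX : X.PerimeterReductionHypothesis) (x : X.V) :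
    IsCoherentGroup (Pi1 X.toTwoComplex x) := by
  intro H hH
  let P : ℕ → Prop := fun n => ∃ (Y : TwoComplex.{u}) (φ : Hom Y X.toTwoComplex) (y : Y.V)
    (h : φ.onV y = x), Y.IsCompact ∧ Y.IsConnected ∧ (φ.pi1Map h).range = H ∧ perimeter φ ≤ n
  have hP : ∃ n, P n := by
    obtain ⟨Y, φ, y, h, hc, hY, hr⟩ := exists_range_eq hH
    obtain ⟨n, hn⟩ := exists_nat_eq_perimeter hc φ
    exact ⟨n, Y, φ, y, h, hc, hY, hr, hn.le⟩
  classical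
  obtain ⟨Y, φ, y, h, hc, hY, hr, hn⟩ := Nat.find_spec hP
  obtain ⟨Z, ψ, ι, hext, himm, hsurj, -⟩ := exists_quot_image h
  have h' : ψ.onV (ι.onV y) = x := by
    rw [← h, ← hext.comp]
    rfl
  have hr' := (range_eq_of_imageClasses h hext.comp h' hext.image).trans hr
  have hn' := (perimeter_le_of_surjective hext.comp hsurj).trans hn
  have hcZ := hext.compact hc
  have hZ := hext.connected hY
  by_cases hinj : Function.Injective (ψ.pi1Map h')
  · have := isFinitelyPresented_pi1 hcZ hZ (ι.onV y)
    rw [← hr']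
    exact Group.IsFinitelyPresented.equiv (MonoidHom.ofInjective hinj)
  · obtain ⟨W, w, χ, hw, -, -, -, hcW, hW, hlt, hrW⟩ := hX Z _ x ψ h' hcZ hZ himm hinj
    obtain ⟨m, hm⟩ := exists_nat_eq_perimeter hcW χ
    refine absurd ⟨W, χ, w, hw, hcW, hW, hrW.trans hr', hm.le⟩ (Nat.find_min hP (m := m) ?_)
    have := hlt.trans_le hn'
    rw [hm] at this
    exact_mod_cast this

end WeightedComplex

theorem mainTheorem10 (X : WeightedComplex.{u}) (hX : X.PathReductionHypothesis) :
    X.PerimeterReductionHypothesis ∧ ∀ x : X.V, IsCoherentGroup (Pi1 X.toTwoComplex x) :=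
  have hX' := WeightedComplex.perimeterReduction hX
  ⟨hX', WeightedComplex.isCoherentGroup hX'⟩
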